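/- **The scheme.** There are $k$ levels, each a circle of circumference $1$. Every bin $b$ has, for every level $i\in\{1,\dots,k\}$, one virtual bin at a point $h_i(b)$ of the circle of level $i$. Every ball $x$ has one level, equal to $i$ with probability $p_i$, and one point on the circle of that level. All points are uniform, and all levels and points are independent. A fixed (arbitrary) linear order on the balls is given; a ball has higher priority than another one if its level is lower, or if the levels are equal and it comes first in that order. Given a finite set of balls and a finite set of bins, each of capacity $C$, the balls are placed one by one in order of decreasing priority, each into the first virtual bin, clockwise from its point on the circle of its level, whose bin holds fewer than $C$ balls (all virtual bins of $b$ share the capacity $C$ of $b$; a ball stays unplaced if all bins are full). This determines the allocation as a function of the sets of balls and bins. The number of balls *moved* by an update (insertion or deletion of a ball or a bin, with $C$, $k$ and the hash values kept) is the number of balls whose bin differs before and after it, including the inserted or deleted ball. To *insert* a ball $y$, visit the virtual bins of its level clockwise from its point. If the bin of the current virtual bin is not full, $y$ is placed there and the insertion ends. If it is full and holds a ball of lower priority than $y$, then $y$ replaces the ball $z$ of lowest priority in it, and the procedure continues with $z$ from the virtual bin of that bin at the level of $z$. Otherwise go to the next virtual bin. *Deleting* a ball $x$ visits the virtual bins that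 would be visited if $x$ were inserted into the system without $x$. A *search* for $x$ visits the virtual bins of its level clockwise from its point up to and including the first one whose bin is not filled with $C$ balls of higher priority than $x$. **Theorem.** There is an absolute constant $K>0$ such that the following holds for every function $\delta:\mathbb N\to\mathbb R$ with $\delta(n)\to 0$ and all sufficiently large $n$ (depending on $\delta$). Let $m\ge 1$ be an integer and $0<\varepsilon<1$ be such that $C=(1+\varepsilon)n/m$ is an integer and $1/\varepsilon\le n^{\delta(n)}$. Let $k=\lceil\log_2(1/\varepsilon)\rceil$, and $p_i=2^{-i}$ for $1\le i\le k-1$, $p_k=2^{-k+1}$. Consider the scheme with any $n$ balls in the system and any $m$ bins of capacity $C$. Then: 1. Inserting a ball that is not in the system, or deleting a ball of the system, visits at most $K/\varepsilon$ virtual bins and moves at most $K/\varepsilon$ balls in expectation. 2. Inserting a bin that is not in the system, or deleting a bin of the system, moves at most $KC/\varepsilon$ balls in expectation. 3. Searching a ball (in the system or not) visits at most $K\log(1+1/\varepsilon)$ virtual bins in expectation. -/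

import Mathlib

open MeasureTheory Filter Topology
open scoped ENNReal

namespace BoundedLoads

/-- A realisation of all hash values for `k` levels (`Fin k`; level `i` of the scheme is the index
`i - 1`).  A ball gets one level and one point of that level's unit circle; a super bin `b` gets one
point on the circle of every level, the position of its virtual bin there.  Points of a circle are
numbers in `[0, 1)`. -/
abbrev Hashes (k : ℕ) (Ball Bin : Type*) := (Ball → Fin k × ℝ) × (Bin → Fin k → ℝ)

/-- `p_i = 2^{-i}` for `1 ≤ i ≤ k - 1` and `p_k = 2^{-k+1}` (with the index shifted by one). -/
noncomputable def levelProb (k : ℕ) (i : Fin k) : ℝ≥0∞ :=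
  if i.1 + 1 < k then 2⁻¹ ^ (i.1 + 1) else 2⁻¹ ^ (k - 1)

/-- The law of the level of a ball. -/
noncomputable def levelLaw (k : ℕ) : Measure (Fin k) :=
  Measure.sum fun i => levelProb k i • Measure.dirac i

/-- The uniform law on the unit circle `[0, 1)`. -/
noncomputable def circleLaw : Measure ℝ := volume.restrict (Set.Ico 0 1)

/-- Fully random hashing: all levels and all points are independent, levels of balls follow
`levelLaw`, points are uniform. -/
noncomputable def hashLaw (k : ℕ) (Ball Bin : Type*) [Fintype Ball] [Fintype Bin] :
    Measure (Hashes k Ball Bin) :=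
  (Measure.pi fun _ : Ball => (levelLaw k).prod circleLaw).prod
    (Measure.pi fun _ : Bin => Measure.pi fun _ : Fin k => circleLaw)

variable {k : ℕ} {Ball Bin : Type*} [Fintype Ball] [LinearOrder Ball] [LinearOrder Bin]

/-- The priority of a ball: first by level, then by the given order on the balls.  A smaller value
means a higher priority. -/
def prio (h : Hashes k Ball Bin) (x : Ball) : Fin k ×ₗ Ball := toLex ((h.1 x).1, x)

/-- The balls of `S` from the highest to the lowest priority. -/
noncomputable def byPriority (h : Hashes k Ball Bin) (S : Finset Ball) : List Ball :=
  ((S.image (prio h)).sort (· ≤ ·)).map fun q => (ofLex q).2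

/-- The bins of `T` in the clockwise order in which their virtual bins at level `i` are met from the
point `p` on; `Int.fract (q - p)` is the clockwise distance from `p` to `q`.  (Ties have probability
zero and are broken by the order on the bins.) -/
noncomputable def clockwise (h : Hashes k Ball Bin) (T : Finset Bin) (i : Fin k) (p : ℝ) :
    List Bin :=
  ((T.image fun b => (toLex (Int.fract (h.2 b i - p), b) : ℝ ×ₗ Bin)).sort (· ≤ ·)).map
    fun q => (ofLex q).2

/-- The bins of `T` in the order in which they are probed for the ball `x`. -/
noncomputable def probes (h : Hashes k Ball Bin) (T : Finset Bin) (x : Ball) : List Bin :=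
  clockwise h T (h.1 x).1 (h.1 x).2

/-- The load of the super bin `b` in an assignment of balls to bins (`none`: not in any bin). -/
def load (a : Ball → Option Bin) (b : Bin) : ℕ := (Finset.univ.filter fun y => a y = some b).card

/-- Place `x` in the first virtual bin clockwise from its hash value whose super bin holds fewer
than `C` balls (nowhere, if all super bins are full). -/
noncomputable def placeBall (C : ℕ) (h : Hashes k Ball Bin) (T : Finset Bin)
    (a : Ball → Option Bin) (x : Ball) : Ball → Option Bin :=
  Function.update a x ((probes h T x).find? fun b => load a b < C)

/-- The static image: the assignment of the balls of `S` to the bins of `T`, of capacity `C`,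
obtained by inserting the balls one by one in priority order. -/
noncomputable def image (C : ℕ) (h : Hashes k Ball Bin) (S : Finset Ball) (T : Finset Bin) :
    Ball → Option Bin :=
  (byPriority h S).foldl (placeBall C h T) fun _ => none

/-- The number of balls whose bin differs between two assignments. -/
def moved (a a' : Ball → Option Bin) : ℕ := (Finset.univ.filter fun y => a y ≠ a' y).card

open Classical in
/-- The virtual bins (level, super bin) visited when the ball `y` is inserted into the assignment `a`,
where `l` lists the bins still to be probed for `y`.  At a super bin `b`: if `b` is not full, then
`y` is placed there and the insertion is complete; if `b` is full and holds a ball of lower priority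
than `y`, then `y` takes the place of the lowest-priority ball `z` of `b`, and the insertion goes on
with `z`, starting at the virtual bin of `b` at the level of `z`; otherwise `y` goes on to the next
virtual bin. -/
noncomputable def insertWalk (C : ℕ) (h : Hashes k Ball Bin) (T : Finset Bin)
    (a : Ball → Option Bin) (y : Ball) (l : List Bin) : Finset (Fin k × Bin) :=
  match l with
  | [] => ∅
  | b :: bs =>
    insert ((h.1 y).1, b)
      (if load a b < C then ∅
      else if hz : ∃ z, a z = some b ∧ prio h y < prio h z ∧
          ∀ w, a w = some b → prio h w ≤ prio h z then
        insertWalk C h T (Function.update (Function.update a y (some b)) hz.choose none) hz.choose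
          (clockwise h T (h.1 hz.choose).1 (h.2 b (h.1 hz.choose).1))
      else insertWalk C h T a y bs)
termination_by ((Finset.univ.filter fun w => prio h y < prio h w).card, l.length)
decreasing_by
  · refine Prod.Lex.left _ _ (Finset.card_lt_card ?_)
    have hlt := hz.choose_spec.2.1
    refine (Finset.ssubset_iff_of_subset ?_).2 ⟨hz.choose, by simpa using hlt, by simp⟩
    intro w hw
    simp only [Finset.mem_filter, Finset.mem_univ, true_and] at hw ⊢
    exact hlt.trans hw
  · exact Prod.Lex.right _ (by simp)

/-- The number of virtual bins visited when the ball `x` is inserted into the system with balls `S`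
and bins `T`. -/
noncomputable def insertVisits (C : ℕ) (h : Hashes k Ball Bin) (S : Finset Ball) (T : Finset Bin)
    (x : Ball) : ℕ :=
  (insertWalk C h T (image C h S T) x (probes h T x)).card

/-- The number of virtual bins visited when the ball `x` is deleted from the system with balls `S`
and bins `T`: those of the inverse operation, the insertion of `x` into the system without `x`. -/
noncomputable def deleteVisits (C : ℕ) (h : Hashes k Ball Bin) (S : Finset Ball) (T : Finset Bin)
    (x : Ball) : ℕ :=
  insertVisits C h (S.erase x) T x

/-- The super bin `b` is filled with balls of higher priority than `x`. -/
def FilledAbove (C : ℕ) (h : Hashes k Ball Bin) (a : Ball → Option Bin) (x : Ball) (b : Bin) :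
    Prop :=
  C ≤ (Finset.univ.filter fun y => a y = some b ∧ prio h y < prio h x).card

instance (C : ℕ) (h : Hashes k Ball Bin) (a : Ball → Option Bin) (x : Ball) (b : Bin) :
    Decidable (FilledAbove C h a x b) :=
  inferInstanceAs (Decidable (_ ≤ _))

/-- The number of virtual bins visited when the ball `x` is searched in the system with balls `S` and
bins `T`: the bins clockwise from the hash value of `x` up to and including the first one that is
not filled with balls of higher priority (this one holds `x` if `x` is in the system). -/
noncomputable def searchVisits (C : ℕ) (h : Hashes k Ball Bin) (S : Finset Ball) (T : Finset Bin)
    (x : Ball) : ℕ :=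
  ((probes h T x).takeWhile fun b => FilledAbove C h (image C h S T) x b).length +
    (((probes h T x).dropWhile fun b => FilledAbove C h (image C h S T) x b).take 1).length

end BoundedLoads

/-! Two systems that differ by one ball, or by one unit of the capacity of one bin, are compared
level by level. One of them always has exactly one more free place, situated in a single bin, the
hole (`HoleAt`). When a further ball is placed in both systems, either it makes the same choice in
both, or it fills the hole in one system and goes on clockwise to another bin in the other, and that
bin becomes the hole. Within a level the hole therefore only moves clockwise, each shift costs one
moved ball, and the hole ends in the first bin that is not full after the level (`holeAt_place`,
`holeAt_foldl`). So the balls moved at a level are at most the bins of a `run`, the bins from a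
starting point up to the first one that is not full after the level. The bins visited by an
insertion lie in the same runs (`insertWalk_subset`), and a search stays in the run from the point
of the ball (`searchVisits_le`). Removing a bin means lowering its capacity from `C` to `0` in `C`
steps, each with its own hole (`moved_capacity_le`).

It remains to see that a run at level `i` has expected length of order `2 ^ i`. Let `b` be in the
run from `p`, and consider the arc from the last non-full bin before `p` up to `b`. The bins inside
become full, and since no ball passes a non-full bin, the balls of level `i` that fill them have
their points in this arc (`exists_arc_of_mem_run`). Hence the arc contains at least as many balls of
level `i` as free room before this level. In total, however, the free room `F` exceeds the number of
these balls by a constant factor: the balls of the later levels, of order `n / 2 ^ i` many, are not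
placed yet, and at the last level the slack `ε n` plays their part. By an exponential moment bound
an arc of expected room `w C` is that crowded with probability exponentially small in `w`. Summing
over a grid of arcs and over the bins gives the order `T.card * C / F`, that is `2 ^ i`
(`lintegral_card_run_le`). If the levels are populated badly, a run still has at most `4 n` bins,
and this event has probability of order `2 ^ i / n`.

The expectation can be taken one level at a time, because the loads before level `i` and the hole
entering it do not depend on the circle of level `i`, which may be resampled
(`lintegral_hashLaw_le`, `Admissible.lintegral_weight_mul_run_le`). An update meets one run per
level, of total order `2 ^ k`, that is `1 / ε`. A search meets the run at the level of the ball, and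
as level `i` has probability of order `2 ^ (-i)`, each of the `k` levels contributes a constant. -/

set_option linter.unusedSectionVars false

/-! ### Clockwise distances and the first bin with a given property -/

namespace BoundedLoads

variable {k : ℕ} {Ball Bin : Type*}

/-- The clockwise distance at level `i` from the point `p` to the virtual bin of `b`. -/
noncomputable def cwDist (h : Hashes k Ball Bin) (i : Fin k) (p : ℝ) (b : Bin) : ℝ :=
  Int.fract (h.2 b i - p)

theorem cwDist_nonneg (h : Hashes k Ball Bin) (i : Fin k) (p : ℝ) (b : Bin) :
    0 ≤ cwDist h i p b := Int.fract_nonneg _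

theorem cwDist_lt_one (h : Hashes k Ball Bin) (i : Fin k) (p : ℝ) (b : Bin) :
    cwDist h i p b < 1 := Int.fract_lt_one _

theorem cwDist_self (h : Hashes k Ball Bin) (i : Fin k) (b : Bin) :
    cwDist h i (h.2 b i) b = 0 := by simp [cwDist]

/-- Walking clockwise from `p` to a point, via a point that is met earlier. -/
theorem fract_sub_eq_add {p e q : ℝ} (hle : Int.fract (e - p) ≤ Int.fract (q - p)) :
    Int.fract (q - p) = Int.fract (e - p) + Int.fract (q - e) := by
  have : Int.fract (q - e) = Int.fract (q - p) - Int.fract (e - p) := by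
    rw [Int.fract_eq_iff]
    refine ⟨by linarith, by linarith [Int.fract_lt_one (q - p), Int.fract_nonneg (e - p)],
      ⌊q - p⌋ - ⌊e - p⌋, ?_⟩
    have h1 := Int.floor_add_fract (q - p)
    have h2 := Int.floor_add_fract (e - p)
    push_cast
    linarith
  linarith

theorem cwDist_eq_add {h : Hashes k Ball Bin} {i : Fin k} {p : ℝ} {e b : Bin}
    (hle : cwDist h i p e ≤ cwDist h i p b) :
    cwDist h i p b = cwDist h i p e + cwDist h i (h.2 e i) b :=
  fract_sub_eq_add hle

/-- No two virtual bins of a level are at the same point of the circle. -/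
def TieFree (h : Hashes k Ball Bin) : Prop :=
  ∀ (i : Fin k) (b b' : Bin), Int.fract (h.2 b i - h.2 b' i) = 0 → b = b'

theorem TieFree.eq_of_cwDist_eq {h : Hashes k Ball Bin} (hh : TieFree h) {i : Fin k} {p : ℝ}
    {b b' : Bin} (he : cwDist h i p b = cwDist h i p b') : b = b' := by
  refine hh i b b' ?_
  have := cwDist_eq_add he.ge
  change _ = _ + Int.fract _ at this
  linarith

/-- `e` is the first bin of `T` with property `F` that is met clockwise from `p` on. -/
def IsFirst (h : Hashes k Ball Bin) (T : Finset Bin) (i : Fin k) (p : ℝ) (F : Bin → Prop)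
    (e : Bin) : Prop :=
  e ∈ T ∧ F e ∧ ∀ b ∈ T, F b → cwDist h i p e ≤ cwDist h i p b

theorem IsFirst.unique {h : Hashes k Ball Bin} (hh : TieFree h) {T : Finset Bin} {i : Fin k}
    {p : ℝ} {F : Bin → Prop} {e e' : Bin} (he : IsFirst h T i p F e) (he' : IsFirst h T i p F e') :
    e = e' :=
  hh.eq_of_cwDist_eq (le_antisymm (he.2.2 _ he'.1 he'.2.1) (he'.2.2 _ he.1 he.2.1))

/-- The first bin from `p` on is also the first bin from any point before it. -/
theorem IsFirst.of_between {h : Hashes k Ball Bin} {T : Finset Bin} {i : Fin k}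
    {p : ℝ} {F : Bin → Prop} {e b : Bin} (he : IsFirst h T i p F e)
    (hb : cwDist h i p b ≤ cwDist h i p e) : IsFirst h T i (h.2 b i) F e := by
  refine ⟨he.1, he.2.1, fun c hc hF => ?_⟩
  have h1 := he.2.2 c hc hF
  have h2 := cwDist_eq_add hb
  have h3 := cwDist_eq_add (hb.trans h1)
  linarith

theorem isFirst_self {h : Hashes k Ball Bin} {T : Finset Bin} {i : Fin k} {F : Bin → Prop} {e : Bin}
    (heT : e ∈ T) (hF : F e) : IsFirst h T i (h.2 e i) F e :=
  ⟨heT, hF, fun b _ _ => by rw [cwDist_self]; exact cwDist_nonneg _ _ _ _⟩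

section Clockwise

variable [LinearOrder Bin]

theorem mem_clockwise {h : Hashes k Ball Bin} {T : Finset Bin} {i : Fin k} {p : ℝ} {b : Bin} :
    b ∈ clockwise h T i p ↔ b ∈ T := by
  simp [clockwise]

theorem nodup_clockwise (h : Hashes k Ball Bin) (T : Finset Bin) (i : Fin k) (p : ℝ) :
    (clockwise h T i p).Nodup := by
  unfold clockwise
  refine List.Nodup.map_on ?_ (Finset.sort_nodup _ _)
  intro x hx y hy hxy
  simp only [Finset.mem_sort, Finset.mem_image] at hx hy
  obtain ⟨b, -, rfl⟩ := hx
  obtain ⟨c, -, rfl⟩ := hy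
  simp only [ofLex_toLex] at hxy
  rw [hxy]

theorem pairwise_key_clockwise (h : Hashes k Ball Bin) (T : Finset Bin) (i : Fin k) (p : ℝ) :
    (clockwise h T i p).Pairwise fun b c =>
      (toLex (cwDist h i p b, b) : ℝ ×ₗ Bin) ≤ toLex (cwDist h i p c, c) := by
  unfold clockwise
  rw [List.pairwise_map]
  refine List.Pairwise.imp_of_mem ?_ (Finset.pairwise_sort _ _)
  intro x y hx hy hxy
  simp only [Finset.mem_sort, Finset.mem_image] at hx hy
  obtain ⟨b, -, rfl⟩ := hx
  obtain ⟨c, -, rfl⟩ := hy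
  exact hxy

theorem pairwise_clockwise (h : Hashes k Ball Bin) (T : Finset Bin) (i : Fin k) (p : ℝ) :
    (clockwise h T i p).Pairwise fun b c => cwDist h i p b ≤ cwDist h i p c := by
  refine (pairwise_key_clockwise h T i p).imp ?_
  intro b c hbc
  rw [Prod.Lex.toLex_le_toLex] at hbc
  rcases hbc with hbc | hbc
  · exact hbc.le
  · exact hbc.1.le

/-- `clockwise` is the only list of the bins of `T` in the order of the clockwise distances. -/
theorem clockwise_eq_iff {h : Hashes k Ball Bin} {T : Finset Bin} {i : Fin k} {p : ℝ}
    {l : List Bin} : clockwise h T i p = l ↔ l.Nodup ∧ l.toFinset = T ∧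
      l.Pairwise fun b c =>
        (toLex (cwDist h i p b, b) : ℝ ×ₗ Bin) ≤ toLex (cwDist h i p c, c) := by
  constructor
  · rintro rfl
    refine ⟨nodup_clockwise _ _ _ _, ?_, pairwise_key_clockwise _ _ _ _⟩
    ext b
    simp [mem_clockwise]
  · rintro ⟨h1, rfl, h2⟩
    refine List.Perm.eq_of_pairwise (fun a b _ _ hab hba => ?_) (pairwise_key_clockwise _ _ _ _) h2
      ((List.perm_ext_iff_of_nodup (nodup_clockwise _ _ _ _) h1).2 fun a => by
        simp [mem_clockwise])
    simpa using congrArg (fun q => (ofLex q).2) (le_antisymm hab hba)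

theorem isFirst_of_find? {h : Hashes k Ball Bin} {T : Finset Bin} {i : Fin k} {p : ℝ}
    {F : Bin → Prop} [DecidablePred F] {e : Bin}
    (he : (clockwise h T i p).find? (fun b => F b) = some e) : IsFirst h T i p F e := by
  obtain ⟨hFe, as, bs, hl, has⟩ := List.find?_eq_some_iff_append.1 he
  refine ⟨mem_clockwise.1 (hl ▸ by simp : e ∈ clockwise h T i p), by simpa using hFe, ?_⟩
  intro b hb hFb
  have hpw := pairwise_clockwise h T i p
  have hb' : b ∈ clockwise h T i p := mem_clockwise.2 hb
  rw [hl] at hpw hb'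
  rcases List.mem_append.1 hb' with hb' | hb'
  · simpa [hFb] using has b hb'
  · rcases List.mem_cons.1 hb' with rfl | hb'
    · exact le_rfl
    · exact List.rel_of_pairwise_cons (List.pairwise_append.1 hpw).2.1 hb'

theorem find?_clockwise_isSome {h : Hashes k Ball Bin} {T : Finset Bin} {i : Fin k} {p : ℝ}
    {F : Bin → Prop} [DecidablePred F] {b : Bin} (hb : b ∈ T) (hF : F b) :
    ∃ e, (clockwise h T i p).find? (fun b => F b) = some e := by
  rw [← Option.isSome_iff_exists, List.find?_isSome]
  exact ⟨b, mem_clockwise.2 hb, by simpa using hF⟩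

/-- Only this direction needs distinct points: the probing list breaks ties by the order on the
bins, which `IsFirst` does not see. -/
theorem IsFirst.find?_eq {h : Hashes k Ball Bin} (hh : TieFree h) {T : Finset Bin} {i : Fin k}
    {p : ℝ} {F : Bin → Prop} [DecidablePred F] {e : Bin} (he : IsFirst h T i p F e) :
    (clockwise h T i p).find? (fun b => F b) = some e := by
  obtain ⟨e', he'⟩ := find?_clockwise_isSome (h := h) (i := i) (p := p) (F := F) he.1 he.2.1
  rw [he', (isFirst_of_find? he').unique hh he]

end Clockwise

end BoundedLoads

/-! ### Static images for individual capacities, and their restriction to the first levels -/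

namespace BoundedLoads

variable {k : ℕ} {Ball Bin : Type*} [Fintype Ball] [LinearOrder Ball] [LinearOrder Bin]

theorem prio_injective (h : Hashes k Ball Bin) : Function.Injective (prio h) := fun _ _ hxy =>
  congrArg (fun q => (ofLex q).2) hxy

theorem prio_lt_of_level_lt {h : Hashes k Ball Bin} {x y : Ball} (hxy : (h.1 x).1 < (h.1 y).1) :
    prio h x < prio h y := Prod.Lex.toLex_lt_toLex.2 (Or.inl hxy)

theorem level_le_of_prio_lt {h : Hashes k Ball Bin} {x y : Ball} (hxy : prio h x < prio h y) :
    (h.1 x).1 ≤ (h.1 y).1 := by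
  rcases Prod.Lex.toLex_lt_toLex.1 hxy with hlt | heq
  · exact hlt.le
  · exact heq.1.le

theorem mem_byPriority {h : Hashes k Ball Bin} {S : Finset Ball} {x : Ball} :
    x ∈ byPriority h S ↔ x ∈ S := by
  simp [byPriority, prio]

theorem pairwise_byPriority (h : Hashes k Ball Bin) (S : Finset Ball) :
    (byPriority h S).Pairwise fun x y => prio h x < prio h y := by
  unfold byPriority
  rw [List.pairwise_map]
  refine List.Pairwise.imp_of_mem ?_ (Finset.sortedLT_sort _).pairwise
  intro x y hx hy hxy
  simp only [Finset.mem_sort, Finset.mem_image] at hx hy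
  obtain ⟨b, -, rfl⟩ := hx
  obtain ⟨c, -, rfl⟩ := hy
  exact hxy

theorem nodup_byPriority (h : Hashes k Ball Bin) (S : Finset Ball) : (byPriority h S).Nodup :=
  (pairwise_byPriority h S).imp fun hxy => by rintro rfl; exact lt_irrefl _ hxy

theorem length_byPriority (h : Hashes k Ball Bin) (S : Finset Ball) :
    (byPriority h S).length = S.card := by
  rw [byPriority, List.length_map, Finset.length_sort,
    Finset.card_image_of_injective _ (prio_injective h)]

theorem byPriority_eq {h : Hashes k Ball Bin} {S : Finset Ball} {l : List Ball}
    (hl : l.Pairwise fun x y => prio h x < prio h y) (hS : ∀ x, x ∈ l ↔ x ∈ S) :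
    byPriority h S = l := by
  have hnd : l.Nodup := hl.imp fun hxy => by rintro rfl; exact lt_irrefl _ hxy
  refine List.Perm.eq_of_pairwise (fun a b _ _ hab hba => (lt_asymm hab hba).elim)
    (pairwise_byPriority h S) hl
    ((List.perm_ext_iff_of_nodup (nodup_byPriority _ _) hnd).2 fun a => by
      rw [mem_byPriority, hS])

theorem byPriority_union {h : Hashes k Ball Bin} {S S' : Finset Ball}
    (hSS : ∀ x ∈ S, ∀ y ∈ S', prio h x < prio h y) :
    byPriority h (S ∪ S') = byPriority h S ++ byPriority h S' := by
  refine byPriority_eq (List.pairwise_append.2 ⟨pairwise_byPriority _ _, pairwise_byPriority _ _,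
    fun x hx y hy => hSS x (mem_byPriority.1 hx) y (mem_byPriority.1 hy)⟩) fun x => ?_
  simp [mem_byPriority]

/-- The balls of `S` of higher priority than `x`. -/
noncomputable def above (h : Hashes k Ball Bin) (S : Finset Ball) (x : Ball) : Finset Ball :=
  S.filter fun y => prio h y < prio h x

/-- The balls of `S` of lower priority than `x`. -/
noncomputable def beneath (h : Hashes k Ball Bin) (S : Finset Ball) (x : Ball) : Finset Ball :=
  S.filter fun y => prio h x < prio h y

theorem byPriority_of_mem {h : Hashes k Ball Bin} {S : Finset Ball} {x : Ball} (hx : x ∈ S) :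
    byPriority h S = byPriority h (above h S x) ++ x :: byPriority h (beneath h S x) := by
  refine byPriority_eq ?_ fun y => ?_
  · refine List.pairwise_append.2 ⟨pairwise_byPriority _ _, List.pairwise_cons.2
      ⟨fun y hy => (Finset.mem_filter.1 (mem_byPriority.1 hy)).2, pairwise_byPriority _ _⟩, ?_⟩
    intro y hy z hz
    have hyx := (Finset.mem_filter.1 (mem_byPriority.1 hy)).2
    rcases List.mem_cons.1 hz with rfl | hz
    · exact hyx
    · exact hyx.trans (Finset.mem_filter.1 (mem_byPriority.1 hz)).2
  · simp only [List.mem_append, List.mem_cons, mem_byPriority, above, beneath, Finset.mem_filter]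
    constructor
    · rintro (hy | rfl | hy)
      exacts [hy.1, hx, hy.1]
    · intro hy
      rcases lt_trichotomy (prio h y) (prio h x) with hlt | heq | hgt
      exacts [Or.inl ⟨hy, hlt⟩, Or.inr (Or.inl (prio_injective h heq)), Or.inr (Or.inr ⟨hy, hgt⟩)]

theorem byPriority_of_notMem {h : Hashes k Ball Bin} {S : Finset Ball} {x : Ball} (hx : x ∉ S) :
    byPriority h S = byPriority h (above h S x) ++ byPriority h (beneath h S x) := by
  rw [← byPriority_union]
  · congr 1
    ext y
    simp only [above, beneath, Finset.mem_union, Finset.mem_filter, ← and_or_left]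
    refine ⟨fun hy => ⟨hy, lt_or_gt_of_ne fun he => hx (prio_injective h he ▸ hy)⟩, fun hy => hy.1⟩
  · intro y hy z hz
    exact (Finset.mem_filter.1 hy).2.trans (Finset.mem_filter.1 hz).2

/-- Place `x` in the first virtual bin clockwise from its hash value whose super bin `b` holds fewer
than `cap b` balls. -/
noncomputable def place (cap : Bin → ℕ) (h : Hashes k Ball Bin) (T : Finset Bin)
    (a : Ball → Option Bin) (x : Ball) : Ball → Option Bin :=
  Function.update a x ((probes h T x).find? fun b => load a b < cap b)

/-- The static image for bins of individual capacities. -/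
noncomputable def capImage (cap : Bin → ℕ) (h : Hashes k Ball Bin) (S : Finset Ball)
    (T : Finset Bin) : Ball → Option Bin :=
  (byPriority h S).foldl (place cap h T) fun _ => none

theorem image_eq_capImage (C : ℕ) (h : Hashes k Ball Bin) (S : Finset Ball) (T : Finset Bin) :
    image C h S T = capImage (fun _ => C) h S T := rfl

theorem foldl_place_of_notMem (cap : Bin → ℕ) (h : Hashes k Ball Bin) (T : Finset Bin)
    {l : List Ball} {y : Ball} (hy : y ∉ l) (a : Ball → Option Bin) :
    l.foldl (place cap h T) a y = a y := by
  induction l generalizing a with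
  | nil => rfl
  | cons x l ih =>
    rw [List.mem_cons, not_or] at hy
    rw [List.foldl_cons, ih hy.2, place, Function.update_of_ne hy.1]

theorem capImage_of_notMem {cap : Bin → ℕ} {h : Hashes k Ball Bin} {S : Finset Ball}
    {T : Finset Bin} {y : Ball} (hy : y ∉ S) : capImage cap h S T y = none := by
  rw [capImage, foldl_place_of_notMem]
  rwa [mem_byPriority]

theorem load_update (a : Ball → Option Bin) {x : Ball} (hx : a x = none) (c b : Bin) :
    load (Function.update a x (some c)) b = load a b + if b = c then 1 else 0 := by
  unfold load
  split_ifs with hbc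
  · subst hbc
    rw [← Finset.card_insert_of_notMem (a := x) (by simp [hx])]
    congr 1
    ext y
    by_cases hy : y = x
    · simp [hy]
    · simp [hy]
  · rw [add_zero]
    congr 1
    ext y
    by_cases hy : y = x
    · simp [hy, hx, Ne.symm hbc]
    · simp [Function.update_of_ne hy]

theorem load_mono {a a' : Ball → Option Bin} {b : Bin} (haa : ∀ y, a y = some b → a' y = some b) :
    load a b ≤ load a' b :=
  Finset.card_le_card fun y => by simpa using haa y

theorem load_none (b : Bin) : load (fun _ : Ball => (none : Option Bin)) b = 0 := by
  simp [load]

theorem place_le_cap {cap : Bin → ℕ} {h : Hashes k Ball Bin} {T : Finset Bin}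
    {a : Ball → Option Bin} {x : Ball} (hx : a x = none) (ha : ∀ b, load a b ≤ cap b) (b : Bin) :
    load (place cap h T a x) b ≤ cap b := by
  unfold place
  cases hc : (probes h T x).find? fun b => load a b < cap b with
  | none => rw [← hx, Function.update_eq_self]; exact ha b
  | some c =>
    have hlt : load a c < cap c := by simpa using List.find?_some hc
    rw [load_update a hx]
    split_ifs with hbc
    · subst hbc; exact hlt
    · exact ha b

theorem foldl_place_le_cap {cap : Bin → ℕ} {h : Hashes k Ball Bin} {T : Finset Bin} {l : List Ball}
    (hl : l.Nodup) {a : Ball → Option Bin} (hal : ∀ x ∈ l, a x = none)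
    (ha : ∀ b, load a b ≤ cap b) (b : Bin) : load (l.foldl (place cap h T) a) b ≤ cap b := by
  induction l generalizing a with
  | nil => exact ha b
  | cons x l ih =>
    rw [List.nodup_cons] at hl
    refine ih hl.2 (fun y hy => ?_) (place_le_cap (hal x (by simp)) ha)
    rw [place, Function.update_of_ne (by rintro rfl; exact hl.1 hy), hal y (by simp [hy])]

theorem load_capImage_le (cap : Bin → ℕ) (h : Hashes k Ball Bin) (S : Finset Ball) (T : Finset Bin)
    (b : Bin) : load (capImage cap h S T) b ≤ cap b :=
  foldl_place_le_cap (nodup_byPriority _ _) (fun _ _ => rfl) (by simp [load_none]) b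

theorem sum_load_le (a : Ball → Option Bin) (T : Finset Bin) :
    ∑ b ∈ T, load a b ≤ (Finset.univ.filter fun y => a y ≠ none).card := by
  unfold load
  rw [← Finset.card_biUnion]
  · refine Finset.card_le_card fun y hy => ?_
    obtain ⟨b, -, hb⟩ := Finset.mem_biUnion.1 hy
    rw [Finset.mem_filter] at hb ⊢
    simp [hb.2]
  · intro b _ c _ hbc
    refine Finset.disjoint_left.2 fun y hy hy' => hbc ?_
    simp only [Finset.mem_filter, Finset.mem_univ, true_and] at hy hy'
    simpa [hy] using hy'

theorem capImage_union {cap : Bin → ℕ} {h : Hashes k Ball Bin} {S S' : Finset Ball} {T : Finset Bin}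
    (hSS : ∀ x ∈ S, ∀ y ∈ S', prio h x < prio h y) :
    capImage cap h (S ∪ S') T = (byPriority h S').foldl (place cap h T) (capImage cap h S T) := by
  rw [capImage, byPriority_union hSS, List.foldl_append, capImage]

/-- The balls of lower priority have no influence on the balls of higher priority. -/
theorem capImage_union_of_mem {cap : Bin → ℕ} {h : Hashes k Ball Bin} {S S' : Finset Ball}
    {T : Finset Bin} (hSS : ∀ x ∈ S, ∀ y ∈ S', prio h x < prio h y) {x : Ball} (hx : x ∈ S) :
    capImage cap h (S ∪ S') T x = capImage cap h S T x := by
  rw [capImage_union hSS, foldl_place_of_notMem]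
  rw [mem_byPriority]
  exact fun hx' => lt_irrefl _ (hSS x hx x hx')

/-- The balls of `S` at the first `j` levels. -/
def below (h : Hashes k Ball Bin) (S : Finset Ball) (j : ℕ) : Finset Ball :=
  S.filter fun y => ((h.1 y).1 : ℕ) < j

/-- The balls of `S` at level `i`. -/
def atLevel (h : Hashes k Ball Bin) (S : Finset Ball) (i : Fin k) : Finset Ball :=
  S.filter fun y => (h.1 y).1 = i

theorem mem_below {h : Hashes k Ball Bin} {S : Finset Ball} {j : ℕ} {y : Ball} :
    y ∈ below h S j ↔ y ∈ S ∧ ((h.1 y).1 : ℕ) < j := Finset.mem_filter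

theorem mem_atLevel {h : Hashes k Ball Bin} {S : Finset Ball} {i : Fin k} {y : Ball} :
    y ∈ atLevel h S i ↔ y ∈ S ∧ (h.1 y).1 = i := Finset.mem_filter

theorem below_zero (h : Hashes k Ball Bin) (S : Finset Ball) : below h S 0 = ∅ := by
  simp [below]

theorem below_top (h : Hashes k Ball Bin) (S : Finset Ball) : below h S k = S := by
  simp [below]

theorem below_succ (h : Hashes k Ball Bin) (S : Finset Ball) (i : Fin k) :
    below h S (i + 1) = below h S i ∪ atLevel h S i := by
  ext y
  simp only [Finset.mem_union, mem_below, mem_atLevel, ← and_or_left, Fin.ext_iff]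
  exact and_congr_right fun _ => Nat.lt_succ_iff_lt_or_eq

theorem prio_lt_of_below_atLevel {h : Hashes k Ball Bin} {S S' : Finset Ball} {i : Fin k} :
    ∀ x ∈ below h S i, ∀ y ∈ atLevel h S' i, prio h x < prio h y := by
  intro x hx y hy
  refine prio_lt_of_level_lt ?_
  rw [(mem_atLevel.1 hy).2]
  exact (mem_below.1 hx).2

theorem capImage_below_succ (cap : Bin → ℕ) (h : Hashes k Ball Bin) (S : Finset Ball)
    (T : Finset Bin) (i : Fin k) :
    capImage cap h (below h S (i + 1)) T =
      (byPriority h (atLevel h S i)).foldl (place cap h T) (capImage cap h (below h S i) T) := by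
  rw [below_succ, capImage_union prio_lt_of_below_atLevel]

theorem capImage_below {cap : Bin → ℕ} {h : Hashes k Ball Bin} {S : Finset Ball}
    {T : Finset Bin} {j : ℕ} {y : Ball} (hy : y ∈ below h S j) :
    capImage cap h (below h S j) T y = capImage cap h S T y := by
  have hS : S = below h S j ∪ S.filter fun y => j ≤ ((h.1 y).1 : ℕ) := by
    ext y
    simp only [Finset.mem_union, mem_below, Finset.mem_filter, ← and_or_left]
    exact ⟨fun hy => ⟨hy, lt_or_ge _ _⟩, fun hy => hy.1⟩
  conv_rhs => rw [hS]
  rw [capImage_union_of_mem _ hy]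
  intro x hx z hz
  exact prio_lt_of_level_lt
    (Fin.lt_def.2 (lt_of_lt_of_le (mem_below.1 hx).2 (Finset.mem_filter.1 hz).2))

/-- The load of `b` after the first `j` levels. -/
noncomputable def levelLoad (cap : Bin → ℕ) (h : Hashes k Ball Bin) (S : Finset Ball)
    (T : Finset Bin) (j : ℕ) (b : Bin) : ℕ :=
  load (capImage cap h (below h S j) T) b

theorem levelLoad_eq (cap : Bin → ℕ) (h : Hashes k Ball Bin) (S : Finset Ball)
    (T : Finset Bin) (j : ℕ) (b : Bin) :
    levelLoad cap h S T j b =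
      (Finset.univ.filter fun y => capImage cap h S T y = some b ∧ ((h.1 y).1 : ℕ) < j).card := by
  unfold levelLoad load
  congr 1
  ext y
  simp only [Finset.mem_filter, Finset.mem_univ, true_and]
  by_cases hyS : y ∈ S
  · by_cases hyj : ((h.1 y).1 : ℕ) < j
    · rw [capImage_below (mem_below.2 ⟨hyS, hyj⟩)]
      simp [hyj]
    · rw [capImage_of_notMem (fun hy => hyj (mem_below.1 hy).2)]
      simp [hyj]
  · rw [capImage_of_notMem hyS, capImage_of_notMem (fun hy => hyS (mem_below.1 hy).1)]
    simp

theorem levelLoad_mono (cap : Bin → ℕ) (h : Hashes k Ball Bin) (S : Finset Ball)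
    (T : Finset Bin) {i j : ℕ} (hij : i ≤ j) (b : Bin) :
    levelLoad cap h S T i b ≤ levelLoad cap h S T j b := by
  rw [levelLoad_eq, levelLoad_eq]
  refine Finset.card_le_card fun y => ?_
  simp only [Finset.mem_filter, Finset.mem_univ, true_and]
  exact fun hy => ⟨hy.1, hy.2.trans_le hij⟩

theorem levelLoad_le_cap (cap : Bin → ℕ) (h : Hashes k Ball Bin) (S : Finset Ball)
    (T : Finset Bin) (j : ℕ) (b : Bin) : levelLoad cap h S T j b ≤ cap b :=
  load_capImage_le _ _ _ _ _

theorem levelLoad_succ (cap : Bin → ℕ) (h : Hashes k Ball Bin) (S : Finset Ball)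
    (T : Finset Bin) (i : Fin k) (b : Bin) :
    levelLoad cap h S T (i + 1) b = levelLoad cap h S T i b +
      ((atLevel h S i).filter fun y => capImage cap h S T y = some b).card := by
  rw [levelLoad_eq, levelLoad_eq, ← Finset.card_union_of_disjoint]
  · congr 1
    ext y
    simp only [Finset.mem_filter, Finset.mem_univ, true_and, Finset.mem_union, mem_atLevel,
      Fin.ext_iff]
    constructor
    · rintro ⟨h1, h2⟩
      by_cases hyS : y ∈ S
      · rcases Nat.lt_succ_iff_lt_or_eq.1 h2 with h2 | h2
        · exact Or.inl ⟨h1, h2⟩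
        · exact Or.inr ⟨⟨hyS, h2⟩, h1⟩
      · rw [capImage_of_notMem hyS] at h1
        cases h1
    · rintro (⟨h1, h2⟩ | ⟨⟨_, h2⟩, h1⟩)
      · exact ⟨h1, by omega⟩
      · exact ⟨h1, by omega⟩
  · refine Finset.disjoint_left.2 fun y hy hy' => ?_
    simp only [Finset.mem_filter, Finset.mem_univ, true_and, mem_atLevel, Fin.ext_iff] at hy hy'
    omega

/-- The bins that a ball of level `i` passes are full after level `i`. -/
theorem full_of_passed {cap : Bin → ℕ} {h : Hashes k Ball Bin} {S : Finset Ball}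
    {T : Finset Bin} {y : Ball} (hy : y ∈ S) {b : Bin}
    (hb : ∀ c, capImage cap h S T y = some c →
      cwDist h (h.1 y).1 (h.1 y).2 b < cwDist h (h.1 y).1 (h.1 y).2 c) (hbT : b ∈ T) :
    cap b ≤ levelLoad cap h S T ((h.1 y).1 + 1) b := by
  by_contra! hlt
  -- The bin of `y` is decided by the image of the balls above `y`. A bin that is free after the
  -- level of `y` was free at that moment too, as loads only grow, so `y` cannot have passed it.
  have hval : capImage cap h S T y = (probes h T y).find? fun c =>
      load (capImage cap h (above h S y) T) c < cap c := by
    rw [capImage, byPriority_of_mem hy, List.foldl_append, List.foldl_cons,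
      foldl_place_of_notMem]
    · rw [place, Function.update_self, capImage]
    · simp [mem_byPriority, beneath]
  have hS : below h S ((h.1 y).1 + 1) = above h S y ∪
      (below h S ((h.1 y).1 + 1)).filter fun z => prio h y ≤ prio h z := by
    ext z
    simp only [Finset.mem_union, Finset.mem_filter, above, mem_below]
    constructor
    · intro hz
      rcases lt_or_ge (prio h z) (prio h y) with hl | hl
      exacts [Or.inl ⟨hz.1, hl⟩, Or.inr ⟨hz, hl⟩]
    · rintro (hz | hz)
      · exact ⟨hz.1, Nat.lt_succ_of_le (level_le_of_prio_lt hz.2)⟩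
      · exact hz.1
  have hle : load (capImage cap h (above h S y) T) b < cap b := by
    refine lt_of_le_of_lt (load_mono fun z hz => ?_) hlt
    rw [hS, capImage_union_of_mem]
    · exact hz
    · intro x hx z hz
      exact (Finset.mem_filter.1 hx).2.trans_le (Finset.mem_filter.1 hz).2
    · by_contra hzn
      rw [capImage_of_notMem hzn] at hz
      cases hz
  obtain ⟨c, hc⟩ := find?_clockwise_isSome (h := h) (i := (h.1 y).1) (p := (h.1 y).2)
    (F := fun c => load (capImage cap h (above h S y) T) c < cap c) hbT hle
  have hfirst := isFirst_of_find? hc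
  exact absurd (hfirst.2.2 b hbT hle) (not_le.2 (hb c (hval.trans hc)))

end BoundedLoads

/-! ### The additional free place and the balls that it moves -/

namespace BoundedLoads

variable {k : ℕ} {Ball Bin : Type*} [Fintype Ball] [LinearOrder Ball] [LinearOrder Bin]

theorem moved_update_same (a a' : Ball → Option Bin) (z : Ball) (v : Option Bin) :
    moved (Function.update a z v) (Function.update a' z v) ≤ moved a a' := by
  refine Finset.card_le_card fun y => ?_
  simp only [Finset.mem_filter, Finset.mem_univ, true_and]
  by_cases hy : y = z
  · simp [hy]
  · simp [Function.update_of_ne hy]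

theorem moved_update (a a' : Ball → Option Bin) (z : Ball) (v v' : Option Bin) :
    moved (Function.update a z v) (Function.update a' z v') ≤ moved a a' + 1 := by
  unfold moved
  refine le_trans (Finset.card_le_card (t := insert z (Finset.univ.filter fun y => a y ≠ a' y))
    fun y => ?_) (Finset.card_insert_le _ _)
  simp only [Finset.mem_filter, Finset.mem_univ, true_and, Finset.mem_insert]
  by_cases hy : y = z
  · simp [hy]
  · simpa [Function.update_of_ne hy] using fun hyy => Or.inr hyy

theorem moved_comm (a a' : Ball → Option Bin) : moved a a' = moved a' a := by
  simp only [moved, ne_comm]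

theorem moved_self (a : Ball → Option Bin) : moved a a = 0 := by
  simp [moved]

theorem moved_triangle (a a' a'' : Ball → Option Bin) :
    moved a a'' ≤ moved a a' + moved a' a'' := by
  unfold moved
  refine le_trans (Finset.card_le_card fun y => ?_) (Finset.card_union_le _ _)
  simp only [Finset.mem_filter, Finset.mem_univ, true_and, Finset.mem_union]
  intro hy
  by_contra! hc
  exact hy (hc.1.trans hc.2)

/-- The assignment `a` for the capacities `cap` leaves one more free place than the assignment `a'`
for the capacities `cap'`, and this place is in the bin `e`. -/
structure HoleAt (cap cap' : Bin → ℕ) (a a' : Ball → Option Bin) (e : Bin) : Prop where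
  free : ∀ b, cap b + load a' b = cap' b + load a b + if b = e then 1 else 0
  le : ∀ b, load a' b ≤ cap' b

/-- The bins of `T` that are strictly closer to `p` than `e`. -/
noncomputable def nearer (h : Hashes k Ball Bin) (T : Finset Bin) (i : Fin k) (p : ℝ) (e : Bin) :
    Finset Bin :=
  T.filter fun b => cwDist h i p b < cwDist h i p e

/-- At least two places of `T` are free in total, and at most one of them is in `e`. This lets the
system without the hole place its ball as well. -/
theorem exists_other_free {cap : Bin → ℕ} {T : Finset Bin} {a : Ball → Option Bin} {e : Bin}
    (hroom : (Finset.univ.filter fun y => a y ≠ none).card + 2 ≤ ∑ b ∈ T, cap b)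
    (he : cap e ≤ load a e + 1) : ∃ d ∈ T, d ≠ e ∧ load a d < cap d := by
  by_contra! hc
  have h1 : ∑ b ∈ T, cap b ≤ ∑ b ∈ T, (load a b + if b = e then 1 else 0) := by
    refine Finset.sum_le_sum fun b hb => ?_
    split_ifs with hbe
    · exact hbe ▸ he
    · exact hc b hb hbe
  have h2 : ∑ b ∈ T, (if b = e then 1 else 0) ≤ 1 := by
    rw [Finset.sum_ite_eq']
    split_ifs <;> simp
  have h3 := sum_load_le a T
  rw [Finset.sum_add_distrib] at h1
  omega

/-- The potential argument behind all bounds on moved balls. The number of bins strictly nearer to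
`p` than the hole grows whenever the two systems treat `z` differently, and this growth pays for the
moved ball. That the hole is the first free bin from `p` is part of the invariant: it forces the
hole to move away from `p`, and it determines where the hole is at the end of a level. -/
theorem holeAt_place {cap cap' : Bin → ℕ} {h : Hashes k Ball Bin} (hh : TieFree h)
    {T : Finset Bin} {i : Fin k} {p : ℝ} {a a' : Ball → Option Bin} {e : Bin} {z : Ball}
    (hz : (h.1 z).1 = i) (haz : a z = none) (haz' : a' z = none) (inv : HoleAt cap cap' a a' e)
    (hfirst : IsFirst h T i p (fun b => load a b < cap b) e)
    (hroom : (Finset.univ.filter fun y => a y ≠ none).card + 2 ≤ ∑ b ∈ T, cap b) :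
    ∃ e', HoleAt cap cap' (place cap h T a z) (place cap' h T a' z) e' ∧
      IsFirst h T i p (fun b => load (place cap h T a z) b < cap b) e' ∧
      moved (place cap h T a z) (place cap' h T a' z) + (nearer h T i p e).card ≤
        moved a a' + (nearer h T i p e').card := by
  subst hz
  have hF : ∀ b, load a' b < cap' b → load a b < cap b := fun b hb => by
    have := inv.free b
    omega
  have hF' : ∀ b, b ≠ e → load a b < cap b → load a' b < cap' b := fun b hbe hb => by
    have := inv.free b
    rw [if_neg hbe] at this
    omega
  have hfe := inv.free e
  rw [if_pos rfl] at hfe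
  have hpl' : ∀ {c}, IsFirst h T (h.1 z).1 (h.1 z).2 (fun b => load a' b < cap' b) c →
      place cap' h T a' z = Function.update a' z (some c) := fun hc => by
    rw [place, probes, hc.find?_eq hh]
  have hle' := place_le_cap (h := h) (T := T) haz' inv.le
  obtain ⟨c, hc⟩ := find?_clockwise_isSome (h := h) (i := (h.1 z).1) (p := (h.1 z).2)
    (F := fun b => load a b < cap b) hfirst.1 hfirst.2.1
  have hcF := isFirst_of_find? hc
  have hpl : place cap h T a z = Function.update a z (some c) := by rw [place, probes, hc]
  -- The harmless case: both systems choose `c`, and `e` keeps a free place, so the hole stays.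
  have hsame : IsFirst h T (h.1 z).1 (h.1 z).2 (fun b => load a' b < cap' b) c →
      load (Function.update a z (some c)) e < cap e →
      ∃ e', HoleAt cap cap' (place cap h T a z) (place cap' h T a' z) e' ∧
      IsFirst h T (h.1 z).1 p (fun b => load (place cap h T a z) b < cap b) e' ∧
      moved (place cap h T a z) (place cap' h T a' z) + (nearer h T (h.1 z).1 p e).card ≤
        moved a a' + (nearer h T (h.1 z).1 p e').card := by
    intro hc' hlt
    rw [hpl' hc'] at hle'
    rw [hpl, hpl' hc']
    refine ⟨e, ⟨fun b => ?_, hle'⟩, ⟨hfirst.1, hlt, fun b hb hlb => hfirst.2.2 b hb ?_⟩, ?_⟩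
    · rw [load_update a haz, load_update a' haz']
      have := inv.free b
      omega
    · change load _ b < cap b at hlb
      rw [load_update a haz] at hlb
      omega
    · exact Nat.add_le_add_right (moved_update_same _ _ _ _) _
  by_cases hce : c = e
  · subst hce
    by_cases hFe : load a' c < cap' c
    · refine hsame ⟨hcF.1, hFe, fun b hb hlb => hcF.2.2 b hb (hF b hlb)⟩ ?_
      rw [load_update a haz, if_pos rfl]
      omega
    -- Here `z` takes the last free place of the hole `c` in the first system, while `c` is full in
    -- the second one. There `z` goes on to `d`, which becomes the hole.
    · have hlee := inv.le c
      obtain ⟨d₀, hd₀T, hd₀, hd₀F⟩ := exists_other_free (T := T) (e := c) hroom (by omega)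
      obtain ⟨d, hd⟩ := find?_clockwise_isSome (h := h) (i := (h.1 z).1) (p := (h.1 z).2)
        (F := fun b => load a' b < cap' b) hd₀T (hF' d₀ hd₀ hd₀F)
      have hdF := isFirst_of_find? hd
      have hdc : d ≠ c := by
        rintro rfl
        exact hFe hdF.2.1
      have hFd := hF d hdF.2.1
      have hpd := hfirst.2.2 d hdF.1 hFd
      rw [hpl' hdF] at hle'
      rw [hpl, hpl' hdF]
      refine ⟨d, ⟨fun b => ?_, hle'⟩, ⟨hdF.1, ?_, fun b hb hlb => ?_⟩, ?_⟩
      · rw [load_update a haz, load_update a' haz']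
        have := inv.free b
        omega
      · change load _ d < cap d
        rw [load_update a haz, if_neg hdc]
        omega
      · change load _ b < cap b at hlb
        rw [load_update a haz] at hlb
        have hbc : b ≠ c := by
          rintro rfl
          rw [if_pos rfl] at hlb
          omega
        rw [if_neg hbc] at hlb
        have hb1 := hcF.2.2 b hb hlb
        have hd1 := hcF.2.2 d hdF.1 hFd
        have hdb := hdF.2.2 b hb (hF' b hbc hlb)
        have hb2 := hfirst.2.2 b hb hlb
        -- Both the point of `z` and `p` meet `c` before `b` and `d`. Hence either order of `b` and
        -- `d` is the one seen from `c`, and `d` before `b` from `z` gives the same from `p`.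
        have e1 := cwDist_eq_add hb1
        have e2 := cwDist_eq_add hd1
        have e3 := cwDist_eq_add hb2
        have e4 := cwDist_eq_add hpd
        linarith
      · have hlt : cwDist h (h.1 z).1 p c < cwDist h (h.1 z).1 p d :=
          lt_of_le_of_ne hpd fun he => hdc (hh.eq_of_cwDist_eq he).symm
        have h1 := moved_update a a' z (some c) (some d)
        have h2 : (nearer h T (h.1 z).1 p c).card < (nearer h T (h.1 z).1 p d).card := by
          refine Finset.card_lt_card ((Finset.ssubset_iff_of_subset fun b hb => ?_).2 ⟨c, ?_, ?_⟩)
          · rw [nearer, Finset.mem_filter] at hb ⊢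
            exact ⟨hb.1, hb.2.trans hlt⟩
          · exact Finset.mem_filter.2 ⟨hfirst.1, hlt⟩
          · simp [nearer]
        omega
  · refine hsame ⟨hcF.1, hF' c hce hcF.2.1, fun b hb hlb => hcF.2.2 b hb (hF b hlb)⟩ ?_
    rw [load_update a haz, if_neg (Ne.symm hce)]
    exact hfirst.2.1

theorem card_assigned_place_le (cap : Bin → ℕ) (h : Hashes k Ball Bin) (T : Finset Bin)
    (a : Ball → Option Bin) (z : Ball) :
    (Finset.univ.filter fun y => place cap h T a z y ≠ none).card ≤
      (Finset.univ.filter fun y => a y ≠ none).card + 1 := by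
  refine le_trans (Finset.card_le_card (t := insert z (Finset.univ.filter fun y => a y ≠ none))
    fun y => ?_) (Finset.card_insert_le _ _)
  intro hy
  rw [Finset.mem_insert, Finset.mem_filter]
  refine (em (y = z)).imp_right fun hyz => ⟨Finset.mem_univ _, ?_⟩
  have := (Finset.mem_filter.1 hy).2
  rwa [place, Function.update_of_ne hyz] at this

theorem holeAt_foldl {cap cap' : Bin → ℕ} {h : Hashes k Ball Bin} (hh : TieFree h)
    {T : Finset Bin} {i : Fin k} {p : ℝ} {l : List Ball} (hl : ∀ z ∈ l, (h.1 z).1 = i)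
    (hnd : l.Nodup) {a a' : Ball → Option Bin} {e : Bin}
    (ha : ∀ z ∈ l, a z = none) (ha' : ∀ z ∈ l, a' z = none) (inv : HoleAt cap cap' a a' e)
    (hfirst : IsFirst h T i p (fun b => load a b < cap b) e)
    (hroom : (Finset.univ.filter fun y => a y ≠ none).card + l.length < ∑ b ∈ T, cap b) :
    ∃ e', HoleAt cap cap' (l.foldl (place cap h T) a) (l.foldl (place cap' h T) a') e' ∧
      IsFirst h T i p (fun b => load (l.foldl (place cap h T) a) b < cap b) e' ∧
      moved (l.foldl (place cap h T) a) (l.foldl (place cap' h T) a') + (nearer h T i p e).card ≤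
        moved a a' + (nearer h T i p e').card := by
  induction l generalizing a a' e with
  | nil => exact ⟨e, inv, hfirst, le_rfl⟩
  | cons z l ih =>
    rw [List.nodup_cons] at hnd
    rw [List.length_cons] at hroom
    obtain ⟨e₁, inv₁, hfirst₁, hm₁⟩ := holeAt_place hh (hl z (by simp)) (ha z (by simp))
      (ha' z (by simp)) inv hfirst (by omega)
    have hne : ∀ y ∈ l, y ≠ z := fun y hy => by rintro rfl; exact hnd.1 hy
    have hc := card_assigned_place_le cap h T a z
    obtain ⟨e₂, inv₂, hfirst₂, hm₂⟩ := ih (fun y hy => hl y (by simp [hy])) hnd.2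
      (fun y hy => by rw [place, Function.update_of_ne (hne y hy)]; exact ha y (by simp [hy]))
      (fun y hy => by rw [place, Function.update_of_ne (hne y hy)]; exact ha' y (by simp [hy]))
      inv₁ hfirst₁ (by omega)
    exact ⟨e₂, inv₂, hfirst₂, by simp only [List.foldl_cons]; omega⟩

/-- The bins of `T` met clockwise from `p` at level `i`, up to and including the first one that is
not full after level `i`. -/
noncomputable def run (cap : Bin → ℕ) (h : Hashes k Ball Bin) (S : Finset Ball) (T : Finset Bin)
    (i : Fin k) (p : ℝ) : Finset Bin :=
  T.filter fun b => ∀ c ∈ T, levelLoad cap h S T (i + 1) c < cap c →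
    cwDist h i p b ≤ cwDist h i p c

/-- The first bin after `e` at level `j` that is not full after level `j`. -/
noncomputable def nextHole (cap : Bin → ℕ) (h : Hashes k Ball Bin) (S : Finset Ball)
    (T : Finset Bin) (j : ℕ) (e : Bin) : Bin :=
  if hj : j < k then
    ((clockwise h T ⟨j, hj⟩ (h.2 e ⟨j, hj⟩)).find? fun b =>
      levelLoad cap h S T (j + 1) b < cap b).getD e
  else e

/-- The bin of the additional free place before level `j`, if it is `b` before level `j₀`. -/
noncomputable def hole (cap : Bin → ℕ) (h : Hashes k Ball Bin) (S : Finset Ball)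
    (T : Finset Bin) (j₀ : ℕ) (b : Bin) : ℕ → Bin
  | 0 => b
  | j + 1 => if j₀ ≤ j then nextHole cap h S T j (hole cap h S T j₀ b j) else b

theorem hole_of_le (cap : Bin → ℕ) (h : Hashes k Ball Bin) (S : Finset Ball)
    (T : Finset Bin) {j₀ : ℕ} (b : Bin) {j : ℕ} (hj : j ≤ j₀) : hole cap h S T j₀ b j = b := by
  cases j with
  | zero => rfl
  | succ j => rw [hole, if_neg (by omega)]

theorem hole_succ (cap : Bin → ℕ) (h : Hashes k Ball Bin) (S : Finset Ball)
    (T : Finset Bin) {j₀ : ℕ} (b : Bin) {j : ℕ} (hj : j₀ ≤ j) :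
    hole cap h S T j₀ b (j + 1) = nextHole cap h S T j (hole cap h S T j₀ b j) := by
  rw [hole, if_pos hj]

theorem nextHole_eq {cap : Bin → ℕ} {h : Hashes k Ball Bin} (hh : TieFree h) {S : Finset Ball}
    {T : Finset Bin} {i : Fin k} {e e' : Bin}
    (he : IsFirst h T i (h.2 e i) (fun b => levelLoad cap h S T (i + 1) b < cap b) e') :
    nextHole cap h S T i e = e' := by
  rw [nextHole, dif_pos i.2, he.find?_eq hh, Option.getD_some]

/-- The inequality is strict because `e` belongs to the run without being nearer than itself. In
`moved_insert_le` this one unit pays for the inserted ball. -/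
theorem card_nearer_lt {cap : Bin → ℕ} {h : Hashes k Ball Bin} {S : Finset Ball}
    {T : Finset Bin} {i : Fin k} {p : ℝ} {e : Bin}
    (he : IsFirst h T i p (fun b => levelLoad cap h S T (i + 1) b < cap b) e) :
    (nearer h T i p e).card < (run cap h S T i p).card := by
  refine Finset.card_lt_card ((Finset.ssubset_iff_of_subset fun b hb => ?_).2 ⟨e, ?_, ?_⟩)
  · rw [nearer, Finset.mem_filter] at hb
    exact Finset.mem_filter.2 ⟨hb.1, fun c hc hlc => hb.2.le.trans (he.2.2 c hc hlc)⟩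
  · exact Finset.mem_filter.2 ⟨he.1, he.2.2⟩
  · simp [nearer]

theorem card_assigned_capImage_le (cap : Bin → ℕ) (h : Hashes k Ball Bin) (S : Finset Ball)
    (T : Finset Bin) :
    (Finset.univ.filter fun y => capImage cap h S T y ≠ none).card ≤ S.card := by
  refine Finset.card_le_card fun y hy => ?_
  by_contra hyS
  exact (Finset.mem_filter.1 hy).2 (capImage_of_notMem hyS)

theorem card_below_succ (h : Hashes k Ball Bin) (S : Finset Ball) (i : Fin k) :
    (below h S (i + 1)).card = (below h S i).card + (atLevel h S i).card := by
  rw [below_succ, Finset.card_union_of_disjoint]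
  refine Finset.disjoint_left.2 fun y hy hy' => ?_
  exact absurd (prio_lt_of_below_atLevel y hy y hy') (lt_irrefl _)

theorem below_subset (h : Hashes k Ball Bin) (S : Finset Ball) (j : ℕ) : below h S j ⊆ S :=
  Finset.filter_subset _ _

/-- One level of two systems that differ by one free place. -/
theorem holeAt_level {cap cap' : Bin → ℕ} {h : Hashes k Ball Bin} (hh : TieFree h)
    {S S' : Finset Ball} {T : Finset Bin} {i : Fin k} {e : Bin} (heT : e ∈ T)
    (hS : atLevel h S' i = atLevel h S i) (hcard : S.card < ∑ b ∈ T, cap b)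
    (inv : HoleAt cap cap' (capImage cap h (below h S i) T) (capImage cap' h (below h S' i) T) e) :
    HoleAt cap cap' (capImage cap h (below h S (i + 1)) T)
        (capImage cap' h (below h S' (i + 1)) T) (nextHole cap h S T i e) ∧
      nextHole cap h S T i e ∈ T ∧
      moved (capImage cap h (below h S (i + 1)) T) (capImage cap' h (below h S' (i + 1)) T) ≤
        moved (capImage cap h (below h S i) T) (capImage cap' h (below h S' i) T) +
          (run cap h S T i (h.2 e i)).card := by
  have hnone : ∀ (cap : Bin → ℕ) (S : Finset Ball), ∀ z ∈ byPriority h (atLevel h S i),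
      capImage cap h (below h S i) T z = none := fun cap S z hz =>
    capImage_of_notMem fun hz' => by
      have h1 := (mem_below.1 hz').2
      have h2 := (mem_atLevel.1 (mem_byPriority.1 hz)).2
      rw [h2] at h1
      exact lt_irrefl _ h1
  have hfe := inv.free e
  have hle := inv.le e
  rw [if_pos rfl] at hfe
  -- The level is started with `p` at the hole itself, which makes the hole trivially the first free
  -- bin from `p`.
  obtain ⟨e', inv', hfirst', hm⟩ := holeAt_foldl (l := byPriority h (atLevel h S i)) hh
    (fun z hz => (mem_atLevel.1 (mem_byPriority.1 hz)).2) (nodup_byPriority _ _) (hnone cap S)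
    (hS ▸ hnone cap' S') inv (isFirst_self heT (by omega)) (by
      have h1 := card_assigned_capImage_le cap h (below h S i) T
      have h2 := card_below_succ h S i
      have h3 := Finset.card_le_card (below_subset h S (i + 1))
      rw [length_byPriority]
      omega)
  rw [← capImage_below_succ] at inv' hfirst' hm
  rw [← hS, ← capImage_below_succ] at inv' hm
  have hnext : nextHole cap h S T i e = e' := nextHole_eq hh hfirst'
  rw [hnext]
  refine ⟨inv', hfirst'.1, ?_⟩
  have := card_nearer_lt (S := S) hfirst'
  omega

/-- From level `j₀` on the two systems receive the same balls, so their whole difference is the hole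
at `b`. The bound iterates `holeAt_level`, and the bins `hole` are computed from the first system
alone. -/
theorem hole_mem_and_moved_le {cap cap' : Bin → ℕ} {h : Hashes k Ball Bin} (hh : TieFree h)
    {S S' : Finset Ball} {T : Finset Bin} {j₀ : ℕ} {b : Bin} (hbT : b ∈ T)
    (hS : ∀ i : Fin k, j₀ ≤ i → atLevel h S' i = atLevel h S i)
    (hcard : S.card < ∑ b ∈ T, cap b)
    (inv : HoleAt cap cap' (capImage cap h (below h S j₀) T) (capImage cap' h (below h S' j₀) T) b)
    {j : ℕ} (hj : j₀ ≤ j) (hjk : j ≤ k) :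
    HoleAt cap cap' (capImage cap h (below h S j) T)
        (capImage cap' h (below h S' j) T) (hole cap h S T j₀ b j) ∧
      hole cap h S T j₀ b j ∈ T ∧
      moved (capImage cap h (below h S j) T) (capImage cap' h (below h S' j) T) ≤
        moved (capImage cap h (below h S j₀) T) (capImage cap' h (below h S' j₀) T) +
          ∑ i ∈ Finset.univ.filter (fun i : Fin k => j₀ ≤ (i : ℕ) ∧ (i : ℕ) < j),
            (run cap h S T i (h.2 (hole cap h S T j₀ b i) i)).card := by
  induction j, hj using Nat.le_induction with
  | base => rw [hole_of_le _ _ _ _ _ le_rfl]; exact ⟨inv, hbT, by omega⟩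
  | succ j hj ih =>
    obtain ⟨inv₁, hT₁, hm₁⟩ := ih (by omega)
    obtain ⟨inv₂, hT₂, hm₂⟩ := holeAt_level (i := ⟨j, hjk⟩) hh hT₁ (hS ⟨j, hjk⟩ hj) hcard inv₁
    rw [hole_succ _ _ _ _ _ hj]
    refine ⟨inv₂, hT₂, hm₂.trans ?_⟩
    have : (Finset.univ.filter fun i : Fin k => j₀ ≤ (i : ℕ) ∧ (i : ℕ) < j + 1) =
        insert ⟨j, hjk⟩ (Finset.univ.filter fun i : Fin k => j₀ ≤ (i : ℕ) ∧ (i : ℕ) < j) := by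
      ext i
      simp only [Finset.mem_filter, Finset.mem_univ, true_and, Finset.mem_insert, Fin.ext_iff]
      omega
    rw [this, Finset.sum_insert (by simp)]
    simp only at hm₁ ⊢
    omega

/-- Lowering the capacity of the bin `b` by one moves at most as many balls as there are bins in the
runs of the additional free place. -/
theorem moved_capacity_le {cap cap' : Bin → ℕ} {h : Hashes k Ball Bin} (hh : TieFree h)
    {S : Finset Ball} {T : Finset Bin} {b : Bin} (hbT : b ∈ T)
    (hcap : ∀ c, cap c = cap' c + if c = b then 1 else 0) (hcard : S.card < ∑ b ∈ T, cap b) :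
    moved (capImage cap h S T) (capImage cap' h S T) ≤
      ∑ i : Fin k, (run cap h S T i (h.2 (hole cap h S T 0 b i) i)).card := by
  have hemp : ∀ cap : Bin → ℕ, capImage cap h (below h S 0) T = fun _ => none := fun cap => by
    funext y
    exact capImage_of_notMem (by simp [below_zero])
  have := (hole_mem_and_moved_le (cap := cap) (cap' := cap') (S := S) (S' := S) hh hbT
    (fun _ _ => rfl) hcard ?_ (Nat.zero_le k) le_rfl).2.2
  · rw [below_top, hemp, hemp, moved_self, zero_add] at this
    refine this.trans (Finset.sum_le_sum_of_subset (Finset.filter_subset _ _))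
  · rw [hemp, hemp]
    exact ⟨fun c => by simp only [load_none, hcap]; omega, fun c => by simp [load_none]⟩

theorem exists_free {cap : Bin → ℕ} {T : Finset Bin} {a : Ball → Option Bin}
    (hroom : (Finset.univ.filter fun y => a y ≠ none).card < ∑ b ∈ T, cap b) :
    ∃ d ∈ T, load a d < cap d := by
  by_contra! hc
  exact absurd (Finset.sum_le_sum hc) (not_le.2 ((sum_load_le a T).trans_lt hroom))

theorem exists_levelLoad_lt {cap : Bin → ℕ} {h : Hashes k Ball Bin} {S : Finset Ball}
    {T : Finset Bin} (hcard : S.card < ∑ b ∈ T, cap b) (j : ℕ) :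
    ∃ d ∈ T, levelLoad cap h S T j d < cap d :=
  exists_free (((card_assigned_capImage_le _ _ _ _).trans
    (Finset.card_le_card (below_subset h S j))).trans_lt hcard)

/-- The first bin clockwise from the hash value of `x` that is not full after the level of `x`
(`d`, if there is none). -/
noncomputable def landing (cap : Bin → ℕ) (h : Hashes k Ball Bin) (S : Finset Ball)
    (T : Finset Bin) (x : Ball) (d : Bin) : Bin :=
  ((probes h T x).find? fun b => levelLoad cap h S T ((h.1 x).1 + 1) b < cap b).getD d

theorem atLevel_insert_of_ne {h : Hashes k Ball Bin} {S : Finset Ball} {x : Ball} {i : Fin k}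
    (hi : (h.1 x).1 ≠ i) : atLevel h (insert x S) i = atLevel h S i := by
  rw [atLevel, Finset.filter_insert, if_neg hi, atLevel]

theorem below_insert_of_le {h : Hashes k Ball Bin} {S : Finset Ball} {x : Ball} {j : ℕ}
    (hj : j ≤ ((h.1 x).1 : ℕ)) : below h (insert x S) j = below h S j := by
  rw [below, Finset.filter_insert, if_neg (by omega), below]

theorem above_beneath_insert (h : Hashes k Ball Bin) (S : Finset Ball) (x : Ball) :
    above h (insert x S) x = above h S x ∧ beneath h (insert x S) x = beneath h S x := by
  rw [above, beneath, Finset.filter_insert, Finset.filter_insert, if_neg (lt_irrefl _),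
    if_neg (lt_irrefl _), above, beneath]
  exact ⟨rfl, rfl⟩

/-- The bin of the place that the ball `x` takes away, before level `i`, if this level is above the
level of `x` (`d`, otherwise). -/
noncomputable def ballHole (cap : Bin → ℕ) (h : Hashes k Ball Bin) (S : Finset Ball)
    (T : Finset Bin) (x : Ball) (d : Bin) (i : Fin k) : Bin :=
  if (h.1 x).1 < i then hole cap h S T ((h.1 x).1 + 1) (landing cap h S T x d) i else d

/-- The balls moved by the insertion of `x`. -/
theorem moved_insert_le {cap : Bin → ℕ} {h : Hashes k Ball Bin} (hh : TieFree h)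
    {S : Finset Ball} {T : Finset Bin} {x : Ball} (hx : x ∉ S) (d : Bin)
    (hcard : S.card < ∑ b ∈ T, cap b) :
    moved (capImage cap h S T) (capImage cap h (insert x S) T) ≤
      (run cap h S T (h.1 x).1 (h.1 x).2).card +
        ∑ i : Fin k, (run cap h S T i (h.2 (ballHole cap h S T x d i) i)).card := by
  set i := (h.1 x).1 with hi
  set S₁ := atLevel h S i with hS₁
  have hxS₁ : x ∉ S₁ := fun hx' => hx (mem_atLevel.1 hx').1
  have hins : atLevel h (insert x S) i = insert x S₁ := by
    rw [atLevel, Finset.filter_insert, if_pos hi.symm, hS₁, atLevel]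
  -- `A` is the common assignment just before `x` is placed. Placing `x` creates a hole in the first
  -- free bin from the point of `x`, and the balls of the same level beneath `x` push it on.
  set A := (byPriority h (above h S₁ x)).foldl (place cap h T) (capImage cap h (below h S i) T)
    with hA
  have e1 : capImage cap h (below h S (i + 1)) T =
      (byPriority h (beneath h S₁ x)).foldl (place cap h T) A := by
    rw [capImage_below_succ, ← hS₁, byPriority_of_notMem hxS₁, List.foldl_append]
  have e2 : capImage cap h (below h (insert x S) (i + 1)) T =
      (byPriority h (beneath h S₁ x)).foldl (place cap h T) (place cap h T A x) := by
    rw [capImage_below_succ, below_insert_of_le hi.le, hins,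
      byPriority_of_mem (Finset.mem_insert_self x S₁), (above_beneath_insert h S₁ x).1,
      (above_beneath_insert h S₁ x).2, List.foldl_append, List.foldl_cons]
  have hA' : A = capImage cap h (below h S i ∪ above h S₁ x) T := by
    rw [hA, capImage_union]
    intro y hy z hz
    exact prio_lt_of_below_atLevel y hy z (Finset.mem_filter.1 hz).1
  have hcA : (Finset.univ.filter fun y => A y ≠ none).card + (beneath h S₁ x).card <
      ∑ b ∈ T, cap b := by
    have h1 := card_assigned_capImage_le cap h (below h S i ∪ above h S₁ x) T
    have h2 := Finset.card_union_le (below h S i) (above h S₁ x)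
    have h3 := congrArg List.length (byPriority_of_notMem hxS₁ (h := h))
    simp only [List.length_append, length_byPriority] at h3
    have h4 := card_below_succ h S i
    rw [← hS₁] at h4
    have h5 := Finset.card_le_card (below_subset h S (i + 1))
    rw [← hA'] at h1
    omega
  have hAx : A x = none := by
    rw [hA']
    refine capImage_of_notMem ?_
    simp only [Finset.mem_union, mem_below, hx, above, Finset.mem_filter, hxS₁, false_and,
      or_self, not_false_eq_true]
  have hbot : ∀ z ∈ byPriority h (beneath h S₁ x), A z = none := by
    intro z hz
    have hz' := Finset.mem_filter.1 (mem_byPriority.1 hz)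
    rw [hA']
    refine capImage_of_notMem fun hzA => ?_
    rcases Finset.mem_union.1 hzA with hzA | hzA
    · have h1 := (mem_below.1 hzA).2
      rw [(mem_atLevel.1 hz'.1).2] at h1
      exact lt_irrefl _ h1
    · exact lt_asymm (Finset.mem_filter.1 hzA).2 hz'.2
  have hAle : ∀ b, load A b ≤ cap b := by
    rw [hA']
    exact load_capImage_le _ _ _ _
  obtain ⟨d₀, hd₀T, hd₀⟩ := exists_free (a := A) (T := T) (cap := cap) (by omega)
  obtain ⟨c, hc⟩ := find?_clockwise_isSome (h := h) (i := (h.1 x).1) (p := (h.1 x).2)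
    (F := fun b => load A b < cap b) hd₀T hd₀
  have hpl : place cap h T A x = Function.update A x (some c) := by rw [place, probes, hc]
  obtain ⟨e, inv, hfirst, hm⟩ := holeAt_foldl (cap := cap) (cap' := cap) (T := T)
    (l := byPriority h (beneath h S₁ x)) (a := A) (a' := place cap h T A x) (e := c)
    (p := (h.1 x).2) (i := i) hh
    (fun z hz => (mem_atLevel.1 (Finset.mem_filter.1 (mem_byPriority.1 hz)).1).2)
    (nodup_byPriority _ _) hbot
    (fun z hz => by
      rw [place, Function.update_of_ne, hbot z hz]
      rintro rfl
      exact hxS₁ (Finset.mem_filter.1 (mem_byPriority.1 hz)).1)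
    ⟨fun b => by rw [hpl, load_update A hAx]; omega, place_le_cap hAx hAle⟩
    (isFirst_of_find? hc) (by rw [length_byPriority]; exact hcA)
  rw [← e1, ← e2] at inv hm
  rw [← e1] at hfirst
  -- The hole at the end of this level is the first non-full bin from the point of `x`, whichever
  -- bin `x` took; hence it depends on the system without `x` only.
  have hland : landing cap h S T x d = e := by
    have hfind := hfirst.find?_eq hh
    exact congrArg (Option.getD · d) hfind
  have hm1 : moved A (place cap h T A x) ≤ 1 := by
    have := moved_update A A x (A x) (some c)
    rwa [Function.update_eq_self, moved_self, ← hpl] at this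
  have hn := card_nearer_lt (S := S) hfirst
  have htot := (hole_mem_and_moved_le (cap := cap) (cap' := cap) (S := S) (S' := insert x S)
    (j₀ := i + 1) hh hfirst.1 (fun i' hi' => atLevel_insert_of_ne fun he => by
      rw [← hi] at he
      rw [he] at hi'
      omega) hcard inv (j := k) i.2 le_rfl).2.2
  rw [below_top, below_top] at htot
  refine htot.trans (add_le_add (by omega) (le_trans (Finset.sum_le_sum fun i' hi' => ?_)
    (Finset.sum_le_sum_of_subset (Finset.filter_subset _ _))))
  have hlt : (h.1 x).1 < i' := Fin.lt_def.2 (Nat.lt_of_succ_le (Finset.mem_filter.1 hi').2.1)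
  rw [ballHole, hland, if_pos hlt]

end BoundedLoads

/-! ### The virtual bins visited by insertions and searches -/

namespace BoundedLoads

variable {k : ℕ} {Ball Bin : Type*} [Fintype Ball] [LinearOrder Ball] [LinearOrder Bin]

theorem hole_hole (cap : Bin → ℕ) (h : Hashes k Ball Bin) (S : Finset Ball) (T : Finset Bin)
    (b : Bin) {j₀ j₁ j : ℕ} (h01 : j₀ ≤ j₁) (hj : j₁ ≤ j) :
    hole cap h S T j₁ (hole cap h S T j₀ b j₁) j = hole cap h S T j₀ b j := by
  induction j, hj using Nat.le_induction with
  | base => rw [hole_of_le _ _ _ _ _ le_rfl]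
  | succ j hj ih => rw [hole_succ _ _ _ _ _ hj, ih, hole_succ _ _ _ _ _ (h01.trans hj)]

/-- A bin that is not full after a level is the first such bin from its own position. -/
theorem hole_eq_self {cap : Bin → ℕ} {h : Hashes k Ball Bin} (hh : TieFree h) {S : Finset Ball}
    {T : Finset Bin} {b : Bin} (hbT : b ∈ T) {j₀ j : ℕ} (hj : j₀ ≤ j) (hjk : j ≤ k)
    (hb : ∀ j' ≤ j, levelLoad cap h S T j' b < cap b) : hole cap h S T j₀ b j = b := by
  induction j, hj using Nat.le_induction with
  | base => rw [hole_of_le _ _ _ _ _ le_rfl]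
  | succ j hj ih =>
    rw [hole_succ _ _ _ _ _ hj, ih (by omega) fun j' hj' => hb j' (by omega)]
    exact nextHole_eq (i := ⟨j, hjk⟩) hh (isFirst_self hbT (hb (j + 1) le_rfl))

theorem run_subset_run {cap : Bin → ℕ} {h : Hashes k Ball Bin} {S : Finset Ball} {T : Finset Bin}
    {i : Fin k} {p : ℝ} {b e : Bin}
    (he : IsFirst h T i p (fun b => levelLoad cap h S T (i + 1) b < cap b) e)
    (hb : cwDist h i p b ≤ cwDist h i p e) :
    run cap h S T i (h.2 b i) ⊆ run cap h S T i p := by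
  intro c hc
  have hc' := Finset.mem_filter.1 hc
  refine Finset.mem_filter.2 ⟨hc'.1, fun d hd hFd => le_trans ?_ (he.2.2 d hd hFd)⟩
  rcases le_total (cwDist h i p b) (cwDist h i p c) with hbc | hbc
  · have h1 := hc'.2 e he.1 he.2.1
    have h2 := cwDist_eq_add hb
    have h3 := cwDist_eq_add hbc
    linarith
  · exact hbc.trans hb

/-- If the assignment `a` has the same loads as the static image at all levels that are relevant for
the unplaced ball `y`, then the insertion of `y` visits only bins of the runs of a free place. -/
theorem insertWalk_subset {C : ℕ} {h : Hashes k Ball Bin} (hh : TieFree h)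
    {S : Finset Ball} {T : Finset Bin} (hcard : S.card < ∑ _b ∈ T, C) (N : ℕ) :
    ∀ (a : Ball → Option Bin) (y : Ball) (l pre : List Bin) (p : ℝ) (e : Bin),
      (Finset.univ.filter fun w => prio h y < prio h w).card = N →
      a y = none →
      (∀ j : ℕ, ((h.1 y).1 : ℕ) < j → ∀ b,
        (Finset.univ.filter fun w => a w = some b ∧ ((h.1 w).1 : ℕ) < j).card =
          levelLoad (fun _ => C) h S T j b) →
      clockwise h T (h.1 y).1 p = pre ++ l →
      (∀ b ∈ pre, C ≤ levelLoad (fun _ => C) h S T ((h.1 y).1 + 1) b) →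
      IsFirst h T (h.1 y).1 p (fun b => levelLoad (fun _ => C) h S T ((h.1 y).1 + 1) b < C) e →
      ∀ v ∈ insertWalk C h T a y l,
        (v.1 = (h.1 y).1 ∧ v.2 ∈ run (fun _ => C) h S T v.1 p) ∨
        ((h.1 y).1 < v.1 ∧ v.2 ∈ run (fun _ => C) h S T v.1
          (h.2 (hole (fun _ => C) h S T ((h.1 y).1 + 1) e v.1) v.1)) := by
  induction N using Nat.strong_induction_on with
  | _ N IH =>
  intro a y l
  induction l with
  | nil =>
    intro pre p e _ _ _ _ _ _ v hv
    rw [insertWalk] at hv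
    simp at hv
  | cons b bs ih =>
    intro pre p e hN hay hcount hl hpre he v hv
    set i := (h.1 y).1 with hi
    have hbT : b ∈ T := mem_clockwise.1 (hl ▸ by simp : b ∈ clockwise h T i p)
    have hbrun : ∀ c ∈ T, levelLoad (fun _ => C) h S T (i + 1) c < C →
        cwDist h i p b ≤ cwDist h i p c := by
      intro c hc hFc
      have hpw := pairwise_clockwise h T i p
      have hc' : c ∈ clockwise h T i p := mem_clockwise.2 hc
      rw [hl] at hpw hc'
      rcases List.mem_append.1 hc' with hc' | hc'
      · exact absurd hFc (not_lt.2 (hpre c hc'))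
      · rcases List.mem_cons.1 hc' with rfl | hc'
        · exact le_rfl
        · exact List.rel_of_pairwise_cons (List.pairwise_append.1 hpw).2.1 hc'
    have hload : ∀ c, load a c = levelLoad (fun _ => C) h S T k c := by
      intro c
      rw [← hcount k i.2 c, load]
      simp
    have hloadC : ∀ c, load a c ≤ C := fun c => by
      rw [hload]
      exact levelLoad_le_cap (fun _ => C) _ _ _ _ _
    rw [insertWalk] at hv
    rcases Finset.mem_insert.1 hv with rfl | hv
    · exact Or.inl ⟨rfl, Finset.mem_filter.2 ⟨hbT, hbrun⟩⟩
    by_cases hfull : load a b < C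
    · rw [if_pos hfull] at hv
      simp at hv
    rw [if_neg hfull] at hv
    by_cases hz : ∃ z, a z = some b ∧ prio h y < prio h z ∧ ∀ w, a w = some b → prio h w ≤ prio h z
    · rw [dif_pos hz] at hv
      obtain ⟨hazb, hyz, -⟩ := hz.choose_spec
      set z := hz.choose with hzdef
      have hne : y ≠ z := fun hyz' => lt_irrefl _ (hyz' ▸ hyz)
      have hlev : i ≤ (h.1 z).1 := level_le_of_prio_lt hyz
      set a₂ := Function.update (Function.update a y (some b)) z none with ha₂
      -- Replacing `z` by `y` in `b` keeps the number of balls below level `j` as soon as `j`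
      -- exceeds both levels, so the invariant passes on to `z`.
      have hcount₂ : ∀ j : ℕ, ((h.1 z).1 : ℕ) < j → ∀ c,
          (Finset.univ.filter fun w => a₂ w = some c ∧ ((h.1 w).1 : ℕ) < j).card =
            levelLoad (fun _ => C) h S T j c := by
        intro j hj c
        have hij : (i : ℕ) < j := lt_of_le_of_lt hlev hj
        rw [← hcount j hij c]
        by_cases hcb : c = b
        · subst hcb
          have hset : (Finset.univ.filter fun w => a₂ w = some c ∧ ((h.1 w).1 : ℕ) < j) =
              insert y ((Finset.univ.filter fun w =>
                a w = some c ∧ ((h.1 w).1 : ℕ) < j).erase z) := by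
            ext w
            simp only [Finset.mem_filter, Finset.mem_univ, true_and, Finset.mem_insert,
              Finset.mem_erase, ha₂]
            by_cases hwz : w = z
            · simp [hwz, hne.symm]
            · by_cases hwy : w = y
              · rw [hwy, Function.update_of_ne hne, Function.update_self]
                simpa using hij
              · rw [Function.update_of_ne hwz, Function.update_of_ne hwy]
                simp [hwz, hwy]
          have hzmem : z ∈ Finset.univ.filter fun w => a w = some c ∧ ((h.1 w).1 : ℕ) < j := by
            simp [hazb, hj]
          rw [hset, Finset.card_insert_of_notMem (by simp [hay]), Finset.card_erase_of_mem hzmem]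
          have := Finset.card_pos.2 ⟨z, hzmem⟩
          omega
        · congr 1
          ext w
          simp only [Finset.mem_filter, Finset.mem_univ, true_and, ha₂]
          by_cases hwz : w = z
          · rw [hwz, Function.update_self, hazb]
            simp [Ne.symm hcb]
          · by_cases hwy : w = y
            · rw [hwy, Function.update_of_ne hne, Function.update_self, hay]
              simp [Ne.symm hcb]
            · rw [Function.update_of_ne hwz, Function.update_of_ne hwy]
      have hN₂ : (Finset.univ.filter fun w => prio h z < prio h w).card < N := by
        rw [← hN]
        refine Finset.card_lt_card ((Finset.ssubset_iff_of_subset fun w hw => ?_).2 ⟨z, ?_, ?_⟩)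
        · rw [Finset.mem_filter] at hw ⊢
          exact ⟨hw.1, hyz.trans hw.2⟩
        · simpa using hyz
        · simp
      have key := fun e' => IH _ hN₂ a₂ z (clockwise h T (h.1 z).1 (h.2 b (h.1 z).1)) []
        (h.2 b (h.1 z).1) e' rfl (by rw [ha₂, Function.update_self]) hcount₂ rfl (by simp)
      -- If `z` has the level of `y`, the walk goes on from `b` inside the same run. Otherwise it
      -- changes to a later circle.
      rcases hlev.eq_or_lt with hlev | hlev
      · rw [← hlev] at key hv
        rcases key e (he.of_between (hbrun e he.1 he.2.1)) v hv with ⟨hv1, hv2⟩ | hv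
        · refine Or.inl ⟨hv1, ?_⟩
          rw [hv1] at hv2 ⊢
          exact run_subset_run he (hbrun e he.1 he.2.1) hv2
        · exact Or.inr hv
      -- The bin `b` holds the ball `z` of a later level, so it is not full before that level.
      -- Therefore `b` is where the hole ends at the level of `y`, and the hole stays there until
      -- the level of `z`.
      · have hbfree : ∀ j ≤ ((h.1 z).1 : ℕ), levelLoad (fun _ => C) h S T j b < C := by
          intro j hj
          refine lt_of_le_of_lt (levelLoad_mono _ _ _ _ hj b) ?_
          rw [← hcount _ hlev b]
          refine lt_of_lt_of_le (Finset.card_lt_card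
            ((Finset.ssubset_iff_of_subset fun w hw => ?_).2 ⟨z, ?_, ?_⟩)) (hloadC b)
          · rw [Finset.mem_filter] at hw ⊢
            exact ⟨hw.1, hw.2.1⟩
          · simpa using hazb
          · simp
        have hbe : b = e := IsFirst.unique hh ⟨hbT, hbfree (i + 1) hlev, hbrun⟩ he
        subst hbe
        have hhole : hole (fun _ => C) h S T (i + 1) b (h.1 z).1 = b :=
          hole_eq_self hh hbT hlev (h.1 z).1.2.le hbfree
        obtain ⟨d, hdT, hd⟩ := exists_levelLoad_lt (h := h) hcard ((h.1 z).1 + 1)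
        obtain ⟨e', he'⟩ := find?_clockwise_isSome (h := h) (i := (h.1 z).1)
          (p := h.2 b (h.1 z).1)
          (F := fun b => levelLoad (fun _ => C) h S T ((h.1 z).1 + 1) b < C) hdT hd
        have hfirst := isFirst_of_find? he'
        have hhole' : hole (fun _ => C) h S T (i + 1) b ((h.1 z).1 + 1) = e' := by
          rw [hole_succ _ _ _ _ _ hlev, hhole]
          exact nextHole_eq hh hfirst
        rcases key e' hfirst v hv with ⟨hv1, hv2⟩ | ⟨hv1, hv2⟩
        · refine Or.inr ⟨hv1 ▸ hlev, ?_⟩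
          rw [hv1] at hv2 ⊢
          rwa [hhole]
        · refine Or.inr ⟨hlev.trans hv1, ?_⟩
          rwa [← hhole', hole_hole _ _ _ _ _ (Nat.le_succ_of_le hlev) hv1] at hv2
    · rw [dif_neg hz] at hv
      -- No ball of the full bin `b` has lower priority than `y`; all of them have at most the level
      -- of `y`, so `b` is already full after that level.
      have hbfull : C ≤ levelLoad (fun _ => C) h S T (i + 1) b := by
        rw [← hcount _ (Nat.lt_succ_self _) b]
        refine (not_lt.1 hfull).trans (Finset.card_le_card fun w hw => ?_)
        have hwb : a w = some b := by simpa using hw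
        obtain ⟨w₀, hw₀, hmax⟩ := Finset.exists_max_image
          (Finset.univ.filter fun w => a w = some b) (prio h) ⟨w, by simpa using hw⟩
        rw [Finset.mem_filter] at hw₀
        have hw₀y : ¬ prio h y < prio h w₀ := fun hlt =>
          hz ⟨w₀, hw₀.2, hlt, fun w' hw' => hmax w' (by simpa using hw')⟩
        have hwy : prio h w ≤ prio h y := (hmax w (by simpa using hw)).trans (not_lt.1 hw₀y)
        refine Finset.mem_filter.2 ⟨Finset.mem_univ _, hwb, Nat.lt_succ_of_le ?_⟩
        rcases hwy.lt_or_eq with hlt | heq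
        · exact level_le_of_prio_lt hlt
        · rw [prio_injective h heq]
      refine ih (pre ++ [b]) p e hN hay hcount (by simp [hl]) ?_ he v hv
      intro c hc
      rcases List.mem_append.1 hc with hc | hc
      · exact hpre c hc
      · rw [List.mem_singleton.1 hc]
        exact hbfull

/-- The virtual bins visited by the insertion of `x`. -/
theorem insertVisits_le {C : ℕ} {h : Hashes k Ball Bin} (hh : TieFree h)
    {S : Finset Ball} {T : Finset Bin} {x : Ball} (hx : x ∉ S) (d : Bin)
    (hcard : S.card < ∑ _b ∈ T, C) :
    insertVisits C h S T x ≤ (run (fun _ => C) h S T (h.1 x).1 (h.1 x).2).card +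
      ∑ i : Fin k,
        (run (fun _ => C) h S T i (h.2 (ballHole (fun _ => C) h S T x d i) i)).card := by
  obtain ⟨c, hcT, hc⟩ := exists_levelLoad_lt (h := h) hcard ((h.1 x).1 + 1)
  obtain ⟨e, he⟩ := find?_clockwise_isSome (h := h) (i := (h.1 x).1) (p := (h.1 x).2)
    (F := fun b => levelLoad (fun _ => C) h S T ((h.1 x).1 + 1) b < C) hcT hc
  have hland : landing (fun _ => C) h S T x d = e := by
    rw [landing, probes, he]
    rfl
  rw [insertVisits]
  have key := insertWalk_subset hh hcard _ (image C h S T) x (probes h T x) [] (h.1 x).2 e rfl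
    (capImage_of_notMem hx) (fun j _ b => (levelLoad_eq _ _ _ _ _ _).symm) rfl (by simp)
    (isFirst_of_find? he)
  refine (Finset.card_le_card (t := ((run (fun _ => C) h S T (h.1 x).1 (h.1 x).2).image
    fun b => ((h.1 x).1, b)) ∪ Finset.univ.biUnion fun i : Fin k =>
      (run (fun _ => C) h S T i (h.2 (ballHole (fun _ => C) h S T x d i) i)).image
        fun b => (i, b)) fun v hv => ?_).trans ?_
  · rcases key v hv with ⟨hv1, hv2⟩ | ⟨hv1, hv2⟩
    · rw [hv1] at hv2
      exact Finset.mem_union_left _ (Finset.mem_image.2 ⟨v.2, hv2, by rw [← hv1]⟩)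
    · have hb : ballHole (fun _ => C) h S T x d v.1 =
          hole (fun _ => C) h S T ((h.1 x).1 + 1) e v.1 := by rw [ballHole, if_pos hv1, hland]
      rw [← hb] at hv2
      exact Finset.mem_union_right _
        (Finset.mem_biUnion.2 ⟨v.1, Finset.mem_univ _, Finset.mem_image.2 ⟨v.2, hv2, rfl⟩⟩)
  · exact (Finset.card_union_le _ _).trans (add_le_add Finset.card_image_le
      (Finset.card_biUnion_le.trans (Finset.sum_le_sum fun _ _ => Finset.card_image_le)))

/-- The elements counted on the left are those with all predecessors satisfying `q`; the list has no
repetitions, so they are distinct elements of `R`. -/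
theorem length_takeWhile_add_take_le {α : Type*} [DecidableEq α] {l : List α} (hl : l.Nodup)
    (q : α → Bool) (R : Finset α)
    (hR : ∀ as b bs, l = as ++ b :: bs → (∀ c ∈ as, q c) → b ∈ R) :
    (l.takeWhile q).length + ((l.dropWhile q).take 1).length ≤ R.card := by
  induction l generalizing R with
  | nil => simp
  | cons b l ih =>
    have hb : b ∈ R := hR [] b l rfl (by simp)
    rw [List.nodup_cons] at hl
    by_cases hq : q b
    · have := ih hl.2 (R.erase b) fun as c cs hl' has => by
        refine Finset.mem_erase.2 ⟨fun hcb => hl.1 ?_, hR (b :: as) c cs (by simp [hl']) ?_⟩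
        · rw [hl', ← hcb]
          simp
        · simpa using ⟨hq, has⟩
      rw [Finset.card_erase_of_mem hb] at this
      rw [List.takeWhile_cons_of_pos hq, List.dropWhile_cons_of_pos hq, List.length_cons]
      have := Finset.card_pos.2 ⟨b, hb⟩
      omega
    · rw [List.takeWhile_cons_of_neg hq, List.dropWhile_cons_of_neg hq]
      simpa using Finset.card_pos.2 ⟨b, hb⟩

/-- The balls of lower priority than `x`, and `x` itself, are irrelevant for the search of `x`. -/
theorem searchVisits_erase (C : ℕ) (h : Hashes k Ball Bin) (S : Finset Ball) (T : Finset Bin)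
    (x : Ball) : searchVisits C h S T x = searchVisits C h (S.erase x) T x := by
  have key : ∀ y, prio h y < prio h x → image C h S T y = image C h (S.erase x) T y := by
    intro y hy
    have hsplit : ∀ S' : Finset Ball, S' = above h S' x ∪ S'.filter fun z => prio h x ≤ prio h z := by
      intro S'
      ext z
      simp only [Finset.mem_union, Finset.mem_filter, above, ← and_or_left]
      exact ⟨fun hz => ⟨hz, lt_or_ge _ _⟩, fun hz => hz.1⟩
    have hlt : ∀ S' : Finset Ball, ∀ u ∈ above h S' x,
        ∀ v ∈ S'.filter fun z => prio h x ≤ prio h z, prio h u < prio h v :=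
      fun S' u hu v hv => (Finset.mem_filter.1 hu).2.trans_le (Finset.mem_filter.1 hv).2
    have hab : above h (S.erase x) x = above h S x := by
      ext z
      simp only [above, Finset.mem_filter, Finset.mem_erase]
      exact ⟨fun hz => ⟨hz.1.2, hz.2⟩, fun hz => ⟨⟨by rintro rfl; exact lt_irrefl _ hz.2, hz.1⟩, hz.2⟩⟩
    by_cases hyS : y ∈ S
    · have hya : y ∈ above h S x := Finset.mem_filter.2 ⟨hyS, hy⟩
      have hval : ∀ S' : Finset Ball, y ∈ above h S' x →
          capImage (fun _ => C) h S' T y = capImage (fun _ => C) h (above h S' x) T y := by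
        intro S' hy'
        conv_lhs => rw [hsplit S']
        exact capImage_union_of_mem (hlt S') hy'
      rw [image_eq_capImage, image_eq_capImage, hval S hya, hval (S.erase x) (by rwa [hab]), hab]
    · rw [image_eq_capImage, image_eq_capImage, capImage_of_notMem hyS,
        capImage_of_notMem fun hy' => hyS (Finset.mem_of_mem_erase hy')]
  have hiff : ∀ b, FilledAbove C h (image C h S T) x b ↔
      FilledAbove C h (image C h (S.erase x) T) x b := by
    intro b
    unfold FilledAbove
    have : (Finset.univ.filter fun y => image C h S T y = some b ∧ prio h y < prio h x) =
        Finset.univ.filter fun y => image C h (S.erase x) T y = some b ∧ prio h y < prio h x := by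
      ext y
      simp only [Finset.mem_filter, Finset.mem_univ, true_and]
      exact and_congr_left fun hy => by rw [key y hy]
    rw [this]
  unfold searchVisits
  simp only [hiff]

/-- The virtual bins visited by the search of `x`. -/
theorem searchVisits_le (C : ℕ) (h : Hashes k Ball Bin) (S : Finset Ball) (T : Finset Bin)
    (x : Ball) :
    searchVisits C h S T x ≤ (run (fun _ => C) h S T (h.1 x).1 (h.1 x).2).card := by
  refine length_takeWhile_add_take_le (nodup_clockwise _ _ _ _) _ _ fun as b bs hl has => ?_
  have hpw := pairwise_clockwise h T (h.1 x).1 (h.1 x).2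
  change clockwise _ _ _ _ = _ at hl
  refine Finset.mem_filter.2 ⟨mem_clockwise.1 (hl ▸ by simp :
    b ∈ clockwise h T (h.1 x).1 (h.1 x).2), fun c hc hFc => ?_⟩
  have hc' : c ∈ clockwise h T (h.1 x).1 (h.1 x).2 := mem_clockwise.2 hc
  rw [hl] at hpw hc'
  rcases List.mem_append.1 hc' with hc' | hc'
  · have hfill : FilledAbove C h (image C h S T) x c := by simpa using has c hc'
    refine absurd hFc (not_lt.2 (le_trans hfill ?_))
    rw [levelLoad_eq]
    refine Finset.card_le_card fun y => ?_
    simp only [Finset.mem_filter, Finset.mem_univ, true_and]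
    exact fun hy => ⟨hy.1, Nat.lt_succ_of_le (level_le_of_prio_lt hy.2)⟩
  · rcases List.mem_cons.1 hc' with rfl | hc'
    · exact le_rfl
    · exact List.rel_of_pairwise_cons (List.pairwise_append.1 hpw).2.1 hc'

end BoundedLoads

/-! ### A long run needs a crowded arc -/

namespace BoundedLoads

variable {k : ℕ} {Ball Bin : Type*} [Fintype Ball] [LinearOrder Ball] [LinearOrder Bin]

theorem fract_sub_eq_add_of_lt {p e q : ℝ} (hlt : Int.fract (e - p) + Int.fract (q - e) < 1) :
    Int.fract (q - p) = Int.fract (e - p) + Int.fract (q - e) := by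
  rw [Int.fract_eq_iff]
  refine ⟨add_nonneg (Int.fract_nonneg _) (Int.fract_nonneg _), hlt, ⌊e - p⌋ + ⌊q - e⌋, ?_⟩
  have h1 := Int.floor_add_fract (e - p)
  have h2 := Int.floor_add_fract (q - e)
  push_cast
  linarith

/-- The points of the circle, given by their clockwise distance from some point, that are less than
`s` after or less than `u` before that point. -/
def arc (s u : ℝ) : Set ℝ := {t | t < s ∨ 1 - u < t}

noncomputable instance (s u t : ℝ) : Decidable (t ∈ arc s u) := Classical.dec _

/-- If all bins between `p` and `b` are full after level `i`, then in some arc that ends at `b`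
and contains `p` there are at least as many balls of level `i` as there is free room before this
level. -/
theorem exists_arc_of_mem_run {cap : Bin → ℕ} {h : Hashes k Ball Bin} {S : Finset Ball}
    {T : Finset Bin} (hcard : S.card < ∑ b ∈ T, cap b) {i : Fin k} {p : ℝ} {b : Bin}
    (hb : b ∈ run cap h S T i p) :
    ∃ u, 0 ≤ u ∧ u ≤ 1 - cwDist h i p b ∧
      ∀ T' ⊆ T, (∀ c ∈ T', cwDist h i p c ∈ arc (cwDist h i p b) u) →
      ∑ c ∈ T', (cap c - levelLoad cap h S T i c) ≤
        ((atLevel h S i).filter fun y =>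
          Int.fract ((h.1 y).2 - p) ∈ arc (cwDist h i p b) u).card := by
  classical
  have hb' := Finset.mem_filter.1 hb
  rcases (cwDist_nonneg h i p b).eq_or_lt with hzero | hpos
  · refine ⟨0, le_rfl, by linarith, fun T' _ hT' => ?_⟩
    rw [Finset.sum_eq_zero]
    · exact Nat.zero_le _
    · intro c hc
      rcases hT' c hc with hlt | hlt
      · exact absurd hlt (not_lt.2 (hzero ▸ cwDist_nonneg h i p c))
      · exact absurd hlt (by have := cwDist_lt_one h i p c; linarith)
  obtain ⟨d, hdT, hd⟩ := exists_levelLoad_lt (h := h) hcard (i + 1)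
  -- The non-full bin farthest clockwise from `p` is the last one before `p`. The arc reaches back
  -- to it, which determines `u`.
  obtain ⟨c₀, hc₀, hmax⟩ := Finset.exists_max_image
    (T.filter fun c => levelLoad cap h S T (i + 1) c < cap c) (cwDist h i p)
    ⟨d, Finset.mem_filter.2 ⟨hdT, hd⟩⟩
  rw [Finset.mem_filter] at hc₀
  have hbc₀ := hb'.2 c₀ hc₀.1 hc₀.2
  have hc₀1 := cwDist_lt_one h i p c₀
  refine ⟨1 - cwDist h i p c₀, by linarith, by linarith, fun T' hTT hT' => ?_⟩
  have hfull : ∀ c ∈ T', cap c - levelLoad cap h S T i c ≤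
      ((atLevel h S i).filter fun y => capImage cap h S T y = some c).card := by
    intro c hc
    have h1 := levelLoad_succ cap h S T i c
    by_cases hFc : levelLoad cap h S T (i + 1) c < cap c
    · have h2 := hb'.2 c (hTT hc) hFc
      have h3 := hmax c (Finset.mem_filter.2 ⟨hTT hc, hFc⟩)
      rcases hT' c hc with hlt | hlt
      · exact absurd hlt (not_lt.2 h2)
      · exact absurd hlt (by linarith)
    · omega
  refine (Finset.sum_le_sum hfull).trans ?_
  rw [← Finset.card_biUnion]
  · refine Finset.card_le_card fun y hy => ?_
    obtain ⟨c, hc, hy⟩ := Finset.mem_biUnion.1 hy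
    obtain ⟨hyL, hyc⟩ := Finset.mem_filter.1 hy
    refine Finset.mem_filter.2 ⟨hyL, ?_⟩
    obtain ⟨hyS, hyi⟩ := mem_atLevel.1 hyL
    -- A ball outside the arc has its point between `b` and `c₀`. To reach a bin of the arc it would
    -- pass `c₀`, which is not full.
    by_contra hcon
    change ¬ (_ ∨ _) at hcon
    simp only [not_or, not_lt] at hcon
    have hy₀ : Int.fract ((h.1 y).2 - p) ≤ Int.fract (h.2 c₀ i - p) := by
      have := hcon.2
      rw [cwDist] at this
      linarith
    have e0 := fract_sub_eq_add hy₀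
    have := full_of_passed (h := h) (cap := cap) (T := T) hyS (b := c₀) (fun c' hc' => ?_) hc₀.1
    · rw [hyi] at this
      exact absurd hc₀.2 (not_lt.2 this)
    · rw [hyc, Option.some.injEq] at hc'
      subst hc'
      rw [hyi]
      by_contra! hle
      have h1 : Int.fract ((h.1 y).2 - p) + Int.fract (h.2 c i - (h.1 y).2) ≤ cwDist h i p c₀ := by
        unfold cwDist at hle ⊢
        linarith
      have e1 : cwDist h i p c = _ := fract_sub_eq_add_of_lt (h1.trans_lt hc₀1)
      rw [← e1] at h1
      have h2 := Int.fract_nonneg (h.2 c i - (h.1 y).2)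
      rcases hT' c hc with hlt | hlt
      · linarith [hcon.1]
      · linarith
  · intro c _ c' _ hcc
    refine Finset.disjoint_left.2 fun y hy hy' => hcc ?_
    have h1 := (Finset.mem_filter.1 hy).2
    have h2 := (Finset.mem_filter.1 hy').2
    exact Option.some.inj (h1.symm.trans h2)

end BoundedLoads

/-! ### Product measures and uniform points of the circle -/

namespace BoundedLoads

section Pi

variable {ι : Type*} [Fintype ι] {A B : Type*} [MeasurableSpace A] [MeasurableSpace B]

theorem lintegral_pi_prod (μ : Measure A) [IsProbabilityMeasure μ] {f : ι → A → ℝ≥0∞}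
    (hf : ∀ i, Measurable (f i)) (s : Finset ι) :
    ∫⁻ ω, ∏ i ∈ s, f i (ω i) ∂(Measure.pi fun _ : ι => μ) = ∏ i ∈ s, ∫⁻ t, f i t ∂μ := by
  refine (ProbabilityTheory.lintegral_prod_eq_prod_lintegral_of_indepFun s
    (fun i (ω : ι → A) => f i (ω i))
    (ProbabilityTheory.iIndepFun_pi fun i => (hf i).aemeasurable)
    fun i => (hf i).comp (measurable_pi_apply i)).trans ?_
  refine Finset.prod_congr rfl fun i _ => ?_
  exact (measurePreserving_eval (fun _ : ι => μ) i).lintegral_comp (hf i)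

/-- Resampling the coordinates of a product measure separately. -/
theorem measurePreserving_resample (μ : Measure A) (ν : Measure B) [IsProbabilityMeasure μ]
    [IsProbabilityMeasure ν] {g : ι → A × B → A}
    (hg : ∀ i, MeasurePreserving (g i) (μ.prod ν) μ) :
    MeasurePreserving (fun z : (ι → A) × (ι → B) => fun i => g i (z.1 i, z.2 i))
      ((Measure.pi fun _ => μ).prod (Measure.pi fun _ => ν)) (Measure.pi fun _ => μ) := by
  have h1 := (measurePreserving_arrowProdEquivProdArrow A B ι (fun _ => μ) fun _ => ν).symm
  exact (measurePreserving_pi (fun _ => μ.prod ν) (fun _ => μ) hg).comp h1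

/-- Resampling one coordinate of a product measure. -/
theorem measurePreserving_update [DecidableEq ι] (μ : Measure A) [IsProbabilityMeasure μ] (i : ι) :
    MeasurePreserving (fun z : A × (ι → A) => Function.update z.2 i z.1)
      (μ.prod (Measure.pi fun _ => μ)) (Measure.pi fun _ => μ) := by
  have h1 := measurePreserving_resample (ι := ι) μ μ
    (g := fun j => if j = i then Prod.snd else Prod.fst) fun j => by
      split_ifs
      · exact measurePreserving_snd
      · exact measurePreserving_fst
  have h2 : MeasurePreserving (fun z : (ι → A) × (ι → A) => (z.2 i, z.1))
      ((Measure.pi fun _ => μ).prod (Measure.pi fun _ => μ))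
      (μ.prod (Measure.pi fun _ => μ)) :=
    ((measurePreserving_eval (fun _ : ι => μ) i).prod (MeasurePreserving.id _)).comp
      Measure.measurePreserving_swap
  have hm : Measurable fun z : A × (ι → A) => Function.update z.2 i z.1 := by
    refine measurable_pi_iff.2 fun j => ?_
    by_cases hj : j = i
    · subst hj
      simpa using measurable_fst
    · simp only [Function.update_of_ne hj]
      exact (measurable_pi_apply j).comp measurable_snd
  refine ⟨hm, ?_⟩
  rw [← h2.map_eq, Measure.map_map hm h2.measurable]
  refine Eq.trans ?_ h1.map_eq
  congr 1
  funext z j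
  by_cases hj : j = i
  · subst hj
    simp
  · simp [hj]

/-- For a function that need not be measurable only this inequality is available, and upper bounds
need no more. -/
theorem lintegral_le_of_measurePreserving {μ : Measure A} {ν : Measure B} {g : A → B}
    (hg : MeasurePreserving g μ ν) (f : B → ℝ≥0∞) : ∫⁻ b, f b ∂ν ≤ ∫⁻ a, f (g a) ∂μ := by
  rw [← hg.map_eq]
  exact lintegral_map_le _ _

end Pi

section Circle

instance : IsProbabilityMeasure circleLaw := ⟨by simp [circleLaw]⟩

/-- The clockwise distance of a uniform point from `p` is uniform. -/
theorem measurePreserving_fract_sub (p : ℝ) :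
    MeasurePreserving (fun t => Int.fract (t - p)) circleLaw circleLaw := by
  have hm : Measurable fun t : ℝ => Int.fract (t - p) :=
    measurable_fract.comp (measurable_id.sub_const p)
  have hm₀ : Measurable fun t : ℝ => Int.fract (t - 0) :=
    measurable_fract.comp (measurable_id.sub_const 0)
  refine ⟨hm, Measure.ext fun s hs => ?_⟩
  -- The condition is invariant under integer translations, and all half-open unit intervals are
  -- fundamental domains for them.
  have key : ∀ q : ℝ, volume ({t | Int.fract (t - q) ∈ s} ∩ Set.Ioc 0 1) =
      volume ({t | Int.fract (t - q) ∈ s} ∩ Set.Ioc q (q + 1)) := by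
    intro q
    have h0 := isAddFundamentalDomain_Ioc (zero_lt_one (α := ℝ)) 0
    have hq := isAddFundamentalDomain_Ioc (zero_lt_one (α := ℝ)) q
    rw [zero_add] at h0
    refine h0.measure_set_eq hq ((measurable_fract.comp (measurable_id.sub_const q)) hs) ?_
    rintro ⟨g, hg⟩
    obtain ⟨n, rfl⟩ := AddSubgroup.mem_zmultiples_iff.1 hg
    ext t
    simp only [Set.mem_preimage, Set.mem_ofPred_eq]
    change Int.fract (n • (1 : ℝ) + t - q) ∈ s ↔ _
    rw [zsmul_eq_mul, mul_one, add_sub_assoc, Int.fract_intCast_add]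
  have hshift : volume ({t | Int.fract (t - p) ∈ s} ∩ Set.Ioc p (p + 1)) =
      volume ({t | Int.fract (t - 0) ∈ s} ∩ Set.Ioc 0 1) := by
    rw [← measure_preimage_add_right volume p
      ({t | Int.fract (t - p) ∈ s} ∩ Set.Ioc p (p + 1))]
    congr 1
    ext t
    simp [add_comm]
  have hIoc : circleLaw = volume.restrict (Set.Ioc 0 1) := by
    rw [circleLaw]
    exact Measure.restrict_congr_set Ico_ae_eq_Ioc
  rw [Measure.map_apply hm hs]
  have e1 : circleLaw ((fun t => Int.fract (t - p)) ⁻¹' s) =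
      volume ({t | Int.fract (t - p) ∈ s} ∩ Set.Ioc 0 1) := by
    rw [hIoc, Measure.restrict_apply (hm hs)]
    rfl
  have e2 : circleLaw ((fun t => Int.fract (t - 0)) ⁻¹' s) =
      volume ({t | Int.fract (t - 0) ∈ s} ∩ Set.Ioc 0 1) := by
    rw [hIoc, Measure.restrict_apply (hm₀ hs)]
    rfl
  rw [e1, key p, hshift, ← e2, circleLaw,
    Measure.restrict_apply (hm₀ hs),
    Measure.restrict_apply hs]
  congr 1
  ext t
  simp only [Set.mem_inter_iff, Set.mem_preimage, sub_zero]
  exact and_congr_left fun ht => by rw [Int.fract_eq_self.2 ⟨ht.1, ht.2⟩]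

theorem measurableSet_arc (s u : ℝ) : MeasurableSet (arc s u) :=
  (measurableSet_lt measurable_id measurable_const).union
    (measurableSet_lt measurable_const measurable_id)

theorem circleLaw_arc_le {s u : ℝ} (hs : 0 ≤ s) (hu : 0 ≤ u) :
    (circleLaw (arc s u)).toReal ≤ s + u := by
  refine ENNReal.toReal_le_of_le_ofReal (by positivity) ?_
  rw [circleLaw, Measure.restrict_apply (measurableSet_arc s u)]
  refine (measure_mono (t := Set.Ico 0 s ∪ Set.Ioo (1 - u) 1) ?_).trans
    ((measure_union_le _ _).trans ?_)
  · rintro t ⟨ht | ht, ht'⟩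
    · exact Or.inl ⟨ht'.1, ht⟩
    · exact Or.inr ⟨ht, ht'.2⟩
  · rw [Real.volume_Ico, Real.volume_Ioo, ← ENNReal.ofReal_add (by linarith) (by linarith)]
    exact ENNReal.ofReal_le_ofReal (by linarith)

theorem le_circleLaw_arc {s u : ℝ} (hs : 0 ≤ s) (hu : 0 ≤ u) (hsu : s + u ≤ 1) :
    s + u ≤ (circleLaw (arc s u)).toReal := by
  refine (ENNReal.ofReal_le_iff_le_toReal (measure_ne_top _ _)).1 ?_
  rw [circleLaw, Measure.restrict_apply (measurableSet_arc s u)]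
  refine le_trans ?_ (measure_mono (s := Set.Ico 0 s ∪ Set.Ioo (1 - u) 1) ?_)
  · rw [measure_union _ measurableSet_Ioo, Real.volume_Ico, Real.volume_Ioo,
      ← ENNReal.ofReal_add (by linarith) (by linarith)]
    · exact ENNReal.ofReal_le_ofReal (by linarith)
    · refine Set.disjoint_left.2 fun t ht ht' => ?_
      have h1 := ht.2
      have h2 := ht'.1
      linarith
  · rintro t (ht | ht)
    · exact ⟨Or.inl ht.2, ht.1, by linarith [ht.2]⟩
    · exact ⟨Or.inr ht.1, by linarith [ht.1], ht.2⟩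

/-- The exponential moment of the indicator of an arc: with `v` the exponential of a weight, this is
the factor of a single ball or bin. -/
theorem lintegral_fract_arc {p s u v : ℝ} (hv : 0 ≤ v) :
    ∫⁻ t, (if Int.fract (t - p) ∈ arc s u then ENNReal.ofReal v else 1) ∂circleLaw =
      ENNReal.ofReal (1 + (circleLaw (arc s u)).toReal * (v - 1)) := by
  have hA := measurableSet_arc s u
  have hm : Measurable fun t : ℝ => if t ∈ arc s u then ENNReal.ofReal v else 1 :=
    Measurable.ite hA measurable_const measurable_const
  rw [(measurePreserving_fract_sub p).lintegral_comp hm, ← lintegral_add_compl _ hA]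
  rw [setLIntegral_congr_fun (g := fun _ => ENNReal.ofReal v) hA fun t ht => if_pos ht,
    setLIntegral_congr_fun (g := fun _ => 1) hA.compl fun t ht => if_neg ht,
    setLIntegral_const, setLIntegral_const, one_mul, prob_compl_eq_one_sub hA]
  have h1 : circleLaw (arc s u) = ENNReal.ofReal (circleLaw (arc s u)).toReal :=
    (ENNReal.ofReal_toReal (measure_ne_top _ _)).symm
  have h2 : (circleLaw (arc s u)).toReal ≤ 1 := by
    have := ENNReal.toReal_mono ENNReal.one_ne_top (prob_le_one (μ := circleLaw) (s := arc s u))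
    simpa using this
  have h3 : 0 ≤ (circleLaw (arc s u)).toReal := ENNReal.toReal_nonneg
  generalize (circleLaw (arc s u)).toReal = m at h1 h2 h3
  rw [h1, ← ENNReal.ofReal_mul hv, ← ENNReal.ofReal_one, ← ENNReal.ofReal_sub _ h3,
    ← ENNReal.ofReal_add (by positivity) (by linarith)]
  congr 1
  ring

theorem circleLaw_Ico_le {a b : ℝ} (p : ℝ) :
    ∫⁻ t, (if a ≤ Int.fract (t - p) ∧ Int.fract (t - p) < b then 1 else 0) ∂circleLaw ≤
      ENNReal.ofReal (b - a) := by
  have hm : Measurable fun t : ℝ => (Set.Ico a b).indicator (1 : ℝ → ℝ≥0∞) t :=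
    measurable_one.indicator measurableSet_Ico
  have := (measurePreserving_fract_sub p).lintegral_comp hm
  rw [lintegral_indicator_one measurableSet_Ico] at this
  refine le_of_eq_of_le ?_ (this.trans_le ?_)
  · refine lintegral_congr fun t => ?_
    simp [Set.indicator_apply]
  · rw [circleLaw, ← Real.volume_Ico]
    exact Measure.restrict_apply_le _ _

end Circle

end BoundedLoads

/-! ### Exponential moments and the expected length of a run on one circle -/

namespace BoundedLoads

section Chernoff

variable {Ball Bin : Type*} [Fintype Ball] [Fintype Bin] [DecidableEq Bin]

/-- From `exp x - 1 ≤ x + x ^ 2 ≤ (51 / 50) x` for `0 ≤ x ≤ 1 / 50`, and `1 + y ≤ exp y`. The losses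
`51 / 50` here and `49 / 50` in the next lemma are small enough to be absorbed by the ratio `16 /
17` of balls to room. -/
theorem one_add_mul_exp_sub_one_le {m α x : ℝ} (hm : m ≤ α) (hx : 0 ≤ x) (hx' : x ≤ 1 / 50) (hm0 : 0 ≤ m) :
    1 + m * (Real.exp x - 1) ≤ Real.exp (α * x * (51 / 50)) := by
  have h1 : |x| ≤ 1 := by rw [abs_of_nonneg hx]; linarith
  have h2 := (abs_le.1 (Real.abs_exp_sub_one_sub_id_le h1)).2
  have h3 : m * (Real.exp x - 1) ≤ α * x * (51 / 50) := by
    have : Real.exp x - 1 ≤ x * (51 / 50) := by nlinarith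
    calc m * (Real.exp x - 1) ≤ m * (x * (51 / 50)) := mul_le_mul_of_nonneg_left this hm0
      _ ≤ α * (x * (51 / 50)) := mul_le_mul_of_nonneg_right hm (by positivity)
      _ = _ := by ring
  linarith [Real.add_one_le_exp (α * x * (51 / 50))]

theorem one_add_mul_exp_neg_sub_one_le {m β x : ℝ} (hm : β ≤ m) (hβ : 0 ≤ β) (hx : 0 ≤ x)
    (hx' : x ≤ 1 / 50) :
    1 + m * (Real.exp (-x) - 1) ≤ Real.exp (-(β * x * (49 / 50))) := by
  have h1 : |-x| ≤ 1 := by rw [abs_neg, abs_of_nonneg hx]; linarith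
  have h2 := (abs_le.1 (Real.abs_exp_sub_one_sub_id_le h1)).2
  have h3 : β * x * (49 / 50) ≤ m * (1 - Real.exp (-x)) := by
    have : x * (49 / 50) ≤ 1 - Real.exp (-x) := by nlinarith
    calc β * x * (49 / 50) = β * (x * (49 / 50)) := by ring
      _ ≤ m * (x * (49 / 50)) := mul_le_mul_of_nonneg_right hm (by positivity)
      _ ≤ _ := mul_le_mul_of_nonneg_left this (hβ.trans hm)
  linarith [Real.add_one_le_exp (-(β * x * (49 / 50)))]

/-- The exponential weight of a ball that is at most `(m.1 + 1) η` after or `(m.2 + 1) η`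
before `p`. -/
noncomputable def ballWeight (p η x : ℝ) (m : ℕ × ℕ) (t : ℝ) : ℝ≥0∞ :=
  if Int.fract (t - p) ∈ arc ((m.1 + 1) * η) ((m.2 + 1) * η) then ENNReal.ofReal (Real.exp x) else 1

/-- The exponential weight of a bin that is at most `m.1 η` after or `m.2 η` before `p`. -/
noncomputable def binWeight (p η x : ℝ) (m : ℕ × ℕ) (t : ℝ) : ℝ≥0∞ :=
  if Int.fract (t - p) ∈ arc (m.1 * η) (m.2 * η) then ENNReal.ofReal (Real.exp (-x)) else 1

/-- The indicator of the bins between `m.1 η` and `(m.1 + 1) η` after `p`. -/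
noncomputable def endWeight (p η : ℝ) (m : ℕ × ℕ) (t : ℝ) : ℝ≥0∞ :=
  if m.1 * η ≤ Int.fract (t - p) ∧ Int.fract (t - p) < (m.1 + 1) * η then 1 else 0

theorem measurable_fract_sub (p : ℝ) : Measurable fun t : ℝ => Int.fract (t - p) :=
  measurable_fract.comp (measurable_id.sub_const p)

theorem measurable_ballWeight (p η x : ℝ) (m : ℕ × ℕ) : Measurable (ballWeight p η x m) :=
  Measurable.ite (measurable_fract_sub p (measurableSet_arc _ _)) measurable_const measurable_const

theorem measurable_binWeight (p η x : ℝ) (m : ℕ × ℕ) : Measurable (binWeight p η x m) :=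
  Measurable.ite (measurable_fract_sub p (measurableSet_arc _ _)) measurable_const measurable_const

theorem measurable_endWeight (p η : ℝ) (m : ℕ × ℕ) : Measurable (endWeight p η m) :=
  Measurable.ite (measurable_fract_sub p measurableSet_Ico) measurable_const measurable_const

theorem lintegral_ballWeight_le {p η x : ℝ} (hη : 0 ≤ η) (hx : 0 ≤ x) (hx' : x ≤ 1 / 50)
    (m : ℕ × ℕ) : ∫⁻ t, ballWeight p η x m t ∂circleLaw ≤
      ENNReal.ofReal (Real.exp ((m.1 + m.2 + 2) * η * x * (51 / 50))) := by
  unfold ballWeight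
  rw [lintegral_fract_arc (Real.exp_pos _).le]
  refine ENNReal.ofReal_le_ofReal (one_add_mul_exp_sub_one_le ?_ hx hx' ENNReal.toReal_nonneg)
  refine (circleLaw_arc_le (by positivity) (by positivity)).trans_eq ?_
  ring

theorem lintegral_binWeight_le {p η x : ℝ} (hη : 0 ≤ η) (hx : 0 ≤ x) (hx' : x ≤ 1 / 50)
    {m : ℕ × ℕ} (hm : (m.1 + m.2) * η ≤ 1) : ∫⁻ t, binWeight p η x m t ∂circleLaw ≤
      ENNReal.ofReal (Real.exp (-((m.1 + m.2) * η * x * (49 / 50)))) := by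
  unfold binWeight
  rw [lintegral_fract_arc (Real.exp_pos _).le]
  refine ENNReal.ofReal_le_ofReal (one_add_mul_exp_neg_sub_one_le ?_ (by positivity) hx hx')
  rw [add_mul] at hm ⊢
  exact le_circleLaw_arc (by positivity) (by positivity) hm

theorem lintegral_endWeight_le (p η : ℝ) (m : ℕ × ℕ) :
    ∫⁻ t, endWeight p η m t ∂circleLaw ≤ ENNReal.ofReal η := by
  refine (circleLaw_Ico_le p).trans_eq ?_
  congr 1
  ring

/-- The exponential bound for the event that `b` is in a run through the arc given by `m`. -/
noncomputable def runWeight (B : Finset Ball) (T : Finset Bin) (r : Bin → ℕ) (C : ℕ) (p η : ℝ)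
    (b : Bin) (m : ℕ × ℕ) (ω : (Ball → ℝ) × (Bin → ℝ)) : ℝ≥0∞ :=
  (∏ y ∈ B, ballWeight p η (1 / 50 / C) m (ω.1 y)) *
    ∏ c ∈ T, (if c = b then endWeight p η m else binWeight p η (1 / 50 * r c / C) m) (ω.2 c)

theorem measurable_runWeight (B : Finset Ball) (T : Finset Bin) (r : Bin → ℕ) (C : ℕ) (p η : ℝ)
    (b : Bin) (m : ℕ × ℕ) : Measurable (runWeight B T r C p η b m) := by
  unfold runWeight
  refine Measurable.mul ?_ ?_
  · exact Finset.measurable_prod _ fun y _ =>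
      (measurable_ballWeight _ _ _ _).comp ((measurable_pi_apply y).comp measurable_fst)
  · refine Finset.measurable_prod _ fun c _ => ?_
    have h2 : Measurable fun ω : (Ball → ℝ) × (Bin → ℝ) => ω.2 c :=
      (measurable_pi_apply c).comp measurable_snd
    split_ifs
    · exact (measurable_endWeight _ _ _).comp h2
    · exact (measurable_binWeight _ _ _ _).comp h2

/-- The arc is rounded to the grid of width `η`, outwards for the balls and inwards for the bins, so
that crowding survives. Then the exponent, a multiple of the number of balls minus the room, is
nonnegative. The bin `b` is left out of the room because its point is already used by `endWeight`.
-/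
theorem one_le_runWeight {B : Finset Ball} {T : Finset Bin} {r : Bin → ℕ} {C : ℕ} {p η : ℝ}
    (hη : 0 < η) {b : Bin} (hb : b ∈ T) {ω : (Ball → ℝ) × (Bin → ℝ)} {u : ℝ} (hu0 : 0 ≤ u)
    (hu : u ≤ 1 - Int.fract (ω.2 b - p))
    (hsum : ∀ T' ⊆ T, (∀ c ∈ T', Int.fract (ω.2 c - p) ∈ arc (Int.fract (ω.2 b - p)) u) →
      ∑ c ∈ T', r c ≤
        (B.filter fun y => Int.fract (ω.1 y - p) ∈ arc (Int.fract (ω.2 b - p)) u).card) :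
    ∃ m : ℕ × ℕ, (m.1 + m.2) * η ≤ 1 ∧ 1 ≤ runWeight B T r C p η b m ω := by
  set ℓ := Int.fract (ω.2 b - p) with hℓ
  have hℓ0 : 0 ≤ ℓ := Int.fract_nonneg _
  have f1 : (⌊ℓ / η⌋₊ : ℝ) * η ≤ ℓ := by
    rw [← le_div_iff₀ hη]; exact Nat.floor_le (by positivity)
  have f2 : ℓ < (⌊ℓ / η⌋₊ + 1 : ℝ) * η := by
    rw [← div_lt_iff₀ hη]; exact Nat.lt_floor_add_one _
  have f3 : (⌊u / η⌋₊ : ℝ) * η ≤ u := by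
    rw [← le_div_iff₀ hη]; exact Nat.floor_le (by positivity)
  have f4 : u < (⌊u / η⌋₊ + 1 : ℝ) * η := by
    rw [← div_lt_iff₀ hη]; exact Nat.lt_floor_add_one _
  refine ⟨(⌊ℓ / η⌋₊, ⌊u / η⌋₊), by simp only; linarith, ?_⟩
  set m : ℕ × ℕ := (⌊ℓ / η⌋₊, ⌊u / η⌋₊) with hm
  set T' := (T.erase b).filter fun c => Int.fract (ω.2 c - p) ∈ arc (m.1 * η) (m.2 * η) with hT'
  have key := hsum T' ((Finset.filter_subset _ _).trans (Finset.erase_subset _ _)) fun c hc => by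
    rcases (Finset.mem_filter.1 hc).2 with h1 | h1
    · exact Or.inl (h1.trans_le f1)
    · exact Or.inr (lt_of_le_of_lt (by simp only [hm]; linarith) h1)
  have hsub : (B.filter fun y => Int.fract (ω.1 y - p) ∈ arc ℓ u).card ≤
      (B.filter fun y => Int.fract (ω.1 y - p) ∈ arc ((m.1 + 1) * η) ((m.2 + 1) * η)).card := by
    refine Finset.card_le_card fun y hy => ?_
    rw [Finset.mem_filter] at hy ⊢
    refine ⟨hy.1, ?_⟩
    rcases hy.2 with h1 | h1
    · exact Or.inl (h1.trans f2)
    · exact Or.inr (lt_of_le_of_lt (by simp only [hm]; linarith) h1)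
  have e1 : ∏ y ∈ B, ballWeight p η (1 / 50 / C) m (ω.1 y) = ENNReal.ofReal (Real.exp
      ((1 / 50 / C) * (B.filter fun y =>
        Int.fract (ω.1 y - p) ∈ arc ((m.1 + 1) * η) ((m.2 + 1) * η)).card)) := by
    unfold ballWeight
    rw [Finset.prod_ite, Finset.prod_const, Finset.prod_const_one, mul_one,
      ← ENNReal.ofReal_pow (Real.exp_pos _).le, ← Real.exp_nat_mul, mul_comm]
  have e2 : ∏ c ∈ T, (if c = b then endWeight p η m else binWeight p η (1 / 50 * r c / C) m)
      (ω.2 c) = ENNReal.ofReal (Real.exp (-((1 / 50 / C) * ∑ c ∈ T', (r c : ℝ)))) := by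
    rw [← Finset.mul_prod_erase _ _ hb, if_pos rfl, endWeight, if_pos ⟨f1, f2⟩, one_mul]
    have : ∀ c ∈ T.erase b, (if c = b then endWeight p η m else
        binWeight p η (1 / 50 * r c / C) m) (ω.2 c) =
        if Int.fract (ω.2 c - p) ∈ arc (m.1 * η) (m.2 * η) then
          ENNReal.ofReal (Real.exp (-(1 / 50 * r c / C))) else 1 := fun c hc => by
      rw [if_neg (Finset.ne_of_mem_erase hc)]
      rfl
    rw [Finset.prod_congr rfl this, Finset.prod_ite, Finset.prod_const_one, mul_one,
      ← ENNReal.ofReal_prod_of_nonneg fun _ _ => (Real.exp_pos _).le, ← Real.exp_sum]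
    congr 2
    rw [Finset.mul_sum, ← Finset.sum_neg_distrib]
    refine Finset.sum_congr rfl fun c _ => ?_
    ring
  rw [runWeight, e1, e2, ← ENNReal.ofReal_mul (Real.exp_pos _).le, ← Real.exp_add,
    ← ENNReal.ofReal_one]
  refine ENNReal.ofReal_le_ofReal (Real.one_le_exp ?_)
  have hle : (∑ c ∈ T', (r c : ℝ)) ≤ ((B.filter fun y =>
      Int.fract (ω.1 y - p) ∈ arc ((m.1 + 1) * η) ((m.2 + 1) * η)).card : ℝ) := by
    exact_mod_cast key.trans hsub
  have : (0 : ℝ) ≤ 1 / 50 / C := by positivity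
  nlinarith [mul_le_mul_of_nonneg_left hle this]

theorem exp_geometric_le (j : ℕ) :
    Real.exp (1 / 50 * (4 - j / 50)) ≤ 2 * (2500 / 2501 : ℝ) ^ j := by
  have h1 : Real.exp (4 / 50 : ℝ) ≤ 2 := by
    have := Real.abs_exp_sub_one_sub_id_le (x := 4 / 50) (by rw [abs_of_nonneg] <;> norm_num)
    have := (abs_le.1 this).2
    norm_num at this ⊢
    linarith
  have h2 : Real.exp (-(1 / 2500) : ℝ) ≤ 2500 / 2501 := by
    rw [Real.exp_neg, inv_le_comm₀ (Real.exp_pos _) (by norm_num)]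
    have := Real.add_one_le_exp (1 / 2500 : ℝ)
    norm_num at this ⊢
    linarith
  calc Real.exp (1 / 50 * (4 - j / 50)) = Real.exp (4 / 50) * Real.exp (-(1 / 2500)) ^ j := by
        rw [← Real.exp_nat_mul, ← Real.exp_add]
        congr 1
        ring
    _ ≤ 2 * (2500 / 2501) ^ j :=
        mul_le_mul h1 (pow_le_pow_left₀ (Real.exp_pos _).le h2 j) (by positivity) (by norm_num)

/-- The grid width `C / F` is the length of an arc of expected room `C`. By independence the
expectation factors. With `w = m.1 + m.2`, balls and bins contribute at most `(24 / 25) (w + 2)` and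
`2 - (49 / 50) w` to fifty times the exponent, whose sum is below `4 - w / 50`; the factor `C / F`
is the probability that `b` is in its grid cell. -/
theorem lintegral_runWeight_le {B : Finset Ball} {T : Finset Bin} {r : Bin → ℕ} {C : ℕ}
    (hC : 0 < C) (hr : ∀ c ∈ T, r c ≤ C) {F : ℝ} (hF : 0 < F) (hTF : F - C ≤ ∑ c ∈ T, (r c : ℝ))
    (hB : 17 * (B.card : ℝ) ≤ 16 * F) (p : ℝ) {b : Bin} (hb : b ∈ T) {m : ℕ × ℕ}
    (hm : (m.1 + m.2) * (C / F) ≤ 1) :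
    ∫⁻ ω, runWeight B T r C p (C / F) b m ω
        ∂((Measure.pi fun _ : Ball => circleLaw).prod (Measure.pi fun _ : Bin => circleLaw)) ≤
      ENNReal.ofReal (C / F * 2 * (2500 / 2501) ^ (m.1 + m.2)) := by
  have hC' : (1 : ℝ) ≤ C := by exact_mod_cast hC
  have hC0 : (0 : ℝ) < C := by linarith
  set η : ℝ := C / F with hη
  have hη0 : 0 < η := by positivity
  have hηF : η * F = C := by rw [hη]; field_simp
  have hx : (1 / 50 / C : ℝ) ≤ 1 / 50 := by
    rw [div_le_iff₀ hC0]
    linarith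
  have hxc : ∀ c ∈ T, (1 / 50 * r c / C : ℝ) ≤ 1 / 50 := fun c hc => by
    have : (r c : ℝ) ≤ C := by exact_mod_cast hr c hc
    rw [div_le_iff₀ hC0]
    linarith
  unfold runWeight
  rw [lintegral_prod_mul
      (f := fun P : Ball → ℝ => ∏ y ∈ B, ballWeight p η (1 / 50 / C) m (P y))
      (g := fun Q : Bin → ℝ => ∏ c ∈ T, (if c = b then endWeight p η m else
        binWeight p η (1 / 50 * r c / C) m) (Q c))
      (Finset.measurable_prod _ fun y _ =>
        (measurable_ballWeight _ _ _ _).comp (measurable_pi_apply y)).aemeasurable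
      (Finset.measurable_prod _ fun c _ => by
        split_ifs
        · exact (measurable_endWeight _ _ _).comp (measurable_pi_apply c)
        · exact (measurable_binWeight _ _ _ _).comp (measurable_pi_apply c)).aemeasurable,
    lintegral_pi_prod circleLaw (f := fun _ : Ball => ballWeight p η (1 / 50 / C) m)
      (fun _ => measurable_ballWeight _ _ _ _),
    lintegral_pi_prod circleLaw (f := fun c : Bin => if c = b then endWeight p η m else
        binWeight p η (1 / 50 * r c / C) m)
      (fun c => by
        split_ifs
        · exact measurable_endWeight _ _ _
        · exact measurable_binWeight _ _ _ _),
    ← Finset.mul_prod_erase _ _ hb, if_pos rfl]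
  have b1 : ∏ _y ∈ B, ∫⁻ t, ballWeight p η (1 / 50 / C) m t ∂circleLaw ≤ ENNReal.ofReal
      (Real.exp (B.card * ((m.1 + m.2 + 2) * η * (1 / 50 / C) * (51 / 50)))) := by
    rw [Finset.prod_const, Real.exp_nat_mul, ENNReal.ofReal_pow (Real.exp_pos _).le]
    exact pow_le_pow_left' (lintegral_ballWeight_le hη0.le (by positivity) hx m) _
  have b2 : ∏ c ∈ T.erase b, ∫⁻ t, (if c = b then endWeight p η m else
      binWeight p η (1 / 50 * r c / C) m) t ∂circleLaw ≤ ENNReal.ofReal (Real.exp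
        (∑ c ∈ T.erase b, -((m.1 + m.2) * η * (1 / 50 * r c / C) * (49 / 50)))) := by
    rw [Real.exp_sum, ENNReal.ofReal_prod_of_nonneg fun _ _ => (Real.exp_pos _).le]
    refine Finset.prod_le_prod' fun c hc => ?_
    rw [if_neg (Finset.ne_of_mem_erase hc)]
    exact lintegral_binWeight_le hη0.le (by positivity) (hxc c (Finset.mem_of_mem_erase hc)) hm
  refine (mul_le_mul' b1 (mul_le_mul' (lintegral_endWeight_le p η m) b2)).trans ?_
  rw [← ENNReal.ofReal_mul hη0.le, ← ENNReal.ofReal_mul (Real.exp_pos _).le]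
  refine ENNReal.ofReal_le_ofReal ?_
  rw [mul_left_comm, ← Real.exp_add, mul_assoc η 2]
  refine mul_le_mul_of_nonneg_left ?_ hη0.le
  refine (Real.exp_le_exp.2 ?_).trans (exp_geometric_le (m.1 + m.2))
  -- One `C` is lost by the hypothesis `hTF`, a second one by leaving out `b`.
  have hsum : F - 2 * C ≤ ∑ c ∈ T.erase b, (r c : ℝ) := by
    have h1 := Finset.add_sum_erase T (fun c => (r c : ℝ)) hb
    have h2 : (r b : ℝ) ≤ C := by exact_mod_cast hr b hb
    linarith
  have e3 : ∑ c ∈ T.erase b, -((m.1 + m.2) * η * (1 / 50 * r c / C) * (49 / 50)) =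
      -((m.1 + m.2) * η * (49 / 2500) / C * ∑ c ∈ T.erase b, (r c : ℝ)) := by
    rw [Finset.mul_sum, ← Finset.sum_neg_distrib]
    exact Finset.sum_congr rfl fun c _ => by ring
  rw [e3]
  set w : ℝ := (m.1 : ℝ) + m.2 with hw
  have hw0 : 0 ≤ w := by positivity
  -- The constant is `16 / 17 * (51 / 50) = 24 / 25`.
  have i1 : (B.card : ℝ) * ((w + 2) * η * (1 / 50 / C) * (51 / 50)) ≤
      1 / 50 * (24 / 25) * (w + 2) := by
    have : (B.card : ℝ) * η ≤ 16 / 17 * C := by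
      rw [← hηF]
      nlinarith
    calc (B.card : ℝ) * ((w + 2) * η * (1 / 50 / C) * (51 / 50))
        = (B.card : ℝ) * η * ((w + 2) * (1 / 50) * (51 / 50) / C) := by ring
      _ ≤ 16 / 17 * C * ((w + 2) * (1 / 50) * (51 / 50) / C) :=
          mul_le_mul_of_nonneg_right this (by positivity)
      _ = 1 / 50 * (24 / 25) * (w + 2) := by field_simp; ring
  have i2 : w * (49 / 2500) - 1 / 50 * 2 ≤
      w * η * (49 / 2500) / C * ∑ c ∈ T.erase b, (r c : ℝ) := by
    -- The missing room `2 C` costs only a constant, because `w * η ≤ 1` by `hm`.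
    calc w * (49 / 2500) - 1 / 50 * 2 ≤ w * (49 / 2500) - w * η * (49 / 1250) := by
          nlinarith
      _ = w * η * (49 / 2500) / C * (F - 2 * C) := by
          field_simp
          rw [mul_sub, ← hηF]
          ring
      _ ≤ _ := mul_le_mul_of_nonneg_left hsum (by positivity)
  push_cast
  rw [← hw]
  linarith

theorem tsum_geometric_pair :
    ∑' m : ℕ × ℕ, ENNReal.ofReal ((2500 / 2501 : ℝ) ^ (m.1 + m.2)) = ENNReal.ofReal (2501 ^ 2) := by
  have hg : ∑' j : ℕ, ENNReal.ofReal (2500 / 2501 : ℝ) ^ j = ENNReal.ofReal 2501 := by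
    rw [ENNReal.tsum_geometric, ← ENNReal.ofReal_one, ← ENNReal.ofReal_sub _ (by norm_num),
      ← ENNReal.ofReal_inv_of_pos (by norm_num)]
    norm_num
  have : ∀ m : ℕ × ℕ, ENNReal.ofReal ((2500 / 2501 : ℝ) ^ (m.1 + m.2)) =
      ENNReal.ofReal (2500 / 2501 : ℝ) ^ m.1 * ENNReal.ofReal (2500 / 2501 : ℝ) ^ m.2 := fun m => by
    rw [ENNReal.ofReal_pow (by norm_num), pow_add]
  simp_rw [this]
  rw [ENNReal.tsum_prod (f := fun a b : ℕ => ENNReal.ofReal (2500 / 2501 : ℝ) ^ a *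
    ENNReal.ofReal (2500 / 2501 : ℝ) ^ b)]
  simp_rw [ENNReal.tsum_mul_left, ENNReal.tsum_mul_right, hg]
  rw [← ENNReal.ofReal_mul (by norm_num), sq]

/-- The expected length of a run, if the balls use at most a fraction `16 / 17` of the room. -/
theorem lintegral_card_run_le {B : Finset Ball} {T X : Finset Bin} {r : Bin → ℕ} {C : ℕ}
    (hC : 0 < C) (hr : ∀ c ∈ T, r c ≤ C) (hX : X.card ≤ 1) (p : ℝ)
    (hF : 0 < ∑ c ∈ T, r c) (hB : 17 * B.card ≤ 16 * ∑ c ∈ T, r c)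
    {R : (Ball → ℝ) × (Bin → ℝ) → Finset Bin} (hRT : ∀ ω, R ω ⊆ T)
    (hR : ∀ ω, ∀ b ∈ R ω, b ∉ X → ∃ u, 0 ≤ u ∧ u ≤ 1 - Int.fract (ω.2 b - p) ∧
      ∀ T' ⊆ T \ X, (∀ c ∈ T', Int.fract (ω.2 c - p) ∈ arc (Int.fract (ω.2 b - p)) u) →
        ∑ c ∈ T', r c ≤
          (B.filter fun y => Int.fract (ω.1 y - p) ∈ arc (Int.fract (ω.2 b - p)) u).card) :
    ∫⁻ ω, ((R ω).card : ℝ≥0∞)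
        ∂((Measure.pi fun _ : Ball => circleLaw).prod (Measure.pi fun _ : Bin => circleLaw)) ≤
      ENNReal.ofReal (1 + 2 * 2501 ^ 2 * T.card * C / ∑ c ∈ T, (r c : ℝ)) := by
  classical
  set F : ℝ := ∑ c ∈ T, (r c : ℝ) with hFdef
  have hF0 : 0 < F := by
    rw [hFdef]
    exact_mod_cast hF
  have hC0 : (0 : ℝ) < C := by exact_mod_cast hC
  have hη0 : 0 < (C : ℝ) / F := by positivity
  have hXsum : F - C ≤ ∑ c ∈ T \ X, (r c : ℝ) := by
    have h1 := Finset.sum_inter_add_sum_sdiff T X (fun c => (r c : ℝ))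
    have h2 : ∑ c ∈ T ∩ X, (r c : ℝ) ≤ (T ∩ X).card • (C : ℝ) :=
      Finset.sum_le_card_nsmul _ _ _ fun c hc => by
        exact_mod_cast hr c (Finset.mem_of_mem_inter_left hc)
    have h3 : ((T ∩ X).card : ℝ) ≤ 1 := by
      exact_mod_cast (Finset.card_le_card Finset.inter_subset_right).trans hX
    rw [nsmul_eq_mul] at h2
    nlinarith
  -- Grid arcs longer than the circle are discarded: the lower bound for the measure of an arc fails
  -- for them.
  set W : Bin → ℕ × ℕ → (Ball → ℝ) × (Bin → ℝ) → ℝ≥0∞ := fun b m ω =>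
    if ((m.1 : ℝ) + m.2) * (C / F) ≤ 1 then runWeight B (T \ X) r C p (C / F) b m ω else 0 with hW
  have hWm : ∀ b m, Measurable (W b m) := fun b m => by
    rw [hW]
    by_cases hm : ((m.1 : ℝ) + m.2) * (C / F) ≤ 1
    · simpa only [hm, if_true] using measurable_runWeight _ _ _ _ _ _ _ _
    · simpa only [hm, if_false] using measurable_const
  -- The exceptional bin of `X` accounts for the summand `1`; all other bins of the run are counted
  -- by some `W`.
  have hpt : ∀ ω, ((R ω).card : ℝ≥0∞) ≤ 1 + ∑ b ∈ T \ X, ∑' m, W b m ω := by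
    intro ω
    have h1 : (R ω).card ≤ 1 + (R ω \ X).card := by
      have := Finset.card_sdiff_add_card_inter (R ω) X
      have := (Finset.card_le_card (Finset.inter_subset_right (s₁ := R ω) (s₂ := X))).trans hX
      omega
    refine (Nat.cast_le.2 h1).trans ?_
    push_cast
    refine add_le_add le_rfl ?_
    rw [Finset.card_eq_sum_ones, Nat.cast_sum]
    refine le_trans (Finset.sum_le_sum fun b hb => ?_)
      (Finset.sum_le_sum_of_subset (Finset.sdiff_subset_sdiff (hRT ω) le_rfl))
    obtain ⟨hbR, hbX⟩ := Finset.mem_sdiff.1 hb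
    obtain ⟨u, hu0, hu, hsum⟩ := hR ω b hbR hbX
    obtain ⟨m, hm, hle⟩ := one_le_runWeight (C := C) hη0
      (Finset.mem_sdiff.2 ⟨hRT ω hbR, hbX⟩) hu0 hu hsum
    refine le_trans ?_ (ENNReal.le_tsum m)
    rw [hW]
    simp only [hm, if_true]
    exact_mod_cast hle
  refine (lintegral_mono hpt).trans ?_
  rw [lintegral_add_left measurable_const, lintegral_const, measure_univ, mul_one,
    lintegral_finsetSum _ fun b _ => Measurable.tsum fun m => hWm b m]
  have hterm : ∀ b ∈ T \ X, ∫⁻ ω, ∑' m, W b m ω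
      ∂((Measure.pi fun _ : Ball => circleLaw).prod (Measure.pi fun _ : Bin => circleLaw)) ≤
      ENNReal.ofReal (C / F * 2 * 2501 ^ 2) := by
    intro b hb
    rw [lintegral_tsum fun m => (hWm b m).aemeasurable]
    calc _ ≤ ∑' m : ℕ × ℕ, ENNReal.ofReal (C / F * 2) *
          ENNReal.ofReal ((2500 / 2501 : ℝ) ^ (m.1 + m.2)) := by
          refine ENNReal.tsum_le_tsum fun m => ?_
          rw [← ENNReal.ofReal_mul (by positivity)]
          by_cases hm : ((m.1 : ℝ) + m.2) * (C / F) ≤ 1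
          · simp only [hW, hm, if_true]
            exact lintegral_runWeight_le hC (fun c hc => hr c (Finset.mem_sdiff.1 hc).1) hF0 hXsum
              (by rw [hFdef]; exact_mod_cast hB) p hb hm
          · simp only [hW, hm, if_false, lintegral_zero]
            exact zero_le
      _ = _ := by
          rw [ENNReal.tsum_mul_left, tsum_geometric_pair, ← ENNReal.ofReal_mul (by positivity)]
  refine (add_le_add le_rfl (Finset.sum_le_card_nsmul _ _ _ hterm)).trans ?_
  rw [nsmul_eq_mul, ← ENNReal.ofReal_natCast, ← ENNReal.ofReal_mul (by positivity),
    ← ENNReal.ofReal_one, ← ENNReal.ofReal_add (by norm_num) (by positivity)]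
  refine ENNReal.ofReal_le_ofReal (add_le_add le_rfl ?_)
  have : ((T \ X).card : ℝ) ≤ T.card := by exact_mod_cast Finset.card_le_card Finset.sdiff_subset
  calc ((T \ X).card : ℝ) * (C / F * 2 * 2501 ^ 2) ≤ T.card * (C / F * 2 * 2501 ^ 2) :=
        mul_le_mul_of_nonneg_right this (by positivity)
    _ = _ := by ring

end Chernoff

end BoundedLoads

/-! ### The law of the levels, and resampling the circle of one level -/

namespace BoundedLoads

section Level

theorem lintegral_levelLaw {k : ℕ} (f : Fin k → ℝ≥0∞) :
    ∫⁻ i, f i ∂(levelLaw k) = ∑ i, levelProb k i * f i := by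
  rw [levelLaw, lintegral_sum_measure, tsum_fintype]
  simp

/-- Induction downwards from the last level, whose probability `2⁻¹ ^ (k - 1)` is the whole tail
there. -/
theorem sum_levelProb_ge {k : ℕ} (d : ℕ) : ∀ j : ℕ, j + d + 1 = k →
    ∑ i ∈ Finset.univ.filter (fun i : Fin k => j ≤ (i : ℕ)), levelProb k i = 2⁻¹ ^ j := by
  induction d with
  | zero =>
    intro j hj
    have : (Finset.univ.filter fun i : Fin k => j ≤ (i : ℕ)) = {⟨j, by omega⟩} := by
      ext i
      simp only [Finset.mem_filter, Finset.mem_univ, true_and, Finset.mem_singleton, Fin.ext_iff]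
      omega
    rw [this, Finset.sum_singleton, levelProb, if_neg (by simp only; omega)]
    congr 1
    omega
  | succ d ih =>
    intro j hj
    have : (Finset.univ.filter fun i : Fin k => j ≤ (i : ℕ)) =
        insert ⟨j, by omega⟩ (Finset.univ.filter fun i : Fin k => j + 1 ≤ (i : ℕ)) := by
      ext i
      simp only [Finset.mem_filter, Finset.mem_univ, true_and, Finset.mem_insert, Fin.ext_iff]
      omega
    rw [this, Finset.sum_insert (by simp), ih (j + 1) (by omega), levelProb,
      if_pos (by simp only; omega)]
    simp only
    rw [pow_succ, ← mul_add, ENNReal.inv_two_add_inv_two, mul_one]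

theorem sum_levelProb {k : ℕ} [NeZero k] : ∑ i, levelProb k i = 1 := by
  have hk := Nat.pos_of_ne_zero (NeZero.ne k)
  have := sum_levelProb_ge (k := k) (k - 1) 0 (by omega)
  simpa using this

instance {k : ℕ} [NeZero k] : IsProbabilityMeasure (levelLaw k) := by
  refine ⟨?_⟩
  rw [← lintegral_one, lintegral_levelLaw]
  simpa using sum_levelProb

end Level

section Resample

variable {k : ℕ} {Ball Bin : Type*}

/-- The hash values `h` with new points, given by `ω`, on the circle of level `i`. -/
noncomputable def resample (i : Fin k) (h : Hashes k Ball Bin) (ω : (Ball → ℝ) × (Bin → ℝ)) :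
    Hashes k Ball Bin :=
  (fun y => ((h.1 y).1, if (h.1 y).1 = i then ω.1 y else (h.1 y).2),
    fun b => Function.update (h.2 b) i (ω.2 b))

/-- The law of the points of all balls and bins on one circle. -/
noncomputable def pointLaw (Ball Bin : Type*) [Fintype Ball] [Fintype Bin] :
    Measure ((Ball → ℝ) × (Bin → ℝ)) :=
  (Measure.pi fun _ : Ball => circleLaw).prod (Measure.pi fun _ : Bin => circleLaw)

instance [Fintype Ball] [Fintype Bin] : IsProbabilityMeasure (pointLaw Ball Bin) := by
  unfold pointLaw
  infer_instance

instance [NeZero k] [Fintype Ball] [Fintype Bin] :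
    IsProbabilityMeasure (hashLaw k Ball Bin) := by
  unfold hashLaw
  infer_instance

/-- For a fixed level the map selects one of two independent uniform points, so the law remains a
product. -/
theorem measurePreserving_resample_ball [NeZero k] (i : Fin k) :
    MeasurePreserving (fun z : (Fin k × ℝ) × ℝ => (z.1.1, if z.1.1 = i then z.2 else z.1.2))
      (((levelLaw k).prod circleLaw).prod circleLaw) ((levelLaw k).prod circleLaw) := by
  have hm : Measurable (Function.uncurry fun (l : Fin k) (q : ℝ × ℝ) =>
      if l = i then q.2 else q.1) :=
    Measurable.ite (measurable_fst (measurableSet_singleton i))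
      (measurable_snd.comp measurable_snd) (measurable_fst.comp measurable_snd)
  have h1 : MeasurePreserving (fun z : Fin k × ℝ × ℝ => (z.1, if z.1 = i then z.2.2 else z.2.1))
      ((levelLaw k).prod (circleLaw.prod circleLaw)) ((levelLaw k).prod circleLaw) := by
    refine (MeasurePreserving.id (levelLaw k)).skew_product
      (g := fun (l : Fin k) (q : ℝ × ℝ) => if l = i then q.2 else q.1) hm (ae_of_all _ fun l => ?_)
    split_ifs
    · exact measurePreserving_snd.map_eq
    · exact measurePreserving_fst.map_eq
  exact h1.comp (measurePreserving_prodAssoc (levelLaw k) circleLaw circleLaw)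

theorem measurePreserving_resample_hashLaw [NeZero k] [Fintype Ball] [Fintype Bin] (i : Fin k) :
    MeasurePreserving
      (fun z : Hashes k Ball Bin × ((Ball → ℝ) × (Bin → ℝ)) => resample i z.1 z.2)
      ((hashLaw k Ball Bin).prod (pointLaw Ball Bin)) (hashLaw k Ball Bin) := by
  have h1 := measurePreserving_resample (ι := Ball) ((levelLaw k).prod circleLaw) circleLaw
    fun _ => measurePreserving_resample_ball i
  have h2 := measurePreserving_resample (ι := Bin) (Measure.pi fun _ : Fin k => circleLaw) circleLaw
    fun _ => (measurePreserving_update circleLaw i).comp Measure.measurePreserving_swap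
  have h3 : MeasurePreserving
      (fun z : Hashes k Ball Bin × ((Ball → ℝ) × (Bin → ℝ)) => ((z.1.1, z.2.1), (z.1.2, z.2.2)))
      ((hashLaw k Ball Bin).prod (pointLaw Ball Bin))
      (((Measure.pi fun _ : Ball => (levelLaw k).prod circleLaw).prod
          (Measure.pi fun _ : Ball => circleLaw)).prod
        ((Measure.pi fun _ : Bin => Measure.pi fun _ : Fin k => circleLaw).prod
          (Measure.pi fun _ : Bin => circleLaw))) := by
    have a1 := measurePreserving_prodAssoc (Measure.pi fun _ : Ball => (levelLaw k).prod circleLaw)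
      (Measure.pi fun _ : Bin => Measure.pi fun _ : Fin k => circleLaw) (pointLaw Ball Bin)
    have a2 := (measurePreserving_prodAssoc
      (Measure.pi fun _ : Bin => Measure.pi fun _ : Fin k => circleLaw)
      (Measure.pi fun _ : Ball => circleLaw) (Measure.pi fun _ : Bin => circleLaw)).symm
    have a3 := (Measure.measurePreserving_swap
      (μ := Measure.pi fun _ : Bin => Measure.pi fun _ : Fin k => circleLaw)
      (ν := Measure.pi fun _ : Ball => circleLaw)).prod
        (MeasurePreserving.id (Measure.pi fun _ : Bin => circleLaw))
    have a4 := measurePreserving_prodAssoc (Measure.pi fun _ : Ball => circleLaw)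
      (Measure.pi fun _ : Bin => Measure.pi fun _ : Fin k => circleLaw)
      (Measure.pi fun _ : Bin => circleLaw)
    have a5 := (MeasurePreserving.id (Measure.pi fun _ : Ball => (levelLaw k).prod circleLaw)).prod
      ((a4.comp a3).comp a2)
    have a6 := (measurePreserving_prodAssoc
      (Measure.pi fun _ : Ball => (levelLaw k).prod circleLaw)
      (Measure.pi fun _ : Ball => circleLaw)
      ((Measure.pi fun _ : Bin => Measure.pi fun _ : Fin k => circleLaw).prod
          (Measure.pi fun _ : Bin => circleLaw))).symm
    exact (a6.comp a5).comp a1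
  exact (h1.prod h2).comp h3

/-- Resampling one level (for an arbitrary function, not necessarily measurable). -/
theorem lintegral_hashLaw_le [NeZero k] [Fintype Ball] [Fintype Bin] (i : Fin k)
    (f : Hashes k Ball Bin → ℝ≥0∞) :
    ∫⁻ h, f h ∂(hashLaw k Ball Bin) ≤
      ∫⁻ h, ∫⁻ ω, f (resample i h ω) ∂(pointLaw Ball Bin) ∂(hashLaw k Ball Bin) :=
  (lintegral_le_of_measurePreserving (measurePreserving_resample_hashLaw i) f).trans
    (lintegral_prod_le _)

/-- Conditioning on the point of one ball. -/
theorem lintegral_pointLaw_ball_le [Fintype Ball] [Fintype Bin] [DecidableEq Ball] (x : Ball)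
    (f : (Ball → ℝ) × (Bin → ℝ) → ℝ≥0∞) :
    ∫⁻ ω, f ω ∂(pointLaw Ball Bin) ≤
      ∫⁻ t, ∫⁻ ω, f (Function.update ω.1 x t, ω.2) ∂(pointLaw Ball Bin) ∂circleLaw := by
  have h1 := ((measurePreserving_update circleLaw x).prod
    (MeasurePreserving.id (Measure.pi fun _ : Bin => circleLaw))).comp
    (measurePreserving_prodAssoc circleLaw (Measure.pi fun _ : Ball => circleLaw)
      (Measure.pi fun _ : Bin => circleLaw)).symm
  exact (lintegral_le_of_measurePreserving h1 f).trans (lintegral_prod_le _)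

/-- Conditioning on the point of one bin. -/
theorem lintegral_pointLaw_bin_le [Fintype Ball] [Fintype Bin] [DecidableEq Bin] (b : Bin)
    (f : (Ball → ℝ) × (Bin → ℝ) → ℝ≥0∞) :
    ∫⁻ ω, f ω ∂(pointLaw Ball Bin) ≤
      ∫⁻ t, ∫⁻ ω, f (ω.1, Function.update ω.2 b t) ∂(pointLaw Ball Bin) ∂circleLaw := by
  have h1 := ((MeasurePreserving.id (Measure.pi fun _ : Ball => circleLaw)).prod
    ((measurePreserving_update circleLaw b).comp Measure.measurePreserving_swap)).comp
    ((measurePreserving_prodAssoc (Measure.pi fun _ : Ball => circleLaw)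
      (Measure.pi fun _ : Bin => circleLaw) circleLaw).comp
      (Measure.measurePreserving_swap (μ := circleLaw) (ν := pointLaw Ball Bin)))
  exact (lintegral_le_of_measurePreserving h1 f).trans (lintegral_prod_le _)

end Resample

section Invariance

variable {k : ℕ} {Ball Bin : Type*} [Fintype Ball] [LinearOrder Ball] [LinearOrder Bin]

theorem clockwise_resample {i j : Fin k} (hij : j ≠ i) (h : Hashes k Ball Bin)
    (ω : (Ball → ℝ) × (Bin → ℝ)) (T : Finset Bin) (p : ℝ) :
    clockwise (resample i h ω) T j p = clockwise h T j p := by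
  simp only [clockwise, resample, Function.update_of_ne hij]

theorem probes_resample {i : Fin k} {h : Hashes k Ball Bin} {y : Ball} (hy : (h.1 y).1 ≠ i)
    (ω : (Ball → ℝ) × (Bin → ℝ)) (T : Finset Bin) :
    probes (resample i h ω) T y = probes h T y := by
  have : (resample i h ω).1 y = h.1 y := by simp [resample, hy]
  rw [probes, this, clockwise_resample hy, probes]

/-- A ball only looks at the circle of its own level. The lemmas that follow draw the consequence
that loads, holes and landing bins before level `i` are constants when circle `i` is resampled. -/
theorem capImage_resample (cap : Bin → ℕ) {i : Fin k} {h : Hashes k Ball Bin} {S : Finset Ball}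
    (hS : ∀ y ∈ S, (h.1 y).1 ≠ i) (ω : (Ball → ℝ) × (Bin → ℝ)) (T : Finset Bin) :
    capImage cap (resample i h ω) S T = capImage cap h S T := by
  have hb : byPriority (resample i h ω) S = byPriority h S := rfl
  rw [capImage, hb, capImage]
  refine List.foldl_ext _ _ _ fun a y hy => ?_
  rw [place, probes_resample (hS y (mem_byPriority.1 hy)), place]

theorem levelLoad_resample (cap : Bin → ℕ) {i : Fin k} (h : Hashes k Ball Bin) (S : Finset Ball)
    (ω : (Ball → ℝ) × (Bin → ℝ)) (T : Finset Bin) {j : ℕ} (hj : j ≤ i) (b : Bin) :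
    levelLoad cap (resample i h ω) S T j b = levelLoad cap h S T j b := by
  rw [levelLoad, levelLoad]
  change load (capImage cap (resample i h ω) (below h S j) T) b = _
  rw [capImage_resample]
  intro y hy hyi
  have := (mem_below.1 hy).2
  rw [hyi] at this
  omega

theorem nextHole_resample (cap : Bin → ℕ) {i : Fin k} (h : Hashes k Ball Bin) (S : Finset Ball)
    (ω : (Ball → ℝ) × (Bin → ℝ)) (T : Finset Bin) {j : ℕ} (hj : j < i) (e : Bin) :
    nextHole cap (resample i h ω) S T j e = nextHole cap h S T j e := by
  have hne : (⟨j, hj.trans i.2⟩ : Fin k) ≠ i := fun he => by simp [Fin.ext_iff] at he; omega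
  have h2 : (resample i h ω).2 e ⟨j, hj.trans i.2⟩ = h.2 e ⟨j, hj.trans i.2⟩ :=
    Function.update_of_ne hne _ _
  rw [nextHole, nextHole, dif_pos (hj.trans i.2), dif_pos (hj.trans i.2), clockwise_resample hne, h2]
  simp only [levelLoad_resample cap h S ω T (Nat.succ_le_of_lt hj)]

theorem hole_resample (cap : Bin → ℕ) {i : Fin k} (h : Hashes k Ball Bin) (S : Finset Ball)
    (ω : (Ball → ℝ) × (Bin → ℝ)) (T : Finset Bin) (j₀ : ℕ) (b : Bin) {j : ℕ} (hj : j ≤ i) :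
    hole cap (resample i h ω) S T j₀ b j = hole cap h S T j₀ b j := by
  induction j with
  | zero => rfl
  | succ j ih => rw [hole, hole, ih (by omega), nextHole_resample _ _ _ _ _ hj]

theorem landing_resample (cap : Bin → ℕ) {i : Fin k} {h : Hashes k Ball Bin} (S : Finset Ball)
    (ω : (Ball → ℝ) × (Bin → ℝ)) (T : Finset Bin) {x : Ball} (hx : (h.1 x).1 < i) (d : Bin) :
    landing cap (resample i h ω) S T x d = landing cap h S T x d := by
  have hl : ((resample i h ω).1 x).1 = (h.1 x).1 := rfl
  rw [landing, landing, probes_resample hx.ne, hl]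
  simp only [levelLoad_resample cap h S ω T (Nat.succ_le_of_lt (Fin.lt_def.1 hx))]

theorem ballHole_resample (cap : Bin → ℕ) (i : Fin k) (h : Hashes k Ball Bin) (S : Finset Ball)
    (ω : (Ball → ℝ) × (Bin → ℝ)) (T : Finset Bin) (x : Ball) (d : Bin) :
    ballHole cap (resample i h ω) S T x d i = ballHole cap h S T x d i := by
  have hl : ((resample i h ω).1 x).1 = (h.1 x).1 := rfl
  rw [ballHole, ballHole, hl]
  split_ifs with hlt
  · rw [landing_resample cap S ω T hlt, hole_resample cap h S ω T _ _ le_rfl]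
  · rfl

/-- The free room in the bins of `T` before level `j`. -/
noncomputable def roomBefore (cap : Bin → ℕ) (h : Hashes k Ball Bin) (S : Finset Ball)
    (T : Finset Bin) (j : ℕ) : ℕ :=
  ∑ c ∈ T, (cap c - levelLoad cap h S T j c)

theorem run_subset (cap : Bin → ℕ) (h : Hashes k Ball Bin) (S : Finset Ball)
    (T : Finset Bin) (i : Fin k) (p : ℝ) : run cap h S T i p ⊆ T :=
  Finset.filter_subset _ _

section Runs

variable [Fintype Bin] {cap : Bin → ℕ} {C : ℕ} {S : Finset Ball} {T : Finset Bin}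

/-- After conditioning on everything but circle `i`, the free room of each bin before level `i` is a
constant. The map `g` allows a fixed point for a ball outside `S`, or for the one bin of `X`, so
that `p` may be the point of that ball or bin. -/
theorem lintegral_card_run_resample_le (hC : 0 < C) (hcap : ∀ c, cap c ≤ C)
    (hcard : S.card < ∑ b ∈ T, cap b) {i : Fin k} {h : Hashes k Ball Bin}
    (hF : 0 < roomBefore cap h S T i)
    (hB : 17 * (atLevel h S i).card ≤ 16 * roomBefore cap h S T i) (p : ℝ) {X : Finset Bin}
    (hX : X.card ≤ 1) {g : (Ball → ℝ) × (Bin → ℝ) → (Ball → ℝ) × (Bin → ℝ)}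
    (hg1 : ∀ ω, ∀ y ∈ S, (g ω).1 y = ω.1 y) (hg2 : ∀ ω, ∀ c ∉ X, (g ω).2 c = ω.2 c) :
    ∫⁻ ω, ((run cap (resample i h (g ω)) S T i p).card : ℝ≥0∞) ∂(pointLaw Ball Bin) ≤
      ENNReal.ofReal (1 + 2 * 2501 ^ 2 * T.card * C / roomBefore cap h S T i) := by
  have hd : ∀ ω, ∀ c ∉ X, cwDist (resample i h (g ω)) i p c = Int.fract (ω.2 c - p) :=
    fun ω c hc => by simp [cwDist, resample, hg2 ω c hc]
  have := lintegral_card_run_le (B := atLevel h S i) (T := T) (X := X)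
    (r := fun c => cap c - levelLoad cap h S T i c) hC
    (fun c _ => (Nat.sub_le _ _).trans (hcap c)) hX p hF hB
    (R := fun ω => run cap (resample i h (g ω)) S T i p) (fun ω => run_subset _ _ _ _ _ _)
    (fun ω b hb hbX => by
      obtain ⟨u, hu0, hu, hsum⟩ := exists_arc_of_mem_run hcard hb
      rw [hd ω b hbX] at hu hsum
      refine ⟨u, hu0, hu, fun T' hT' harc => ?_⟩
      have key := hsum T' (hT'.trans Finset.sdiff_subset) fun c hc => by
        rw [hd ω c (Finset.mem_sdiff.1 (hT' hc)).2]
        exact harc c hc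
      simp only [levelLoad_resample cap h S (g ω) T le_rfl] at key
      refine key.trans (Finset.card_le_card fun y hy => ?_)
      obtain ⟨hy1, hy2⟩ := Finset.mem_filter.1 hy
      have hy1' : y ∈ atLevel h S i := hy1
      refine Finset.mem_filter.2 ⟨hy1', ?_⟩
      have : ((resample i h (g ω)).1 y).2 = ω.1 y := by
        simp [resample, (mem_atLevel.1 hy1').2, hg1 ω y (mem_atLevel.1 hy1').1]
      rwa [this] at hy2)
  rw [roomBefore, Nat.cast_sum]
  exact this

theorem lintegral_card_run_ball_le (hC : 0 < C) (hcap : ∀ c, cap c ≤ C)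
    (hcard : S.card < ∑ b ∈ T, cap b) {i : Fin k} {h : Hashes k Ball Bin}
    (hF : 0 < roomBefore cap h S T i)
    (hB : 17 * (atLevel h S i).card ≤ 16 * roomBefore cap h S T i) {x : Ball} (hx : x ∉ S)
    (hxi : (h.1 x).1 = i) :
    ∫⁻ ω, ((run cap (resample i h ω) S T i ((resample i h ω).1 x).2).card : ℝ≥0∞)
        ∂(pointLaw Ball Bin) ≤
      ENNReal.ofReal (1 + 2 * 2501 ^ 2 * T.card * C / roomBefore cap h S T i) := by
  refine (lintegral_pointLaw_ball_le x _).trans ?_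
  refine (lintegral_mono fun t => ?_).trans_eq (by rw [lintegral_const, measure_univ, mul_one])
  have e : ∀ ω : (Ball → ℝ) × (Bin → ℝ),
      ((resample i h (Function.update ω.1 x t, ω.2)).1 x).2 = t := fun ω => by
    simp [resample, hxi]
  simp only [e]
  exact lintegral_card_run_resample_le hC hcap hcard hF hB t (X := ∅) (by simp)
    (g := fun ω => (Function.update ω.1 x t, ω.2))
    (fun ω y hy => Function.update_of_ne (by rintro rfl; exact hx hy) _ _) fun _ _ _ => rfl

theorem lintegral_card_run_bin_le (hC : 0 < C) (hcap : ∀ c, cap c ≤ C)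
    (hcard : S.card < ∑ b ∈ T, cap b) {i : Fin k} {h : Hashes k Ball Bin}
    (hF : 0 < roomBefore cap h S T i)
    (hB : 17 * (atLevel h S i).card ≤ 16 * roomBefore cap h S T i) (b : Bin) :
    ∫⁻ ω, ((run cap (resample i h ω) S T i ((resample i h ω).2 b i)).card : ℝ≥0∞)
        ∂(pointLaw Ball Bin) ≤
      ENNReal.ofReal (1 + 2 * 2501 ^ 2 * T.card * C / roomBefore cap h S T i) := by
  refine (lintegral_pointLaw_bin_le b _).trans ?_
  refine (lintegral_mono fun t => ?_).trans_eq (by rw [lintegral_const, measure_univ, mul_one])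
  have e : ∀ ω : (Ball → ℝ) × (Bin → ℝ),
      (resample i h (ω.1, Function.update ω.2 b t)).2 b i = t := fun ω => by
    simp [resample]
  simp only [e]
  exact lintegral_card_run_resample_le hC hcap hcard hF hB t (X := {b}) (by simp)
    (g := fun ω => (ω.1, Function.update ω.2 b t)) (fun _ _ _ => rfl)
    fun ω c hc => Function.update_of_ne (by simpa using hc) _ _

end Runs

end Invariance

end BoundedLoads

/-! ### How many balls the levels receive, and the expected runs under full hashing -/

namespace BoundedLoads

variable {k : ℕ} {Ball Bin : Type*} [Fintype Ball] [Fintype Bin]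

theorem lintegral_prod_levels [NeZero k] (U : Finset Ball) (f : Ball → Fin k → ℝ≥0∞) :
    ∫⁻ h, ∏ y ∈ U, f y (h.1 y).1 ∂(hashLaw k Ball Bin) =
      ∏ y ∈ U, ∑ j, levelProb k j * f y j := by
  have hm : ∀ y, Measurable fun q : Fin k × ℝ => f y q.1 := fun y =>
    (measurable_of_finite (f y)).comp measurable_fst
  have hm' : Measurable fun P : Ball → Fin k × ℝ => ∏ y ∈ U, f y (P y).1 :=
    Finset.measurable_prod _ fun y _ => (hm y).comp (measurable_pi_apply y)
  rw [hashLaw]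
  refine (measurePreserving_fst.lintegral_comp hm').trans ?_
  rw [lintegral_pi_prod _ hm]
  refine Finset.prod_congr rfl fun y _ => ?_
  rw [← lintegral_levelLaw]
  exact measurePreserving_fst.lintegral_comp (measurable_of_finite (f y))

/-- A Markov bound for an event that is determined by the levels, with a weight that is determined by
the levels of the other balls. -/
theorem lintegral_levels_le [NeZero k] {Z S : Finset Ball} (hZS : Disjoint Z S)
    (w : Ball → Fin k → ℝ≥0∞) (f : Fin k → ℝ≥0∞) {E : Hashes k Ball Bin → ℝ≥0∞} {c : ℝ≥0∞}
    (hE : ∀ h, E h ≤ c * ∏ y ∈ S, f (h.1 y).1) :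
    ∫⁻ h, (∏ y ∈ Z, w y (h.1 y).1) * E h ∂(hashLaw k Ball Bin) ≤
      (∏ y ∈ Z, ∑ j, levelProb k j * w y j) * (c * (∑ j, levelProb k j * f j) ^ S.card) := by
  classical
  set g : Ball → Fin k → ℝ≥0∞ := fun y => if y ∈ Z then w y else f with hg
  have hgZ : ∀ y ∈ Z, g y = w y := fun y hy => by simp [hg, hy]
  have hgS : ∀ y ∈ S, g y = f := fun y hy => by
    have : y ∉ Z := fun hyZ => Finset.disjoint_left.1 hZS hyZ hy
    simp [hg, this]
  have hmeas : Measurable fun h : Hashes k Ball Bin => ∏ y ∈ Z ∪ S, g y (h.1 y).1 :=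
    Finset.measurable_prod _ fun y _ => (measurable_of_finite (g y)).comp
      (measurable_fst.comp ((measurable_pi_apply y).comp measurable_fst))
  calc ∫⁻ h, (∏ y ∈ Z, w y (h.1 y).1) * E h ∂(hashLaw k Ball Bin)
      ≤ ∫⁻ h, c * ∏ y ∈ Z ∪ S, g y (h.1 y).1 ∂(hashLaw k Ball Bin) := by
        refine lintegral_mono fun h => ?_
        rw [Finset.prod_union hZS]
        refine (mul_le_mul' le_rfl (hE h)).trans_eq ?_
        rw [mul_left_comm]
        congr 2
        · exact Finset.prod_congr rfl fun y hy => by rw [hgZ y hy]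
        · exact Finset.prod_congr rfl fun y hy => by rw [hgS y hy]
    _ = _ := by
        rw [lintegral_const_mul _ hmeas, lintegral_prod_levels, Finset.prod_union hZS,
          mul_left_comm]
        have eZ : ∏ y ∈ Z, ∑ j, levelProb k j * g y j = ∏ y ∈ Z, ∑ j, levelProb k j * w y j :=
          Finset.prod_congr rfl fun y hy => by rw [hgZ y hy]
        have eS : ∏ y ∈ S, ∑ j, levelProb k j * g y j = (∑ j, levelProb k j * f j) ^ S.card :=
          (Finset.prod_congr rfl fun y hy => by rw [hgS y hy]).trans (Finset.prod_const _)
        rw [eZ, eS]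

theorem levelProb_le (i : Fin k) : levelProb k i ≤ ENNReal.ofReal ((1 / 2) ^ (i : ℕ)) := by
  have h2 : ENNReal.ofReal (1 / 2) = 2⁻¹ := by
    rw [one_div, ENNReal.ofReal_inv_of_pos two_pos]
    norm_num
  rw [ENNReal.ofReal_pow (by norm_num), h2, levelProb]
  split_ifs with hi
  · exact pow_le_pow_of_le_one (by simp) (by simp) (Nat.le_succ _)
  · exact le_of_eq (by congr 1; omega)

/-- This weak tail bound suffices: an exceptional event is multiplied by at most `4 n` bins, so with
`q = (1 / 2) ^ (i + 1)` a probability of order `1 / (n q)` costs `1 / q`, the order of the main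
term. -/
theorem exp_neg_le_div {x : ℝ} (hx : 0 < x) : Real.exp (-x) ≤ 1 / x := by
  rw [Real.exp_neg, one_div]
  exact inv_anti₀ hx (by linarith [Real.add_one_le_exp x])

open Classical in
/-- Too many balls at level `i`. -/
theorem lintegral_many_le [NeZero k] {Z S : Finset Ball} (hZS : Disjoint Z S)
    (w : Ball → Fin k → ℝ≥0∞) (i : Fin k) {n : ℕ} (hn : 0 < n) (hS : S.card ≤ n) :
    ∫⁻ h, (∏ y ∈ Z, w y (h.1 y).1) *
        (if 4 * (n * (1 / 2 : ℝ) ^ ((i : ℕ) + 1)) < (atLevel h S i).card then 1 else 0)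
        ∂(hashLaw k Ball Bin) ≤
      (∏ y ∈ Z, ∑ j, levelProb k j * w y j) *
        ENNReal.ofReal (2 / (n * (1 / 2 : ℝ) ^ ((i : ℕ) + 1))) := by
  set q : ℝ := (1 / 2 : ℝ) ^ ((i : ℕ) + 1) with hq
  have hq0 : 0 < q := by positivity
  have hn' : (0 : ℝ) < n := by exact_mod_cast hn
  have he1 : Real.exp 1 < 2.75 := Real.exp_one_lt_d9.trans (by norm_num)
  have he0 : 1 < Real.exp 1 := by
    have := Real.add_one_le_exp (1 : ℝ)
    linarith
  set f : Fin k → ℝ≥0∞ := fun j => 1 + if j = i then ENNReal.ofReal (Real.exp 1 - 1) else 0 with hf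
  -- Exponent one is enough: level `i` has probability at most `2 q`, and `2 (e - 1) < 7 / 2 < 4`.
  have hsum : ∑ j, levelProb k j * f j ≤ ENNReal.ofReal (Real.exp (7 / 2 * q)) := by
    have e1 : ∑ j, levelProb k j * f j =
        1 + levelProb k i * ENNReal.ofReal (Real.exp 1 - 1) := by
      simp only [hf, mul_add, mul_one, Finset.sum_add_distrib, sum_levelProb, mul_ite, mul_zero,
        Finset.sum_ite_eq', Finset.mem_univ, if_true]
    have e2 : ((1 / 2 : ℝ)) ^ (i : ℕ) = 2 * q := by rw [hq, pow_succ]; ring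
    rw [e1]
    refine (add_le_add le_rfl (mul_le_mul' (levelProb_le i) le_rfl)).trans ?_
    rw [e2, ← ENNReal.ofReal_mul (by positivity), ← ENNReal.ofReal_one,
      ← ENNReal.ofReal_add (by norm_num) (by nlinarith)]
    refine ENNReal.ofReal_le_ofReal (le_trans ?_ (Real.add_one_le_exp _))
    nlinarith
  refine (lintegral_levels_le hZS w f (c := ENNReal.ofReal (Real.exp (-(4 * (n * q)))))
    fun h => ?_).trans (mul_le_mul' le_rfl ?_)
  · have e3 : ∏ y ∈ S, f (h.1 y).1 = ENNReal.ofReal (Real.exp (atLevel h S i).card) := by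
      have : ∀ y ∈ S, f (h.1 y).1 = if (h.1 y).1 = i then ENNReal.ofReal (Real.exp 1) else 1 := by
        intro y _
        simp only [hf]
        split_ifs
        · rw [← ENNReal.ofReal_one, ← ENNReal.ofReal_add (by norm_num) (by linarith)]
          congr 1
          ring
        · simp
      rw [Finset.prod_congr rfl this, Finset.prod_ite, Finset.prod_const, Finset.prod_const_one,
        mul_one, ← ENNReal.ofReal_pow (Real.exp_pos _).le, ← Real.exp_nat_mul, mul_one]
      simp only [atLevel]
    rw [e3, ← ENNReal.ofReal_mul (Real.exp_pos _).le, ← Real.exp_add]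
    split_ifs with hlt
    · rw [← ENNReal.ofReal_one]
      exact ENNReal.ofReal_le_ofReal (Real.one_le_exp (by linarith))
    · exact zero_le
  · refine (mul_le_mul' le_rfl (pow_le_pow_left' hsum _)).trans ?_
    rw [← ENNReal.ofReal_pow (Real.exp_pos _).le, ← ENNReal.ofReal_mul (Real.exp_pos _).le,
      ← Real.exp_nat_mul, ← Real.exp_add]
    refine ENNReal.ofReal_le_ofReal ?_
    have hS' : (S.card : ℝ) ≤ n := by exact_mod_cast hS
    have h1 : (S.card : ℝ) * (7 / 2 * q) ≤ n * (7 / 2 * q) :=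
      mul_le_mul_of_nonneg_right hS' (by positivity)
    calc _ ≤ Real.exp (-(n * q / 2)) := Real.exp_le_exp.2 (by linarith)
      _ ≤ 1 / (n * q / 2) := exp_neg_le_div (by positivity)
      _ = 2 / (n * q) := by field_simp

/-- The balls of `S` at levels above `i`. -/
def higher (h : Hashes k Ball Bin) (S : Finset Ball) (i : Fin k) : Finset Ball :=
  S.filter fun y => i < (h.1 y).1

open Classical in
/-- Too few balls at the levels above `i`. -/
theorem lintegral_few_le [NeZero k] {Z S : Finset Ball} (hZS : Disjoint Z S)
    (w : Ball → Fin k → ℝ≥0∞) (i : Fin k) (hik : (i : ℕ) + 1 < k) {n : ℕ} (hn : 0 < n)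
    (hS : n ≤ 2 * S.card) :
    ∫⁻ h, (∏ y ∈ Z, w y (h.1 y).1) *
        (if ((higher h S i).card : ℝ) < n * (1 / 2 : ℝ) ^ ((i : ℕ) + 1) / 4 then 1 else 0)
        ∂(hashLaw k Ball Bin) ≤
      (∏ y ∈ Z, ∑ j, levelProb k j * w y j) *
        ENNReal.ofReal (16 / (n * (1 / 2 : ℝ) ^ ((i : ℕ) + 1))) := by
  set q : ℝ := (1 / 2 : ℝ) ^ ((i : ℕ) + 1) with hq
  have hq0 : 0 < q := by positivity
  have hq1 : q ≤ 1 := pow_le_one₀ (by norm_num) (by norm_num)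
  have hn' : (0 : ℝ) < n := by exact_mod_cast hn
  have he1 : Real.exp (-1) < 3 / 8 := by
    rw [Real.exp_neg, inv_lt_comm₀ (Real.exp_pos _) (by norm_num)]
    exact lt_trans (by norm_num) Real.exp_one_gt_d9
  have he0 := Real.exp_pos (-1)
  set f : Fin k → ℝ≥0∞ := fun j => if i < j then ENNReal.ofReal (Real.exp (-1)) else 1 with hf
  -- Exponent minus one: the levels above `i` have probability `q`, and `1 - 1 / e > 5 / 8`. As `S`
  -- has at least `n / 2` balls, this leaves `5 / 16` against the threshold `1 / 4`.
  have hsum : ∑ j, levelProb k j * f j ≤ ENNReal.ofReal (Real.exp (-(5 / 8 * q))) := by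
    have h2 : ENNReal.ofReal (1 / 2) = 2⁻¹ := by
      rw [one_div, ENNReal.ofReal_inv_of_pos two_pos]
      norm_num
    have e1 : ∑ j ∈ Finset.univ.filter (fun j : Fin k => i < j), levelProb k j =
        ENNReal.ofReal q := by
      rw [hq, ENNReal.ofReal_pow (by norm_num), h2,
        ← sum_levelProb_ge (k := k) (k - (i + 1) - 1) (i + 1) (by omega)]
      rfl
    have e2 := Finset.sum_filter_add_sum_filter_not Finset.univ (fun j : Fin k => i < j)
      (levelProb k)
    rw [sum_levelProb, e1] at e2
    have e3 : ∑ j ∈ Finset.univ.filter (fun j : Fin k => ¬ i < j), levelProb k j =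
        ENNReal.ofReal (1 - q) := by
      refine (ENNReal.add_right_inj (a := ENNReal.ofReal q) ENNReal.ofReal_ne_top).1 ?_
      rw [e2, ← ENNReal.ofReal_add hq0.le (by linarith)]
      simp
    rw [← Finset.sum_filter_add_sum_filter_not Finset.univ (fun j : Fin k => i < j)]
    have e4 : ∑ j ∈ Finset.univ.filter (fun j : Fin k => i < j), levelProb k j * f j =
        ENNReal.ofReal q * ENNReal.ofReal (Real.exp (-1)) := by
      rw [← e1, Finset.sum_mul]
      exact Finset.sum_congr rfl fun j hj => by simp [hf, (Finset.mem_filter.1 hj).2]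
    have e5 : ∑ j ∈ Finset.univ.filter (fun j : Fin k => ¬ i < j), levelProb k j * f j =
        ENNReal.ofReal (1 - q) := by
      rw [← e3]
      refine Finset.sum_congr rfl fun j hj => ?_
      simp only [hf, if_neg (Finset.mem_filter.1 hj).2, mul_one]
    rw [e4, e5, ← ENNReal.ofReal_mul hq0.le,
      ← ENNReal.ofReal_add (by positivity) (by linarith)]
    refine ENNReal.ofReal_le_ofReal (le_trans ?_ (Real.add_one_le_exp _))
    nlinarith
  refine (lintegral_levels_le hZS w f (c := ENNReal.ofReal (Real.exp (n * q / 4)))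
    fun h => ?_).trans (mul_le_mul' le_rfl ?_)
  · have e3 : ∏ y ∈ S, f (h.1 y).1 = ENNReal.ofReal (Real.exp (-(higher h S i).card)) := by
      simp only [hf]
      rw [Finset.prod_ite, Finset.prod_const, Finset.prod_const_one,
        mul_one, ← ENNReal.ofReal_pow (Real.exp_pos _).le, ← Real.exp_nat_mul, mul_neg, mul_one]
      simp only [higher]
    rw [e3, ← ENNReal.ofReal_mul (Real.exp_pos _).le, ← Real.exp_add]
    split_ifs with hlt
    · rw [← ENNReal.ofReal_one]
      exact ENNReal.ofReal_le_ofReal (Real.one_le_exp (by linarith))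
    · exact zero_le
  · refine (mul_le_mul' le_rfl (pow_le_pow_left' hsum _)).trans ?_
    rw [← ENNReal.ofReal_pow (Real.exp_pos _).le, ← ENNReal.ofReal_mul (Real.exp_pos _).le,
      ← Real.exp_nat_mul, ← Real.exp_add]
    refine ENNReal.ofReal_le_ofReal ?_
    have hS' : (n : ℝ) ≤ 2 * S.card := by exact_mod_cast hS
    have h1 : (n / 2 : ℝ) * (5 / 8 * q) ≤ S.card * (5 / 8 * q) :=
      mul_le_mul_of_nonneg_right (by linarith) (by positivity)
    calc _ ≤ Real.exp (-(n * q / 16)) := Real.exp_le_exp.2 (by linarith)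
      _ ≤ 1 / (n * q / 16) := exp_neg_le_div (by positivity)
      _ = 16 / (n * q) := by field_simp

section Runs

variable [LinearOrder Ball] [LinearOrder Bin]

/-- The systems for which the runs at the successive levels are short: up to constant factors, `n`
balls in bins of total capacity at least `(1 + ε) n`, each of capacity at most `C`. -/
structure Admissible (k n C : ℕ) (ε : ℝ) (cap : Bin → ℕ) (S : Finset Ball) (T : Finset Bin) :
    Prop where
  n_pos : 0 < n
  C_pos : 0 < C
  ε_pos : 0 < ε
  cap_le : ∀ c, cap c ≤ C
  card_le : S.card ≤ n
  le_card : n ≤ 2 * S.card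
  bins : T.card * C ≤ 4 * n
  room : S.card + ε * n / 2 ≤ ∑ b ∈ T, (cap b : ℝ)
  levels : 1 / ε ≤ 2 ^ k

variable {n C : ℕ} {ε : ℝ} {cap : Bin → ℕ} {S : Finset Ball} {T : Finset Bin}

theorem Admissible.card_lt (A : Admissible k n C ε cap S T) : S.card < ∑ b ∈ T, cap b := by
  have h1 := A.room
  have h2 : 0 < ε * n / 2 := by
    have := A.ε_pos
    have : (0 : ℝ) < n := by exact_mod_cast A.n_pos
    positivity
  have : (S.card : ℝ) < ((∑ b ∈ T, cap b : ℕ) : ℝ) := by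
    push_cast
    linarith
  exact_mod_cast this

/-- Only the balls below level `i` can have used room, so the balls of level `i` and those above it
add to the slack. -/
theorem le_roomBefore (cap : Bin → ℕ) (h : Hashes k Ball Bin) (S : Finset Ball) (T : Finset Bin)
    (i : Fin k) : ∑ b ∈ T, (cap b : ℝ) - S.card + (atLevel h S i).card + (higher h S i).card ≤
      roomBefore cap h S T i := by
  have h1 : ∑ b ∈ T, cap b = roomBefore cap h S T i + ∑ b ∈ T, levelLoad cap h S T i b := by
    rw [roomBefore, ← Finset.sum_add_distrib]
    refine Finset.sum_congr rfl fun b _ => ?_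
    have := levelLoad_le_cap cap h S T i b
    omega
  have h2 : ∑ b ∈ T, levelLoad cap h S T i b ≤ (below h S i).card :=
    (sum_load_le _ _).trans (card_assigned_capImage_le _ _ _ _)
  have h3 : S.card = (below h S (i + 1)).card + (higher h S i).card := by
    rw [below, higher, ← Finset.card_filter_add_card_filter_not
      (s := S) (fun y => ((h.1 y).1 : ℕ) < i + 1)]
    congr 2
    ext y
    simp only [Finset.mem_filter, Fin.lt_def]
    exact and_congr_right fun _ => by omega
  have h4 := card_below_succ h S i
  have h5 : ∑ b ∈ T, cap b + (atLevel h S i).card + (higher h S i).card ≤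
      roomBefore cap h S T i + S.card := by omega
  have : ((∑ b ∈ T, cap b : ℕ) : ℝ) + (atLevel h S i).card + (higher h S i).card ≤
      roomBefore cap h S T i + S.card := by exact_mod_cast h5
  push_cast at this
  linarith

/-- The constant in the bounds for the expected lengths of runs. -/
noncomputable def runConst : ℝ := 32 * 2501 ^ 2 + 73

theorem runConst_pos : 0 < runConst := by
  unfold runConst
  norm_num

/-- The expected length of the run at level `i` from a point `p`, with a weight that is determined by
the levels of some other balls. -/
theorem Admissible.lintegral_weight_mul_run_le [NeZero k] (A : Admissible k n C ε cap S T)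
    (i : Fin k) {Z : Finset Ball} (hZS : Disjoint Z S) {w : Ball → Fin k → ℝ≥0∞}
    (hw : ∀ y j, w y j ≠ ∞) (p : Hashes k Ball Bin → ℝ)
    (hp : ∀ h : Hashes k Ball Bin, ∏ y ∈ Z, w y (h.1 y).1 ≠ 0 → 0 < roomBefore cap h S T i →
      17 * (atLevel h S i).card ≤ 16 * roomBefore cap h S T i →
      ∫⁻ ω, ((run cap (resample i h ω) S T i (p (resample i h ω))).card : ℝ≥0∞)
        ∂(pointLaw Ball Bin) ≤
      ENNReal.ofReal (1 + 2 * 2501 ^ 2 * T.card * C / roomBefore cap h S T i)) :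
    ∫⁻ h, (∏ y ∈ Z, w y (h.1 y).1) * ((run cap h S T i (p h)).card : ℝ≥0∞)
        ∂(hashLaw k Ball Bin) ≤
      (∏ y ∈ Z, ∑ j, levelProb k j * w y j) * ENNReal.ofReal (runConst * 2 ^ ((i : ℕ) + 1)) := by
  classical
  set q : ℝ := (1 / 2 : ℝ) ^ ((i : ℕ) + 1) with hq
  have hq0 : 0 < q := by positivity
  have hqi : q⁻¹ = 2 ^ ((i : ℕ) + 1) := by rw [hq, one_div, inv_pow, inv_inv]
  have hq1 : 1 ≤ q⁻¹ := by rw [hqi]; exact one_le_pow₀ (by norm_num)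
  have hn : (0 : ℝ) < n := by exact_mod_cast A.n_pos
  have hC : (1 : ℝ) ≤ C := by exact_mod_cast A.C_pos
  have hTC : (T.card : ℝ) * C ≤ 4 * n := by exact_mod_cast A.bins
  have hT : (T.card : ℝ) ≤ 4 * n := by nlinarith
  have hε := A.ε_pos
  set many : Hashes k Ball Bin → ℝ≥0∞ := fun h =>
    if 4 * (n * q) < (atLevel h S i).card then 1 else 0 with hmany
  set few : Hashes k Ball Bin → ℝ≥0∞ := fun h =>
    if ((higher h S i).card : ℝ) < n * q / 4 then 1 else 0 with hfew
  set few' : Hashes k Ball Bin → ℝ≥0∞ := fun h => if (i : ℕ) + 1 < k then few h else 0 with hfew'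
  set W : Hashes k Ball Bin → ℝ≥0∞ := fun h => ∏ y ∈ Z, w y (h.1 y).1 with hW
  have hlevm : ∀ y : Ball, Measurable fun h : Hashes k Ball Bin => (h.1 y).1 := fun y =>
    measurable_fst.comp ((measurable_pi_apply y).comp measurable_fst)
  have hWm : Measurable W := Finset.measurable_prod _ fun y _ =>
    (measurable_of_finite (w y)).comp (hlevm y)
  have hlevels : ∀ F : (Ball → Fin k) → ℝ≥0∞,
      Measurable fun h : Hashes k Ball Bin => F fun y => (h.1 y).1 := fun F =>
    (measurable_of_finite F).comp (measurable_pi_iff.2 hlevm)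
  have hmanym : Measurable many := hlevels fun l =>
    if 4 * (n * q) < (S.filter fun y => l y = i).card then 1 else 0
  have hfewm : Measurable few' := hlevels fun l => if (i : ℕ) + 1 < k then
    (if ((S.filter fun y => i < l y).card : ℝ) < n * q / 4 then 1 else 0) else 0
  set M : ℝ := 1 + 32 * 2501 ^ 2 * q⁻¹ with hM
  have hinner : ∀ h, ∫⁻ ω, W (resample i h ω) *
      ((run cap (resample i h ω) S T i (p (resample i h ω))).card : ℝ≥0∞) ∂(pointLaw Ball Bin) ≤
      W h * (ENNReal.ofReal M + ENNReal.ofReal (4 * n) * (many h + few' h)) := by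
    intro h
    by_cases hWh : W h = 0
    · have : ∀ ω, W (resample i h ω) = 0 := fun ω => hWh
      simp [this]
    have hle : ∫⁻ ω, W (resample i h ω) *
        ((run cap (resample i h ω) S T i (p (resample i h ω))).card : ℝ≥0∞) ∂(pointLaw Ball Bin) =
        ∫⁻ ω, W h * ((run cap (resample i h ω) S T i (p (resample i h ω))).card : ℝ≥0∞)
          ∂(pointLaw Ball Bin) := rfl
    have htriv : ∀ ω, ((run cap (resample i h ω) S T i (p (resample i h ω))).card : ℝ≥0∞) ≤
        ENNReal.ofReal (4 * n) := fun ω => by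
      rw [← ENNReal.ofReal_natCast]
      refine ENNReal.ofReal_le_ofReal (le_trans ?_ hT)
      exact_mod_cast Finset.card_le_card (run_subset _ _ _ _ _ _)
    rw [hle]
    by_cases hbad : many h + few' h = 0
    · rw [add_eq_zero] at hbad
      obtain ⟨hg1, hg2⟩ := hbad
      have hN : ((atLevel h S i).card : ℝ) ≤ 4 * (n * q) := by
        by_contra hc
        simp [hmany, not_le.1 hc] at hg1
      have hroom := le_roomBefore cap h S T i
      have hA := A.room
      -- Below the last level the surplus `n * q / 4` comes from the balls of the higher levels, at
      -- the last level from the slack `ε * n / 2`, since `q = 2 ^ (-k) ≤ ε` there.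
      have hF : (atLevel h S i).card + n * q / 4 ≤ (roomBefore cap h S T i : ℝ) := by
        by_cases hik : (i : ℕ) + 1 < k
        · have hH : n * q / 4 ≤ ((higher h S i).card : ℝ) := by
            by_contra hc
            have : few' h = 1 := (if_pos hik).trans (if_pos (not_le.1 hc))
            exact one_ne_zero (this.symm.trans hg2)
          have : 0 < ε * n / 2 := by positivity
          linarith
        · have hik' : (i : ℕ) + 1 = k := by omega
          have hqε : q ≤ ε := by
            rw [← inv_inv q, hqi, hik', inv_le_comm₀ (by positivity) hε, ← one_div]
            exact A.levels
          have h0 : (0 : ℝ) ≤ (higher h S i).card := Nat.cast_nonneg _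
          have h1 : n * q ≤ ε * n := by nlinarith
          have h2 : 0 < n * q := by positivity
          linarith
      have hnq : 0 < n * q := by positivity
      have hF0 : (0 : ℝ) < roomBefore cap h S T i := by
        have : (0 : ℝ) ≤ (atLevel h S i).card := Nat.cast_nonneg _
        linarith
      -- The level has at most `4 * (n * q)` balls, which is `16` times the surplus `n * q / 4`.
      -- This is the origin of the ratio `16 / 17`.
      have hint := hp h hWh (by exact_mod_cast hF0) (by
        have : 17 * ((atLevel h S i).card : ℝ) ≤ 16 * roomBefore cap h S T i := by linarith
        exact_mod_cast this)
      have hconst : ∫⁻ ω, W h * ((run cap (resample i h ω) S T i (p (resample i h ω))).card : ℝ≥0∞)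
          ∂(pointLaw Ball Bin) ≤ W h * ENNReal.ofReal M := by
        rw [lintegral_const_mul' _ _ (ENNReal.prod_ne_top fun y _ => hw y _)]
        refine mul_le_mul' le_rfl (hint.trans (ENNReal.ofReal_le_ofReal ?_))
        have hF1 : n * q / 4 ≤ (roomBefore cap h S T i : ℝ) := by
          have : (0 : ℝ) ≤ (atLevel h S i).card := Nat.cast_nonneg _
          linarith
        have : (T.card : ℝ) * C / roomBefore cap h S T i ≤ 16 * q⁻¹ := by
          rw [div_le_iff₀ hF0]
          calc (T.card : ℝ) * C ≤ 4 * n := hTC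
            _ = 16 * q⁻¹ * (n * q / 4) := by field_simp; ring
            _ ≤ _ := by gcongr
        rw [hM, mul_assoc _ (T.card : ℝ), mul_div_assoc]
        linarith
      refine hconst.trans (mul_le_mul' le_rfl le_self_add)
    · have h1 : 1 ≤ many h + few' h := by
        have h01 : ∀ (P : Prop) [Decidable P], (if P then (1 : ℝ≥0∞) else 0) = 0 ∨
            (if P then (1 : ℝ≥0∞) else 0) = 1 := fun P _ => by split_ifs <;> simp
        rcases h01 (4 * (n * q) < (atLevel h S i).card) with h0 | h1
        · by_cases hik : (i : ℕ) + 1 < k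
          · have e : few' h = few h := if_pos hik
            rcases h01 (((higher h S i).card : ℝ) < n * q / 4) with h2 | h2
            · exact absurd (by rw [e, add_eq_zero]; exact ⟨h0, h2⟩) hbad
            · exact le_add_left (by rw [e]; exact h2.ge)
          · have e : few' h = 0 := if_neg hik
            exact absurd (by rw [e, add_zero]; exact h0) hbad
        · exact le_add_right h1.ge
      have hmono : ∀ ω, W h * ((run cap (resample i h ω) S T i (p (resample i h ω))).card : ℝ≥0∞) ≤
          W h * ENNReal.ofReal (4 * n) := fun ω => mul_le_mul' (le_refl (W h)) (htriv ω)
      refine (lintegral_mono hmono).trans ?_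
      rw [lintegral_const, measure_univ, mul_one]
      refine mul_le_mul' le_rfl (le_add_left ?_)
      simpa using mul_le_mul' (le_refl (ENNReal.ofReal (4 * n))) h1
  refine (lintegral_hashLaw_le i _).trans ((lintegral_mono hinner).trans ?_)
  set EW : ℝ≥0∞ := ∏ y ∈ Z, ∑ j, levelProb k j * w y j with hEW
  have hEWi : ∫⁻ h, W h ∂(hashLaw k Ball Bin) = EW := lintegral_prod_levels Z w
  have hmanyi : ∫⁻ h, W h * many h ∂(hashLaw k Ball Bin) ≤ EW * ENNReal.ofReal (2 / (n * q)) :=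
    lintegral_many_le hZS w i A.n_pos A.card_le
  have hfewi : ∫⁻ h, W h * few' h ∂(hashLaw k Ball Bin) ≤ EW * ENNReal.ofReal (16 / (n * q)) := by
    by_cases hik : (i : ℕ) + 1 < k
    · have e : few' = few := funext fun h => if_pos hik
      rw [e]
      exact lintegral_few_le hZS w i hik A.n_pos A.le_card
    · have e : few' = fun _ => 0 := funext fun h => if_neg hik
      simp [e]
  have hsplit : ∀ h, W h * (ENNReal.ofReal M + ENNReal.ofReal (4 * n) * (many h + few' h)) =
      ENNReal.ofReal M * W h +
        (ENNReal.ofReal (4 * n) * (W h * many h) + ENNReal.ofReal (4 * n) * (W h * few' h)) :=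
    fun h => by ring
  have hWmm : Measurable fun h => W h * many h := hWm.mul hmanym
  have hWfm : Measurable fun h => W h * few' h := hWm.mul hfewm
  simp only [hsplit]
  rw [lintegral_add_left (hWm.const_mul _), lintegral_add_left (hWmm.const_mul _),
    lintegral_const_mul _ hWm, lintegral_const_mul _ hWmm, lintegral_const_mul _ hWfm, hEWi]
  refine (add_le_add le_rfl (add_le_add (mul_le_mul' le_rfl hmanyi)
    (mul_le_mul' le_rfl hfewi))).trans ?_
  have e : ENNReal.ofReal M * EW + (ENNReal.ofReal (4 * n) * (EW * ENNReal.ofReal (2 / (n * q))) +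
      ENNReal.ofReal (4 * n) * (EW * ENNReal.ofReal (16 / (n * q)))) =
      EW * (ENNReal.ofReal M + (ENNReal.ofReal (4 * n) * ENNReal.ofReal (2 / (n * q)) +
        ENNReal.ofReal (4 * n) * ENNReal.ofReal (16 / (n * q)))) := by ring
  rw [e, ← ENNReal.ofReal_mul (by positivity), ← ENNReal.ofReal_mul (by positivity),
    ← ENNReal.ofReal_add (by positivity) (by positivity),
    ← ENNReal.ofReal_add (by positivity) (by positivity)]
  -- With `1 ≤ q⁻¹` the terms `1`, `8 * q⁻¹` and `64 * q⁻¹` make up the `73` of `runConst`.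
  refine mul_le_mul' le_rfl (ENNReal.ofReal_le_ofReal ?_)
  have e1 : 4 * n * (2 / (n * q)) = 8 * q⁻¹ := by field_simp; ring
  have e2 : 4 * n * (16 / (n * q)) = 64 * q⁻¹ := by field_simp; ring
  rw [e1, e2, ← hqi, hM, runConst]
  nlinarith

end Runs

end BoundedLoads

/-! ### Measurability through finite order data, and absence of ties -/

namespace BoundedLoads

section Order

variable {k : ℕ} {Ball Bin : Type*} [Fintype Ball] [LinearOrder Ball] [LinearOrder Bin]

/-- Two realisations with the same levels of the balls and the same order of the bins clockwise from
each ball and each virtual bin. -/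
structure SameOrder (h h' : Hashes k Ball Bin) : Prop where
  level : ∀ y, (h.1 y).1 = (h'.1 y).1
  ball : ∀ y b c, cwDist h (h.1 y).1 (h.1 y).2 b ≤ cwDist h (h.1 y).1 (h.1 y).2 c ↔
    cwDist h' (h'.1 y).1 (h'.1 y).2 b ≤ cwDist h' (h'.1 y).1 (h'.1 y).2 c
  bin : ∀ i e b c, cwDist h i (h.2 e i) b ≤ cwDist h i (h.2 e i) c ↔
    cwDist h' i (h'.2 e i) b ≤ cwDist h' i (h'.2 e i) c

/-- A function of the levels and of the orders is measurable. -/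
theorem measurable_of_sameOrder [Fintype Bin] {α : Type*} [MeasurableSpace α]
    {f : Hashes k Ball Bin → α} (hf : ∀ h h', SameOrder h h' → f h = f h') : Measurable f := by
  classical
  let Φ : Hashes k Ball Bin →
      (Ball → Fin k) × (Ball → Bin → Bin → Prop) × (Fin k → Bin → Bin → Bin → Prop) := fun h =>
    (fun y => (h.1 y).1,
      fun y b c => cwDist h (h.1 y).1 (h.1 y).2 b ≤ cwDist h (h.1 y).1 (h.1 y).2 c,
      fun i e b c => cwDist h i (h.2 e i) b ≤ cwDist h i (h.2 e i) c)
  have hpos : ∀ b i, Measurable fun h : Hashes k Ball Bin => h.2 b i := fun b i =>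
    (measurable_pi_apply i).comp ((measurable_pi_apply b).comp measurable_snd)
  have hlev : ∀ y : Ball, Measurable fun h : Hashes k Ball Bin => (h.1 y).1 := fun y =>
    measurable_fst.comp ((measurable_pi_apply y).comp measurable_fst)
  have hpt : ∀ y : Ball, Measurable fun h : Hashes k Ball Bin => (h.1 y).2 := fun y =>
    measurable_snd.comp ((measurable_pi_apply y).comp measurable_fst)
  have hposl : ∀ b (y : Ball), Measurable fun h : Hashes k Ball Bin => h.2 b (h.1 y).1 :=
    fun b y => by
      have h1 : Measurable (Function.uncurry fun (i : Fin k) (v : Fin k → ℝ) => v i) :=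
        measurable_from_prod_countable_right fun i => measurable_pi_apply i
      exact h1.comp ((hlev y).prodMk ((measurable_pi_apply b).comp measurable_snd))
  have hΦ : Measurable Φ := by
    refine (measurable_pi_iff.2 hlev).prodMk (Measurable.prodMk ?_ ?_)
    · refine measurable_pi_iff.2 fun y => measurable_pi_iff.2 fun b => measurable_pi_iff.2 fun c => ?_
      exact measurableSet_setOfPred.1 (measurableSet_le (measurable_fract.comp ((hposl b y).sub (hpt y)))
        (measurable_fract.comp ((hposl c y).sub (hpt y))))
    · refine measurable_pi_iff.2 fun i => measurable_pi_iff.2 fun e => measurable_pi_iff.2 fun b =>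
        measurable_pi_iff.2 fun c => ?_
      exact measurableSet_setOfPred.1 (measurableSet_le
        (measurable_fract.comp ((hpos b i).sub (hpos e i)))
        (measurable_fract.comp ((hpos c i).sub (hpos e i))))
  have hfac : Function.FactorsThrough f Φ := fun h h' he => by
    have h1 : (Φ h).1 = (Φ h').1 := by rw [he]
    have h2 : (Φ h).2.1 = (Φ h').2.1 := by rw [he]
    have h3 : (Φ h).2.2 = (Φ h').2.2 := by rw [he]
    exact hf h h' ⟨fun y => congrFun h1 y,
      fun y b c => (congrFun (congrFun (congrFun h2 y) b) c).to_iff,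
      fun i e b c => (congrFun (congrFun (congrFun (congrFun h3 i) e) b) c).to_iff⟩
  intro s _
  -- `Φ` is measurable into a finite type with measurable singletons, so every subset of its
  -- codomain has a measurable preimage.
  have : f ⁻¹' s = Φ ⁻¹' (Φ '' (f ⁻¹' s)) := by
    refine Set.Subset.antisymm (Set.subset_preimage_image _ _) ?_
    rintro h ⟨h', hs, he⟩
    rw [Set.mem_preimage, hfac he.symm]
    exact hs
  rw [this]
  have : MeasurableSingletonClass Prop := ⟨fun _ => trivial⟩
  have : MeasurableSingletonClass (Bin → Bin → Prop) := inferInstance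
  have : MeasurableSingletonClass (Ball → Bin → Bin → Prop) := Pi.instMeasurableSingletonClass
  have : MeasurableSingletonClass (Fin k → Bin → Bin → Bin → Prop) := inferInstance
  have : MeasurableSingletonClass (Ball → Fin k) := inferInstance
  exact hΦ (Set.toFinite _).measurableSet

theorem clockwise_congr {h h' : Hashes k Ball Bin} {T : Finset Bin} {i : Fin k} {p p' : ℝ}
    (hd : ∀ b c, cwDist h i p b ≤ cwDist h i p c ↔ cwDist h' i p' b ≤ cwDist h' i p' c) :
    clockwise h T i p = clockwise h' T i p' := by
  refine clockwise_eq_iff.2 ?_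
  obtain ⟨h1, h2, h3⟩ := clockwise_eq_iff.1 (rfl : clockwise h' T i p' = _)
  refine ⟨h1, h2, h3.imp fun {b c} hbc => ?_⟩
  have hlt : ∀ b c, cwDist h i p b < cwDist h i p c ↔ cwDist h' i p' b < cwDist h' i p' c :=
    fun b c => by rw [← not_le, hd, not_le]
  rw [Prod.Lex.toLex_le_toLex] at hbc ⊢
  rcases hbc with hbc | ⟨he, hbc⟩
  · exact Or.inl ((hlt b c).2 hbc)
  · exact Or.inr ⟨le_antisymm ((hd b c).2 he.le) ((hd c b).2 he.ge), hbc⟩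

namespace SameOrder

variable {h h' : Hashes k Ball Bin} (H : SameOrder h h')
include H

theorem prio_eq : prio h = prio h' := by
  funext y
  rw [prio, prio, H.level]

theorem probes_eq (T : Finset Bin) (y : Ball) : probes h T y = probes h' T y := by
  have := H.ball y
  rw [probes, probes]
  rw [H.level y] at this ⊢
  exact clockwise_congr this

theorem below_eq (S : Finset Ball) (j : ℕ) : below h S j = below h' S j := by
  rw [below, below]
  simp only [H.level]

theorem capImage_eq (cap : Bin → ℕ) (S : Finset Ball) (T : Finset Bin) :
    capImage cap h S T = capImage cap h' S T := by
  have : place cap h T = place cap h' T := by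
    funext a x
    rw [place, place, H.probes_eq]
  rw [capImage, capImage, this, byPriority, byPriority, H.prio_eq]

theorem levelLoad_eq (cap : Bin → ℕ) (S : Finset Ball) (T : Finset Bin) (j : ℕ) :
    levelLoad cap h S T j = levelLoad cap h' S T j := by
  funext b
  rw [levelLoad, levelLoad, H.below_eq, H.capImage_eq]

theorem run_bin_eq (cap : Bin → ℕ) (S : Finset Ball) (T : Finset Bin) (i : Fin k) (e : Bin) :
    run cap h S T i (h.2 e i) = run cap h' S T i (h'.2 e i) := by
  rw [run, run]
  refine Finset.filter_congr fun b _ => ?_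
  simp only [H.bin, H.levelLoad_eq]

theorem run_ball_eq (cap : Bin → ℕ) (S : Finset Ball) (T : Finset Bin) (y : Ball) :
    run cap h S T (h.1 y).1 (h.1 y).2 = run cap h' S T (h'.1 y).1 (h'.1 y).2 := by
  rw [run, run]
  have := H.ball y
  rw [H.level y] at this ⊢
  refine Finset.filter_congr fun b _ => ?_
  simp only [this, H.levelLoad_eq]

theorem nextHole_eq (cap : Bin → ℕ) (S : Finset Ball) (T : Finset Bin) (j : ℕ) (e : Bin) :
    nextHole cap h S T j e = nextHole cap h' S T j e := by
  rw [nextHole, nextHole]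
  split_ifs with hj
  · rw [clockwise_congr (H.bin ⟨j, hj⟩ e), H.levelLoad_eq]
  · rfl

theorem hole_eq (cap : Bin → ℕ) (S : Finset Ball) (T : Finset Bin) (j₀ : ℕ) (b : Bin) (j : ℕ) :
    hole cap h S T j₀ b j = hole cap h' S T j₀ b j := by
  induction j with
  | zero => rfl
  | succ j ih => rw [hole, hole, ih, H.nextHole_eq]

theorem ballHole_eq (cap : Bin → ℕ) (S : Finset Ball) (T : Finset Bin) (x : Ball) (d : Bin)
    (i : Fin k) : ballHole cap h S T x d i = ballHole cap h' S T x d i := by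
  rw [ballHole, ballHole, landing, landing, H.level, H.probes_eq, H.levelLoad_eq, H.hole_eq]

end SameOrder

end Order

section TieFree

variable {k : ℕ} {Ball Bin : Type*} [Fintype Ball] [Fintype Bin]

/-- Resample level `i` and fix the point `t` of `b`. The point of `b'` then has to differ from `t`
by an integer, which leaves a countable set. -/
theorem ae_tieFree [NeZero k] : ∀ᵐ h ∂(hashLaw k Ball Bin), TieFree h := by
  classical
  have key : ∀ (i : Fin k) (b b' : Bin), b ≠ b' →
      ∀ᵐ h ∂(hashLaw k Ball Bin), Int.fract (h.2 b i - h.2 b' i) ≠ 0 := by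
    intro i b b' hb
    have hpos : ∀ b i, Measurable fun h : Hashes k Ball Bin => h.2 b i := fun b i =>
      (measurable_pi_apply i).comp ((measurable_pi_apply b).comp measurable_snd)
    have hs : MeasurableSet {h : Hashes k Ball Bin | Int.fract (h.2 b i - h.2 b' i) = 0} :=
      (measurable_fract.comp ((hpos b i).sub (hpos b' i))) (measurableSet_singleton 0)
    rw [ae_iff]
    simp only [ne_eq, not_not]
    rw [← lintegral_indicator_one hs, ← nonpos_iff_eq_zero]
    have hcircle : ∀ t : ℝ, ∫⁻ s, (if Int.fract (t - s) = 0 then (1 : ℝ≥0∞) else 0) ∂circleLaw = 0 := by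
      intro t
      have h0 : circleLaw {s : ℝ | Int.fract (t - s) = 0} = 0 := by
        refine measure_mono_null ?_
          (((Set.countable_range fun z : ℤ => t - z).measure_zero volume : _) |>
            fun h => nonpos_iff_eq_zero.1 ((Measure.restrict_apply_le _ _).trans h.le))
        intro s hs
        obtain ⟨z, hz⟩ := Int.fract_eq_zero_iff.1 hs
        exact ⟨z, by simp only [hz]; ring⟩
      rw [lintegral_congr_ae (g := fun _ => 0), lintegral_zero]
      filter_upwards [compl_mem_ae_iff.2 h0] with s hs
      exact if_neg hs
    refine (lintegral_hashLaw_le i _).trans ?_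
    refine (lintegral_mono (g := fun _ => 0) fun h => ?_).trans_eq lintegral_zero
    refine (lintegral_pointLaw_bin_le b _).trans ?_
    refine (lintegral_mono (g := fun _ => 0) fun t => ?_).trans_eq lintegral_zero
    refine (lintegral_pointLaw_bin_le b' _).trans (le_of_eq ?_)
    rw [← hcircle t]
    refine lintegral_congr fun s => ?_
    have : ∀ ω : (Ball → ℝ) × (Bin → ℝ), Set.indicator
        {h : Hashes k Ball Bin | Int.fract (h.2 b i - h.2 b' i) = 0} (1 : Hashes k Ball Bin → ℝ≥0∞)
        (resample i h ((ω.1, Function.update ω.2 b' s).1,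
          Function.update (ω.1, Function.update ω.2 b' s).2 b t)) =
        if Int.fract (t - s) = 0 then (1 : ℝ≥0∞) else 0 := fun ω => by
      simp [Set.indicator_apply, resample, hb.symm]
    simp only [this]
    rw [lintegral_const, measure_univ, mul_one]
  have : ∀ᵐ h ∂(hashLaw k Ball Bin), ∀ (i : Fin k) (b b' : Bin), b ≠ b' →
      Int.fract (h.2 b i - h.2 b' i) ≠ 0 := by
    simp only [ae_all_iff]
    exact key
  filter_upwards [this] with h hh i b b' he
  by_contra hb
  exact hh i b b' hb he

end TieFree

end BoundedLoads

/-! ### Expected sums of runs for updates of balls and of bins -/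

namespace BoundedLoads

section Expectations

variable {k : ℕ} {Ball Bin : Type*} [Fintype Ball] [Fintype Bin] [LinearOrder Ball]
  [LinearOrder Bin] {n C : ℕ} {ε : ℝ} {cap : Bin → ℕ} {S : Finset Ball} {T : Finset Bin}

theorem Admissible.lintegral_run_bin_le [NeZero k] (A : Admissible k n C ε cap S T) (i : Fin k)
    (e : Hashes k Ball Bin → Bin) (he : ∀ h ω, e (resample i h ω) = e h) :
    ∫⁻ h, ((run cap h S T i (h.2 (e h) i)).card : ℝ≥0∞) ∂(hashLaw k Ball Bin) ≤
      ENNReal.ofReal (runConst * 2 ^ ((i : ℕ) + 1)) := by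
  have := A.lintegral_weight_mul_run_le i (Finset.disjoint_empty_left S) (w := fun _ _ => 1)
    (fun _ _ => ENNReal.one_ne_top) (fun h => h.2 (e h) i) fun h _ hF hB => by
      simp only [he]
      exact lintegral_card_run_bin_le A.C_pos A.cap_le A.card_lt hF hB (e h)
  simpa using this

theorem Admissible.lintegral_run_ball_le [NeZero k] (A : Admissible k n C ε cap S T) (i : Fin k)
    {x : Ball} (hx : x ∉ S) :
    ∫⁻ h, (if (h.1 x).1 = i then 1 else 0) * ((run cap h S T i (h.1 x).2).card : ℝ≥0∞)
        ∂(hashLaw k Ball Bin) ≤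
      levelProb k i * ENNReal.ofReal (runConst * 2 ^ ((i : ℕ) + 1)) := by
  have := A.lintegral_weight_mul_run_le i (Finset.disjoint_singleton_left.2 hx)
    (w := fun _ j => if j = i then 1 else 0)
    (fun _ j => by split_ifs <;> simp) (fun h => (h.1 x).2) fun h hw hF hB => by
      rw [Finset.prod_singleton] at hw
      have hxi : (h.1 x).1 = i := by
        by_contra hc
        exact hw (if_neg hc)
      exact lintegral_card_run_ball_le A.C_pos A.cap_le A.card_lt hF hB hx hxi
  simpa using this

theorem measurable_card_run_bin (cap : Bin → ℕ) (S : Finset Ball) (T : Finset Bin) (i : Fin k)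
    {e : Hashes k Ball Bin → Bin} (he : ∀ h h', SameOrder h h' → e h = e h') :
    Measurable fun h => ((run cap h S T i (h.2 (e h) i)).card : ℝ≥0∞) :=
  measurable_of_sameOrder fun h h' H => by rw [he h h' H, H.run_bin_eq]

theorem sum_two_pow_le (k : ℕ) : ∑ i : Fin k, (2 : ℝ) ^ ((i : ℕ) + 1) ≤ 2 ^ (k + 1) := by
  rw [Fin.sum_univ_eq_sum_range fun i => (2 : ℝ) ^ (i + 1)]
  induction k with
  | zero => simp
  | succ k ih =>
    rw [Finset.sum_range_succ, pow_succ 2 (k + 1)]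
    linarith

/-- The runs at all levels from bins that are determined by the lower levels. -/
theorem Admissible.lintegral_sum_run_le [NeZero k] (A : Admissible k n C ε cap S T)
    (e : Fin k → Hashes k Ball Bin → Bin) (he : ∀ i h ω, e i (resample i h ω) = e i h)
    (he' : ∀ i h h', SameOrder h h' → e i h = e i h') :
    ∫⁻ h, ∑ i, ((run cap h S T i (h.2 (e i h) i)).card : ℝ≥0∞) ∂(hashLaw k Ball Bin) ≤
      ENNReal.ofReal (runConst * 2 ^ (k + 1)) := by
  rw [lintegral_finsetSum _ fun i _ => measurable_card_run_bin cap S T i (he' i)]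
  refine (Finset.sum_le_sum fun i _ => A.lintegral_run_bin_le i (e i) (he i)).trans ?_
  rw [← ENNReal.ofReal_sum_of_nonneg fun i _ => mul_nonneg runConst_pos.le (by positivity),
    ← Finset.mul_sum]
  exact ENNReal.ofReal_le_ofReal (mul_le_mul_of_nonneg_left (sum_two_pow_le k) runConst_pos.le)

/-- The run from the hash value of a ball. -/
theorem Admissible.lintegral_run_probe_le [NeZero k] (A : Admissible k n C ε cap S T) {x : Ball}
    (hx : x ∉ S) :
    ∫⁻ h, ((run cap h S T (h.1 x).1 (h.1 x).2).card : ℝ≥0∞) ∂(hashLaw k Ball Bin) ≤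
      ENNReal.ofReal (2 * runConst * k) := by
  have hlev : Measurable fun h : Hashes k Ball Bin => (h.1 x).1 :=
    measurable_fst.comp ((measurable_pi_apply x).comp measurable_fst)
  have hrun : Measurable fun h : Hashes k Ball Bin =>
      ((run cap h S T (h.1 x).1 (h.1 x).2).card : ℝ≥0∞) :=
    measurable_of_sameOrder fun h h' H => by rw [H.run_ball_eq]
  have hite : ∀ i, Measurable fun h : Hashes k Ball Bin =>
      if (h.1 x).1 = i then (1 : ℝ≥0∞) else 0 := fun i =>
    (measurable_of_finite fun j : Fin k => if j = i then (1 : ℝ≥0∞) else 0).comp hlev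
  have hsum : ∀ h : Hashes k Ball Bin, ((run cap h S T (h.1 x).1 (h.1 x).2).card : ℝ≥0∞) =
      ∑ i, (if (h.1 x).1 = i then 1 else 0) *
        ((run cap h S T (h.1 x).1 (h.1 x).2).card : ℝ≥0∞) := fun h => by
    rw [← Finset.sum_mul]
    simp
  have hi : ∀ (i : Fin k) (h : Hashes k Ball Bin), (if (h.1 x).1 = i then 1 else 0) *
      ((run cap h S T (h.1 x).1 (h.1 x).2).card : ℝ≥0∞) =
      (if (h.1 x).1 = i then 1 else 0) * ((run cap h S T i (h.1 x).2).card : ℝ≥0∞) := fun i h => by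
    split_ifs with hxi
    · rw [hxi]
    · simp
  have hprod : ∀ i, Measurable fun h : Hashes k Ball Bin => (if (h.1 x).1 = i then 1 else 0) *
      ((run cap h S T (h.1 x).1 (h.1 x).2).card : ℝ≥0∞) := fun i => (hite i).mul hrun
  rw [lintegral_congr hsum, lintegral_finsetSum _ fun i _ => hprod i]
  have hterm : ∀ i : Fin k, ∫⁻ h, (if (h.1 x).1 = i then 1 else 0) *
      ((run cap h S T (h.1 x).1 (h.1 x).2).card : ℝ≥0∞) ∂(hashLaw k Ball Bin) ≤
      ENNReal.ofReal (2 * runConst) := fun i => by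
    rw [lintegral_congr (hi i)]
    -- The probability of level `i`, at most `(1 / 2) ^ i`, cancels the growth of the runs up to a
    -- factor `2`.
    refine (A.lintegral_run_ball_le i hx).trans ((mul_le_mul' (levelProb_le i) le_rfl).trans ?_)
    rw [← ENNReal.ofReal_mul (by positivity)]
    refine ENNReal.ofReal_le_ofReal (le_of_eq ?_)
    have : (1 / 2 : ℝ) ^ (i : ℕ) * 2 ^ (i : ℕ) = 1 := by rw [← mul_pow]; norm_num
    rw [pow_succ]
    linear_combination (2 * runConst) * this
  refine (Finset.sum_le_sum fun i _ => hterm i).trans (le_of_eq ?_)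
  rw [Finset.sum_const, Finset.card_univ, Fintype.card_fin, nsmul_eq_mul, mul_comm (2 * runConst),
    ENNReal.ofReal_mul (Nat.cast_nonneg _), ENNReal.ofReal_natCast]

/-- The integrand dominates both the visited bins and the moved balls. At levels not above that of
`x`, `ballHole` is the constant `d`; these terms only enlarge the bound, and they keep each summand
independent of its own circle. -/
theorem Admissible.lintegral_insertion_le [NeZero k] (A : Admissible k n C ε cap S T) {x : Ball}
    (hx : x ∉ S) (d : Bin) :
    ∫⁻ h, (((run cap h S T (h.1 x).1 (h.1 x).2).card +
        ∑ i : Fin k, (run cap h S T i (h.2 (ballHole cap h S T x d i) i)).card : ℕ) : ℝ≥0∞)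
        ∂(hashLaw k Ball Bin) ≤ ENNReal.ofReal (2 * runConst * 2 ^ (k + 1)) := by
  have hrun : Measurable fun h : Hashes k Ball Bin =>
      ((run cap h S T (h.1 x).1 (h.1 x).2).card : ℝ≥0∞) :=
    measurable_of_sameOrder fun h h' H => by rw [H.run_ball_eq]
  push_cast
  rw [lintegral_add_left hrun]
  refine (add_le_add (A.lintegral_run_probe_le hx) (A.lintegral_sum_run_le
    (fun i h => ballHole cap h S T x d i) (fun i h ω => ballHole_resample cap i h S ω T x d)
    fun i h h' H => H.ballHole_eq cap S T x d i)).trans ?_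
  have hk : (k : ℝ) ≤ 2 ^ k := by exact_mod_cast (Nat.lt_two_pow_self (n := k)).le
  have := runConst_pos
  rw [← ENNReal.ofReal_add (by positivity) (by positivity), pow_succ]
  refine ENNReal.ofReal_le_ofReal ?_
  nlinarith

/-- Removing a bin without capacity. -/
theorem clockwise_erase (h : Hashes k Ball Bin) (T : Finset Bin) (i : Fin k) (p : ℝ) (b : Bin) :
    clockwise h (T.erase b) i p = (clockwise h T i p).filter fun c => c ≠ b := by
  refine clockwise_eq_iff.2 ⟨(nodup_clockwise _ _ _ _).filter _, ?_,
    (pairwise_key_clockwise _ _ _ _).filter _⟩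
  ext c
  simp [mem_clockwise, and_comm]

/-- A bin of capacity zero is never free, so every ball passes it. -/
theorem capImage_erase {cap : Bin → ℕ} (h : Hashes k Ball Bin) (S : Finset Ball) (T : Finset Bin)
    {b : Bin} (hb : cap b = 0) : capImage cap h S (T.erase b) = capImage cap h S T := by
  have : place cap h (T.erase b) = place cap h T := by
    funext a x
    rw [place, place, probes, clockwise_erase, List.find?_filter, probes]
    congr 3
    funext c
    by_cases hc : c = b
    · simp [hc, hb]
    · simp [hc]
  rw [capImage, capImage, this]

theorem capImage_congr {cap cap' : Bin → ℕ} (h : Hashes k Ball Bin) (S : Finset Ball)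
    {T : Finset Bin} (hc : ∀ b ∈ T, cap b = cap' b) :
    capImage cap h S T = capImage cap' h S T := by
  have : place cap h T = place cap' h T := by
    funext a x
    rw [place, place]
    congr 1
    refine List.find?_congr fun b hb => ?_
    rw [hc b (mem_clockwise.1 hb)]
  rw [capImage, capImage, this]

/-- Two systems that differ by one bin. -/
theorem lintegral_moved_erase_le [NeZero k] (hn : 0 < n) (hS : S.card = n) (hC : 0 < C) (hε : 0 < ε)
    (hbins : T.card * C ≤ 4 * n) (hlev : 1 / ε ≤ 2 ^ k) {b : Bin} (hb : b ∈ T)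
    (hroom : n + ε * n / 2 ≤ ((T.erase b).card : ℝ) * C) :
    ∫⁻ h, (moved (image C h S T) (image C h S (T.erase b)) : ℝ≥0∞) ∂(hashLaw k Ball Bin) ≤
      ENNReal.ofReal (C * (runConst * 2 ^ (k + 1))) := by
  -- The bin `b` is removed place by place: `κ C` is the system with `b`, and `κ 0` amounts to the
  -- system without it. Each step is a capacity change by one, covered by `moved_capacity_le`.
  set κ : ℕ → Bin → ℕ := fun r => Function.update (fun _ => C) b r with hκ
  have hsum : ∀ r, ∑ c ∈ T, (κ r c : ℝ) = r + (T.erase b).card * C := fun r => by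
    rw [← Finset.add_sum_erase T _ hb]
    have : ∀ c ∈ T.erase b, (κ r c : ℝ) = C := fun c hc => by
      rw [hκ]
      simp only [Function.update_of_ne (Finset.ne_of_mem_erase hc)]
    rw [Finset.sum_congr rfl this, Finset.sum_const, nsmul_eq_mul]
    simp [hκ]
  have hA : ∀ r, r ≤ C → Admissible k n C ε (κ r) S T := fun r hr =>
    { n_pos := hn
      C_pos := hC
      ε_pos := hε
      cap_le := fun c => by
        by_cases hc : c = b
        · simpa [hκ, hc] using hr
        · simp [hκ, Function.update_of_ne hc]
      card_le := hS.le
      le_card := by omega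
      bins := hbins
      room := by
        rw [hsum, hS]
        have : (0 : ℝ) ≤ r := Nat.cast_nonneg _
        linarith
      levels := hlev }
  have h0 : ∀ h : Hashes k Ball Bin, image C h S (T.erase b) = capImage (κ 0) h S T := fun h => by
    rw [image_eq_capImage, ← capImage_erase (cap := κ 0) h S T (b := b) (by simp [hκ])]
    exact capImage_congr h S fun c hc => by
      simp only [hκ, Function.update_of_ne (Finset.ne_of_mem_erase hc)]
  have h1 : ∀ h : Hashes k Ball Bin, image C h S T = capImage (κ C) h S T := fun h => by
    rw [image_eq_capImage]
    exact capImage_congr h S fun c hc => by simp only [hκ, Function.update_eq_self]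
  have hstep : ∀ h : Hashes k Ball Bin, TieFree h → ∀ r, r ≤ C →
      moved (capImage (κ r) h S T) (capImage (κ 0) h S T) ≤ ∑ s ∈ Finset.range r,
        ∑ i : Fin k, (run (κ (s + 1)) h S T i (h.2 (hole (κ (s + 1)) h S T 0 b i) i)).card := by
    intro h hh r
    induction r with
    | zero => simp [moved_self]
    | succ r ih =>
      intro hr
      refine (moved_triangle _ (capImage (κ r) h S T) _).trans ?_
      rw [Finset.sum_range_succ, add_comm]
      refine add_le_add (ih (by omega)) (moved_capacity_le hh hb (fun c => ?_) (hA _ hr).card_lt)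
      by_cases hc : c = b
      · simp [hκ, hc]
      · simp [hκ, hc]
  have hle : ∀ᵐ h ∂(hashLaw k Ball Bin),
      (moved (image C h S T) (image C h S (T.erase b)) : ℝ≥0∞) ≤ ∑ s ∈ Finset.range C,
        ∑ i : Fin k,
          ((run (κ (s + 1)) h S T i (h.2 (hole (κ (s + 1)) h S T 0 b i) i)).card : ℝ≥0∞) := by
    filter_upwards [ae_tieFree] with h hh
    rw [h0, h1]
    exact_mod_cast hstep h hh C le_rfl
  refine (lintegral_mono_ae hle).trans ?_
  have hm : ∀ s, Measurable fun h : Hashes k Ball Bin => ∑ i : Fin k,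
      ((run (κ (s + 1)) h S T i (h.2 (hole (κ (s + 1)) h S T 0 b i) i)).card : ℝ≥0∞) := fun s =>
    Finset.measurable_sum _ fun i _ => measurable_card_run_bin _ S T i
      fun h h' H => H.hole_eq (κ (s + 1)) S T 0 b i
  rw [lintegral_finsetSum _ fun s _ => hm s]
  refine (Finset.sum_le_sum fun s hs => (hA (s + 1) (Finset.mem_range.1 hs)).lintegral_sum_run_le
    (fun i h => hole (κ (s + 1)) h S T 0 b i) (fun i h ω => hole_resample _ h S ω T 0 b le_rfl)
    fun i h h' H => H.hole_eq _ S T 0 b i).trans (le_of_eq ?_)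
  rw [Finset.sum_const, Finset.card_range, nsmul_eq_mul, ENNReal.ofReal_mul (Nat.cast_nonneg _),
    ENNReal.ofReal_natCast]

theorem moved_image_le (h : Hashes k Ball Bin) (S : Finset Ball) (T T' : Finset Bin) :
    moved (image C h S T) (image C h S T') ≤ S.card := by
  refine Finset.card_le_card fun y hy => ?_
  by_contra hyS
  refine (Finset.mem_filter.1 hy).2 ?_
  rw [image_eq_capImage, image_eq_capImage, capImage_of_notMem hyS, capImage_of_notMem hyS]

end Expectations

end BoundedLoads

/-! ### Choice of constants and conclusion -/

namespace BoundedLoads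

theorem levels_bounds {ε : ℝ} (hε : 0 < ε) (hε1 : ε < 1) {k : ℕ}
    (hk : k = ⌈Real.logb 2 (1 / ε)⌉₊) :
    0 < k ∧ 1 / ε ≤ 2 ^ k ∧ (2 : ℝ) ^ k ≤ 2 / ε ∧ (k : ℝ) ≤ 4 * Real.log (1 + 1 / ε) := by
  have h1 : 1 < 1 / ε := (one_lt_div hε).2 hε1
  have h0 : 0 < 1 / ε := by linarith
  have hpos : 0 < Real.logb 2 (1 / ε) := Real.logb_pos (by norm_num) h1
  have hle : Real.logb 2 (1 / ε) ≤ k := hk ▸ Nat.le_ceil _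
  have hlt : (k : ℝ) < Real.logb 2 (1 / ε) + 1 := hk ▸ Nat.ceil_lt_add_one hpos.le
  refine ⟨hk ▸ Nat.ceil_pos.2 hpos, ?_, ?_, ?_⟩
  · have := (Real.logb_le_iff_le_rpow (by norm_num) h0).1 hle
    rwa [Real.rpow_natCast] at this
  · have h2 : (2 : ℝ) ^ (k : ℝ) ≤ 2 ^ (Real.logb 2 (1 / ε) + 1) :=
      Real.rpow_le_rpow_of_exponent_le (by norm_num) hlt.le
    rw [Real.rpow_add (by norm_num), Real.rpow_logb (by norm_num) (by norm_num) h0,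
      Real.rpow_natCast, Real.rpow_one] at h2
    calc (2 : ℝ) ^ k ≤ 1 / ε * 2 := h2
      _ = 2 / ε := by ring
  -- With `L = log (1 + 1 / ε)`, both `logb 2 (1 / ε)` and `1` are at most `2 L`, since `1 / 2 < log
  -- 2 ≤ L`.
  · have hl2 : 1 / 2 < Real.log 2 := lt_trans (by norm_num) Real.log_two_gt_d9
    have e : Real.logb 2 (1 / ε) * Real.log 2 = Real.log (1 / ε) := by
      rw [Real.logb, div_mul_cancel₀ _ (by linarith)]
    have h3 : Real.log (1 / ε) ≤ Real.log (1 + 1 / ε) := Real.log_le_log h0 (by linarith)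
    have h4 : Real.log 2 ≤ Real.log (1 + 1 / ε) := Real.log_le_log two_pos (by linarith)
    nlinarith

section Expectations

variable {k : ℕ} {Ball Bin : Type*} [Fintype Ball] [Fintype Bin] [LinearOrder Ball]
  [LinearOrder Bin] {n C : ℕ} {ε : ℝ} {S : Finset Ball} {T : Finset Bin}

/-- Insertion of a ball: the visited bins and the moved balls. -/
theorem Admissible.lintegral_insert_le [NeZero k] (A : Admissible k n C ε (fun _ : Bin => C) S T)
    {x : Ball} (hx : x ∉ S) (d : Bin) :
    ∫⁻ h, (insertVisits C h S T x : ℝ≥0∞) ∂(hashLaw k Ball Bin) ≤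
        ENNReal.ofReal (2 * runConst * 2 ^ (k + 1)) ∧
      ∫⁻ h, (moved (image C h S T) (image C h (insert x S) T) : ℝ≥0∞) ∂(hashLaw k Ball Bin) ≤
        ENNReal.ofReal (2 * runConst * 2 ^ (k + 1)) := by
  refine ⟨(lintegral_mono_ae ?_).trans (A.lintegral_insertion_le hx d),
    (lintegral_mono_ae ?_).trans (A.lintegral_insertion_le hx d)⟩
  · filter_upwards [ae_tieFree] with h hh
    exact Nat.cast_le.2 (insertVisits_le hh hx d A.card_lt)
  · filter_upwards [ae_tieFree] with h hh
    exact Nat.cast_le.2 (moved_insert_le hh hx d A.card_lt)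

theorem Admissible.lintegral_searchVisits_le [NeZero k]
    (A : Admissible k n C ε (fun _ : Bin => C) S T) {x : Ball} (hx : x ∉ S) :
    ∫⁻ h, (searchVisits C h S T x : ℝ≥0∞) ∂(hashLaw k Ball Bin) ≤
      ENNReal.ofReal (2 * runConst * k) :=
  (lintegral_mono fun h => Nat.cast_le.2 (searchVisits_le C h S T x)).trans
    (A.lintegral_run_probe_le hx)

end Expectations

end BoundedLoads

open BoundedLoads

theorem mainTheorem2 :
    ∃ K : ℝ, 0 < K ∧ ∀ δ : ℕ → ℝ, Tendsto δ atTop (𝓝 0) →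
      ∀ᶠ n : ℕ in atTop, ∀ (m C k : ℕ) (ε : ℝ), 0 < m → 0 < ε → ε < 1 →
        (C : ℝ) = (1 + ε) * n / m → k = ⌈Real.logb 2 (1 / ε)⌉₊ → 1 / ε ≤ (n : ℝ) ^ δ n →
        ∀ (Ball Bin : Type*) [Fintype Ball] [LinearOrder Ball] [Fintype Bin] [LinearOrder Bin]
          (S : Finset Ball) (T : Finset Bin), S.card = n → T.card = m →
          -- insertion of a ball: bins visited, balls moved
          (∀ x, x ∉ S →
            ∫⁻ h, (BoundedLoads.insertVisits C h S T x : ℝ≥0∞)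
                ∂(BoundedLoads.hashLaw k Ball Bin) ≤ ENNReal.ofReal (K / ε) ∧
            ∫⁻ h, (BoundedLoads.moved (BoundedLoads.image C h S T)
                (BoundedLoads.image C h (insert x S) T) : ℝ≥0∞)
                ∂(BoundedLoads.hashLaw k Ball Bin) ≤ ENNReal.ofReal (K / ε)) ∧
          -- deletion of a ball: bins visited, balls moved
          (∀ x ∈ S,
            ∫⁻ h, (BoundedLoads.deleteVisits C h S T x : ℝ≥0∞)
                ∂(BoundedLoads.hashLaw k Ball Bin) ≤ ENNReal.ofReal (K / ε) ∧
            ∫⁻ h, (BoundedLoads.moved (BoundedLoads.image C h S T)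
                (BoundedLoads.image C h (S.erase x) T) : ℝ≥0∞)
                ∂(BoundedLoads.hashLaw k Ball Bin) ≤ ENNReal.ofReal (K / ε)) ∧
          -- insertion of a bin: balls moved
          (∀ b, b ∉ T →
            ∫⁻ h, (BoundedLoads.moved (BoundedLoads.image C h S T)
                (BoundedLoads.image C h S (insert b T)) : ℝ≥0∞)
                ∂(BoundedLoads.hashLaw k Ball Bin) ≤ ENNReal.ofReal (K * C / ε)) ∧
          -- deletion of a bin: balls moved
          (∀ b ∈ T,
            ∫⁻ h, (BoundedLoads.moved (BoundedLoads.image C h S T)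
                (BoundedLoads.image C h S (T.erase b)) : ℝ≥0∞)
                ∂(BoundedLoads.hashLaw k Ball Bin) ≤ ENNReal.ofReal (K * C / ε)) ∧
          -- search of a ball: bins visited
          (∀ x,
            ∫⁻ h, (BoundedLoads.searchVisits C h S T x : ℝ≥0∞)
                ∂(BoundedLoads.hashLaw k Ball Bin) ≤
              ENNReal.ofReal (K * Real.log (1 + 1 / ε))) := by
  have hR := runConst_pos
  -- An update costs `4 * runConst * 2 ^ k` with `2 ^ k ≤ 2 / ε`, and a search `2 * runConst * k`
  -- with `k ≤ 4 * log (1 + 1 / ε)`; both lead to the factor `8`.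
  refine ⟨8 * runConst, by positivity, fun δ _ => ?_⟩
  -- For `n ≥ 2` the system without one ball still satisfies `n ≤ 2 * (n - 1)`, as `Admissible`
  -- requires.
  filter_upwards [eventually_ge_atTop 2] with n hn m C k ε hm hε hε1 hC hk _
  intro Ball Bin _ _ _ _ S T hS hT
  obtain ⟨hk0, hlev, hk2, hklog⟩ := levels_bounds hε hε1 hk
  have : NeZero k := ⟨hk0.ne'⟩
  have hn0 : (0 : ℝ) < n := by exact_mod_cast (by omega : 0 < n)
  have hm0 : (0 : ℝ) < m := by exact_mod_cast hm
  have hCm : (m : ℝ) * C = (1 + ε) * n := by rw [hC]; field_simp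
  have hεn : 0 < ε * n := by positivity
  have hC0 : 0 < C := by
    have : (0 : ℝ) < C := by rw [hC]; positivity
    exact_mod_cast this
  have hC1 : (0 : ℝ) < C := by exact_mod_cast hC0
  have hmC : m * C ≤ 2 * n := by
    have : (m : ℝ) * C ≤ 2 * n := by nlinarith
    exact_mod_cast this
  obtain ⟨d, hd⟩ : T.Nonempty := Finset.card_pos.1 (by omega)
  have hball : 2 * runConst * 2 ^ (k + 1) ≤ 8 * runConst / ε := by
    have := mul_le_mul_of_nonneg_left hk2 (by positivity : 0 ≤ 4 * runConst)
    calc 2 * runConst * 2 ^ (k + 1) = 4 * runConst * 2 ^ k := by ring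
      _ ≤ 4 * runConst * (2 / ε) := this
      _ = 8 * runConst / ε := by ring
  have hbin : (C : ℝ) * (runConst * 2 ^ (k + 1)) ≤ 8 * runConst * C / ε := by
    have h1 : (C : ℝ) * (2 * runConst * 2 ^ (k + 1)) ≤ C * (8 * runConst / ε) :=
      mul_le_mul_of_nonneg_left hball hC1.le
    have h2 : 0 ≤ (C : ℝ) * (runConst * 2 ^ (k + 1)) := by positivity
    have h3 : (C : ℝ) * (8 * runConst / ε) = 8 * runConst * C / ε := by ring
    linarith
  have hsearch : 2 * runConst * k ≤ 8 * runConst * Real.log (1 + 1 / ε) := by nlinarith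
  have hA : ∀ S' : Finset Ball, S'.card ≤ n → n ≤ S'.card + 1 →
      Admissible k n C ε (fun _ : Bin => C) S' T := fun S' h1 h2 =>
    { n_pos := by omega
      C_pos := hC0
      ε_pos := hε
      cap_le := fun _ => le_rfl
      card_le := h1
      le_card := by omega
      bins := by rw [hT]; omega
      room := by
        have : (S'.card : ℝ) ≤ n := by exact_mod_cast h1
        rw [Finset.sum_const, nsmul_eq_mul, hT, hCm]
        linarith
      levels := hlev }
  have herase : ∀ x ∈ S, Admissible k n C ε (fun _ : Bin => C) (S.erase x) T := fun x hx => by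
    have := Finset.card_erase_add_one hx
    exact hA _ (by omega) (by omega)
  refine ⟨fun x hx => ?_, fun x hx => ?_, fun b hb => ?_, fun b hb => ?_, fun x => ?_⟩
  · obtain ⟨h1, h2⟩ := (hA S hS.le (by omega)).lintegral_insert_le hx d
    exact ⟨h1.trans (ENNReal.ofReal_le_ofReal hball), h2.trans (ENNReal.ofReal_le_ofReal hball)⟩
  · obtain ⟨h1, h2⟩ := (herase x hx).lintegral_insert_le (Finset.notMem_erase x S) d
    refine ⟨h1.trans (ENNReal.ofReal_le_ofReal hball), ?_⟩
    simp only [Finset.insert_erase hx, moved_comm _ (image C _ S T)] at h2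
    exact h2.trans (ENNReal.ofReal_le_ofReal hball)
  -- Inserting `b` is the reverse of deleting it from `insert b T`. The larger system has `(m + 1) *
  -- C ≤ 2 * (m * C) ≤ 4 * n`.
  · have h1 := lintegral_moved_erase_le (k := k) (T := insert b T) (b := b) (by omega) hS hC0 hε
      (by rw [Finset.card_insert_of_notMem hb, hT]; nlinarith) hlev (Finset.mem_insert_self b T)
      (by rw [Finset.erase_insert hb, hT, hCm]; linarith)
    simp only [Finset.erase_insert hb, moved_comm (image C _ S (insert b T))] at h1
    exact h1.trans (ENNReal.ofReal_le_ofReal hbin)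
  -- If `C` exceeds half of the slack, the remaining bins may be too small for `Admissible`, but
  -- then even moving all `n < 2 * C / ε` balls is affordable. Otherwise the slack `ε * n / 2` is
  -- left.
  · rcases lt_or_ge (ε * n / 2) (C : ℝ) with hbig | hsmall
    · calc ∫⁻ h, (moved (image C h S T) (image C h S (T.erase b)) : ℝ≥0∞) ∂(hashLaw k Ball Bin)
          ≤ ∫⁻ _, (n : ℝ≥0∞) ∂(hashLaw k Ball Bin) := lintegral_mono fun h =>
            Nat.cast_le.2 (hS ▸ moved_image_le h S T (T.erase b))
        _ = ENNReal.ofReal n := by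
            rw [lintegral_const, measure_univ, mul_one, ENNReal.ofReal_natCast]
        _ ≤ _ := by
            refine ENNReal.ofReal_le_ofReal ((le_div_iff₀ hε).2 ?_)
            have : 1 ≤ runConst := by unfold runConst; norm_num
            nlinarith
    · refine (lintegral_moved_erase_le (by omega) hS hC0 hε (by rw [hT]; omega) hlev hb ?_).trans
        (ENNReal.ofReal_le_ofReal hbin)
      have : ((T.erase b).card : ℝ) + 1 = m := by
        rw [← hT]
        exact_mod_cast Finset.card_erase_add_one hb
      nlinarith
  · have h1 : ∫⁻ h, (searchVisits C h S T x : ℝ≥0∞) ∂(hashLaw k Ball Bin) ≤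
        ENNReal.ofReal (2 * runConst * k) := by
      -- A ball of the system is taken out first, so that its point is independent of the image that
      -- it is searched in.
      by_cases hx : x ∈ S
      · simp only [searchVisits_erase C _ S T x]
        exact (herase x hx).lintegral_searchVisits_le (Finset.notMem_erase x S)
      · exact (hA S hS.le (by omega)).lintegral_searchVisits_le hx
    exact h1.trans (ENNReal.ofReal_le_ofReal hsearch)
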